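/- Let $l\ge 2$ and $n\ge 2$ be integers, $k\in\mathbb{C}$, $N=ln$, and assume $\alpha:=k+(l-1)n\neq 0$. Let $\kappa$ be the invariant symmetric bilinear form on $\mathfrak{g}=\mathfrak{gl}_N$ with $\kappa(E_{i,j},E_{p,q})=k\,\delta_{iq}\delta_{jp}+\delta_{ij}\delta_{pq}$, let $f\in\mathfrak{gl}_N$ be the nilpotent element of Jordan type $(l^n)$ given by $f=\sum_{s=1}^{l-1}\sum_{i=1}^{n}E_{sn+i,(s-1)n+i}$, and let $\mathcal{W}=\mathcal{W}^{\kappa}(\mathfrak{gl}_N,(l^n))$ be the corresponding rectangular $W$-algebra. It is regarded, through the Miura map, as a vertex subalgebra of the universal affine vertex algebra $V^{\tilde\kappa}(\mathfrak{g}_0)$ of $\mathfrak{g}_0=\mathfrak{gl}_n^{\oplus l}$, where, with $E^{[s]}_{i,j}$ the matrix unit in the $s$-th summand, $\tilde\kappa(E^{[s]}_{i,j},E^{[t]}_{p,q})=\delta_{st}(\alpha\,\delta_{iq}\delta_{jp}+\delta_{ij}\delta_{pq})$. Namely, write $X[-m]=X(-m)|0\rangle$ with $X(m)=Xt^m$,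 let $A^{[s]}$ be the $n\times n$ matrix with entries $E^{[s]}_{i,j}[-1]_{(-1)}$, let $\tau$ be a formal operator with $[X[-m],\tau]=\alpha m X[-m-1]$ for $X\in\mathfrak{g}_0$, $m\ge1$, and define $W^{(r)}=(W^{(r)}_{i,j})_{1\le i,j\le n}$, $1\le r\le l$, by $$(\tau+A^{[1]})(\tau+A^{[2]})\cdots(\tau+A^{[l]})=\tau^l+\sum_{r=1}^{l}\tau^{l-r}W^{(r)},$$ where a product of operators $X_1[-m_1]_{(-1)}\cdots X_a[-m_a]_{(-1)}$ stands for the vector $X_1(-m_1)\cdots X_a(-m_a)|0\rangle$; then $\mathcal{W}$ is the vertex subalgebra of $V^{\tilde\kappa}(\mathfrak{g}_0)$ generated by all $W^{(r)}_{i,j}$, $1\le r\le l$, $1\le i,j\le n$. For a conformally graded vertex algebra $V$, let $\mathfrak{U}(V)$ be its current algebra: the quotient of the standard degreewise completion $\bigoplus_{d}\varprojlim_{m}\bigl(A_d/\sum_{r>m}A_{d-r}A_r\bigr)$ of the free associative algebra $A=\bigoplus_d A_d$ on the symbols $vt^m$ ($v\in V$, $m\in\mathbb{Z}$, linear in $v$,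 with $\deg vt^m=m-\Delta+1$ for $v$ of conformal weight $\Delta$) by the closed two-sided ideal generated by the relations $|0\rangle t^m=\delta_{m,-1}$ and the Borcherds identities $$\sum_{j\ge0}\tbinom{p}{j}(u_{(r+j)}v)t^{p+q-j}=\sum_{j\ge0}(-1)^j\tbinom{r}{j}\bigl(ut^{p+r-j}\,vt^{q+j}-(-1)^r\,vt^{q+r-j}\,ut^{p+j}\bigr)$$ for all $u,v\in V$ and $p,q,r\in\mathbb{Z}$. Put $W^{(r)}_{i,j}(m)=W^{(r)}_{i,j}t^{m+r-1}\in\mathfrak{U}(\mathcal{W})$. Then $\mathfrak{U}(\mathcal{W})$ is topologically generated by $$\{W^{(1)}_{n,1}(1),\ W^{(1)}_{1,n}(-1)\}\cup\{W^{(1)}_{i,i+1}(0),\ W^{(1)}_{i+1,i}(0),\ W^{(2)}_{i,i+1}(0)\mid i=1,\dots,n-1\},$$ that is, the unital $\mathbb{C}$-subalgebra generated by these elements is dense in $\mathfrak{U}(\mathcal{W})$. -/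

import Mathlib

noncomputable section

attribute [local instance 100] LieRing.ofAssociativeRing

namespace RectW

section
variable (M : Type*) [AddCommGroup M] [Module ℂ M]

/-- The space of fields `a(z) = ∑ a_m z^(-m-1)` on `M`: for each `v` we have `a_m v = 0` for all
large `m`. -/
def Fields : Submodule ℂ (ℤ → Module.End ℂ M) where
  carrier := {a | ∀ v, ∃ N : ℤ, ∀ m, N ≤ m → a m v = 0}
  zero_mem' := fun v => ⟨0, fun m _ => rfl⟩
  add_mem' := by
    intro a b ha hb v
    obtain ⟨N, hN⟩ := ha v
    obtain ⟨N', hN'⟩ := hb v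
    refine ⟨max N N', fun m hm => ?_⟩
    simp [hN m (le_trans (le_max_left _ _) hm), hN' m (le_trans (le_max_right _ _) hm)]
  smul_mem' := by
    intro c a ha v
    obtain ⟨N, hN⟩ := ha v
    exact ⟨N, fun m hm => by simp [hN m hm]⟩

variable {M}

/-- The coefficient `(-1)^j * binom(p, j)` of `x ^ (p - j) * z ^ j` in the expansion of
`(x - z) ^ p` in the domain `|x| > |z|`. -/
def expCoeff (p : ℤ) (j : ℕ) : ℤ := (-1) ^ j * Ring.choose p j

theorem expCoeff_zero (p : ℤ) : expCoeff p 0 = 1 := by simp [expCoeff]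

theorem expCoeff_add (p q : ℤ) (s : ℕ) :
    ∑ x ∈ Finset.HasAntidiagonal.antidiagonal s, expCoeff p x.1 * expCoeff q x.2 = expCoeff (p + q) s := by
  unfold expCoeff
  rw [Ring.add_choose_eq s (Commute.all p q), Finset.mul_sum]
  refine Finset.sum_congr rfl fun x hx => ?_
  rw [← Finset.HasAntidiagonal.mem_antidiagonal.mp hx, pow_add]
  ring

theorem sub_mul_expCoeff (p : ℤ) (j : ℕ) :
    (p - j) * expCoeff p j = p * expCoeff (p - 1) j := by
  unfold expCoeff
  have h1 : (p - j) * Ring.choose p j = p * Ring.choose (p - 1) j := by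
    have a := Ring.choose_smul_choose p (Nat.le_succ j)
    have b := Ring.choose_smul_choose p (Nat.succ_le_succ (Nat.zero_le j))
    simp only [Nat.choose_succ_self_right, Nat.succ_sub (le_refl j), Nat.sub_self, Nat.choose_one_right,
      Ring.choose_one_right, nsmul_eq_mul, Nat.succ_eq_add_one, zero_add, Nat.add_sub_cancel, Nat.cast_one] at a b
    linarith
  linear_combination (-1) ^ j * h1

theorem sum_sub_mul_expCoeff (p q : ℤ) (s : ℕ) (h : p + q = s) :
    ∑ x ∈ Finset.HasAntidiagonal.antidiagonal s, (p - x.1) * (expCoeff p x.1 * expCoeff q x.2) =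
      if s = 0 then p else 0 := by
  simp only [← mul_assoc, sub_mul_expCoeff]
  simp only [mul_assoc, ← Finset.mul_sum, expCoeff_add]
  rw [show p - 1 + q = (s : ℤ) - 1 by omega]
  cases s with
  | zero => simp [expCoeff]
  | succ t =>
    have : ((t + 1 : ℕ) : ℤ) - 1 = (t : ℤ) := by simp
    rw [this, expCoeff, Ring.choose_natCast]
    simp

theorem sum_range_range {A : Type*} [AddCommGroup A] (F : ℕ → ℕ → A) (N : ℕ)
    (hF : ∀ i j, N ≤ i + j → F i j = 0) :
    ∑ i ∈ Finset.range N, ∑ j ∈ Finset.range N, F i j =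
      ∑ s ∈ Finset.range N, ∑ x ∈ Finset.HasAntidiagonal.antidiagonal s, F x.1 x.2 := by
  rw [← Finset.sum_product', ← Finset.sum_filter_of_ne (p := fun x : ℕ × ℕ => x.1 + x.2 < N)
    (fun x _ hx => by by_contra h; exact hx (hF _ _ (not_lt.mp h))),
    Finset.sum_sigma' (Finset.range N)]
  refine Finset.sum_bij' (fun x _ => ⟨x.1 + x.2, x⟩) (fun y _ => y.2) ?_ ?_ ?_ ?_ ?_
  · intro x hx; simp at hx ⊢; exact hx.2
  · rintro ⟨s, x⟩ hx; simp at hx ⊢; omega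
  · intro x hx; rfl
  · rintro ⟨s, x⟩ hx; simp at hx; obtain ⟨_, rfl⟩ := hx; rfl
  · intro x hx; rfl

theorem finsum_eq_range {A : Type*} [AddCommGroup A] {f : ℕ → A} {N : ℕ}
    (hf : ∀ j, N ≤ j → f j = 0) : ∑ᶠ j, f j = ∑ j ∈ Finset.range N, f j := by
  refine finsum_eq_sum_of_support_subset f fun j hj => ?_
  simp only [Finset.coe_range, Set.mem_Iio]
  by_contra h
  exact hj (hf j (not_lt.mp h))

theorem exists_nat (b : Fields M) (k : ℤ) (v : M) :
    ∃ N : ℕ, ∀ j : ℕ, N ≤ j → b.1 (k + j) v = 0 := by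
  obtain ⟨N, hN⟩ := b.2 v
  exact ⟨(N - k).toNat, fun j hj => hN _ (by omega)⟩

/-- The field `Res_x (x - z)^p a(x) b(z)`, expanded in the domain `|x| > |z|`, as a function of
`b`. -/
def prodLeft (a : Fields M) (p : ℤ) : Module.End ℂ (Fields M) where
  toFun b := ⟨fun k =>
    { toFun := fun v => ∑ᶠ j : ℕ, expCoeff p j • a.1 (p - j) (b.1 (k + j) v)
      map_add' := fun v w => by
        obtain ⟨N, hN⟩ := exists_nat b k v
        obtain ⟨N', hN'⟩ := exists_nat b k w
        rw [finsum_eq_range (N := max N N'), finsum_eq_range (N := max N N'),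
          finsum_eq_range (N := max N N'), ← Finset.sum_add_distrib]
        · simp
        all_goals
          intro j hj
          simp [hN j (le_trans (le_max_left _ _) hj), hN' j (le_trans (le_max_right _ _) hj)]
      map_smul' := fun c v => by
        obtain ⟨N, hN⟩ := exists_nat b k v
        rw [finsum_eq_range (N := N), finsum_eq_range (N := N), RingHom.id_apply, Finset.smul_sum]
        · refine Finset.sum_congr rfl fun j _ => ?_
          simp [smul_comm c]
        all_goals
          intro j hj
          simp [hN j hj] },
    fun v => by
      obtain ⟨N, hN⟩ := b.2 v
      refine ⟨N, fun m hm => ?_⟩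
      simp only [LinearMap.coe_mk, AddHom.coe_mk]
      rw [finsum_eq_range (N := 0) (fun j _ => by simp [hN (m + j) (by omega)])]
      simp⟩
  map_add' b c := by
    ext k v
    obtain ⟨N, hN⟩ := exists_nat b k v
    obtain ⟨N', hN'⟩ := exists_nat c k v
    simp only [Submodule.coe_add, Pi.add_apply, LinearMap.add_apply, LinearMap.coe_mk, AddHom.coe_mk]
    rw [finsum_eq_range (N := max N N'), finsum_eq_range (N := max N N'),
      finsum_eq_range (N := max N N'), ← Finset.sum_add_distrib]
    · simp
    all_goals
      intro j hj
      simp [hN j (le_trans (le_max_left _ _) hj), hN' j (le_trans (le_max_right _ _) hj)]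
  map_smul' c b := by
    ext k v
    obtain ⟨N, hN⟩ := exists_nat b k v
    simp only [Submodule.coe_smul, Pi.smul_apply, LinearMap.smul_apply, LinearMap.coe_mk,
      AddHom.coe_mk, RingHom.id_apply]
    rw [finsum_eq_range (N := N), finsum_eq_range (N := N), Finset.smul_sum]
    · refine Finset.sum_congr rfl fun j _ => ?_
      simp [smul_comm c]
    all_goals
      intro j hj
      simp [hN j hj]

theorem prodLeft_apply (a b : Fields M) (p k : ℤ) (v : M) {N : ℕ}
    (hN : ∀ j : ℕ, N ≤ j → b.1 (k + j) v = 0) :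
    (prodLeft a p b).1 k v =
      ∑ j ∈ Finset.range N, expCoeff p j • a.1 (p - j) (b.1 (k + j) v) :=
  finsum_eq_range fun j hj => by simp [hN j hj]

/-- The field `Res_x (x - z)^p b(z) a(x)`, expanded in the domain `|z| > |x|`, as a function of
`b`. -/
def prodRight (a : Fields M) (p : ℤ) : Module.End ℂ (Fields M) where
  toFun b := ⟨fun k =>
    { toFun := fun v => ∑ᶠ j : ℕ, (p.negOnePow * expCoeff p j) • b.1 (p + k - j) (a.1 j v)
      map_add' := fun v w => by
        obtain ⟨N, hN⟩ := exists_nat a 0 v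
        obtain ⟨N', hN'⟩ := exists_nat a 0 w
        simp only [zero_add] at hN hN'
        rw [finsum_eq_range (N := max N N'), finsum_eq_range (N := max N N'),
          finsum_eq_range (N := max N N'), ← Finset.sum_add_distrib]
        · simp
        all_goals
          intro j hj
          simp [hN j (le_trans (le_max_left _ _) hj), hN' j (le_trans (le_max_right _ _) hj)]
      map_smul' := fun c v => by
        obtain ⟨N, hN⟩ := exists_nat a 0 v
        simp only [zero_add] at hN
        rw [finsum_eq_range (N := N), finsum_eq_range (N := N), RingHom.id_apply, Finset.smul_sum]
        · refine Finset.sum_congr rfl fun j _ => ?_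
          simp [smul_comm c]
        all_goals
          intro j hj
          simp [hN j hj] },
    fun v => by
      obtain ⟨N, hN⟩ := exists_nat a 0 v
      simp only [zero_add] at hN
      choose K hK using fun j : ℕ => b.2 (a.1 j v)
      refine ⟨∑ j ∈ Finset.range N, |K j| + N - p, fun m hm => ?_⟩
      simp only [LinearMap.coe_mk, AddHom.coe_mk]
      rw [finsum_eq_range (N := N) (fun j hj => by simp [hN j hj])]
      refine Finset.sum_eq_zero fun j hj => ?_
      have h1 := Finset.single_le_sum (f := fun j => |K j|) (fun i _ => abs_nonneg _) hj
      have h2 := le_abs_self (K j)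
      have h3 := Finset.mem_range.mp hj
      rw [hK j _ (by omega), smul_zero]⟩
  map_add' b c := by
    ext k v
    obtain ⟨N, hN⟩ := exists_nat a 0 v
    simp only [zero_add] at hN
    simp only [Submodule.coe_add, Pi.add_apply, LinearMap.add_apply, LinearMap.coe_mk, AddHom.coe_mk]
    rw [finsum_eq_range (N := N), finsum_eq_range (N := N),
      finsum_eq_range (N := N), ← Finset.sum_add_distrib]
    · simp
    all_goals
      intro j hj
      simp [hN j hj]
  map_smul' c b := by
    ext k v
    obtain ⟨N, hN⟩ := exists_nat a 0 v
    simp only [zero_add] at hN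
    simp only [Submodule.coe_smul, Pi.smul_apply, LinearMap.smul_apply, LinearMap.coe_mk,
      AddHom.coe_mk, RingHom.id_apply]
    rw [finsum_eq_range (N := N), finsum_eq_range (N := N), Finset.smul_sum]
    · refine Finset.sum_congr rfl fun j _ => ?_
      simp [smul_comm c]
    all_goals
      intro j hj
      simp [hN j hj]

theorem prodRight_apply (a b : Fields M) (p k : ℤ) (v : M) {N : ℕ}
    (hN : ∀ j : ℕ, N ≤ j → a.1 j v = 0) :
    (prodRight a p b).1 k v =
      ∑ j ∈ Finset.range N, (p.negOnePow * expCoeff p j) • b.1 (p + k - j) (a.1 j v) :=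
  finsum_eq_range fun j hj => by simp [hN j hj]

/-- The `p`-th residue product `a(z)_(p) b(z) = Res_x ((x - z)^p a(x) b(z) - (x - z)^p b(z) a(x))`
of fields, where `(x - z)^p` is expanded in `|x| > |z|` in the first term and in `|z| > |x|` in the
second one. -/
def fieldProd (a : Fields M) (p : ℤ) : Module.End ℂ (Fields M) := prodLeft a p - prodRight a p

variable (M) in
/-- The constant field `id_M`. -/
def idField : Fields M :=
  ⟨fun k => if k = -1 then 1 else 0, fun v => ⟨0, fun m hm => by
    have : m ≠ -1 := by omega
    simp [this]⟩⟩

theorem fieldProd_idField (a : Fields M) (p : ℤ) (hp : 0 ≤ p) : fieldProd a p (idField M) = 0 := by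
  lift p to ℕ using hp
  refine Subtype.ext (funext fun k => LinearMap.ext fun v => ?_)
  obtain ⟨N, hN⟩ := exists_nat a 0 v
  simp only [zero_add] at hN
  have h1 : ∀ j : ℕ, N + p + (-k).toNat ≤ j → a.1 j v = 0 := fun j hj => hN j (by omega)
  have h2 : ∀ j : ℕ, N + p + (-k).toNat ≤ j → (idField M).1 (k + j) v = 0 := fun j hj => by
    have : k + j ≠ -1 := by omega
    simp [idField, this]
  simp only [fieldProd, LinearMap.sub_apply, Submodule.coe_sub, Pi.sub_apply]
  rw [prodLeft_apply _ _ _ _ _ h2, prodRight_apply _ _ _ _ _ h1]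
  change _ = (0 : M)
  rw [sub_eq_zero]
  have hL : ∀ j : ℕ, expCoeff p j • a.1 (p - j) ((idField M).1 (k + j) v) =
      if j = (-1 - k).toNat then (if k ≤ -1 then expCoeff p j • a.1 (p + k + 1) v else 0)
      else 0 := by
    intro j
    by_cases hk : k + j = -1
    · rw [if_pos (by omega), if_pos (by omega), show (p : ℤ) - j = p + k + 1 by omega]
      simp [idField, hk]
    · have : (idField M).1 (k + j) v = 0 := by simp [idField, hk]
      rw [this, map_zero, smul_zero]
      split_ifs <;> first | rfl | omega
  have hR : ∀ j : ℕ, (((p : ℤ).negOnePow : ℤ) * expCoeff p j) •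
        (idField M).1 (p + k - j) (a.1 j v) =
      if j = (p + k + 1).toNat then (if 0 ≤ p + k + 1 then
        (((p : ℤ).negOnePow : ℤ) * expCoeff p j) • a.1 (p + k + 1) v else 0) else 0 := by
    intro j
    by_cases hk : (p : ℤ) + k - j = -1
    · rw [if_pos (by omega), if_pos (by omega), show (p : ℤ) + k + 1 = j by omega]
      simp [idField, hk]
    · have : (idField M).1 (p + k - j) (a.1 j v) = 0 := by simp [idField, hk]
      rw [this, smul_zero]
      split_ifs <;> first | rfl | omega
  rw [Finset.sum_congr rfl fun j _ => hL j, Finset.sum_congr rfl fun j _ => hR j,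
    Finset.sum_ite_eq', Finset.sum_ite_eq']
  by_cases hk1 : k ≤ -1
  · by_cases hk2 : (0 : ℤ) ≤ p + k + 1
    · obtain ⟨i, rfl⟩ : ∃ i : ℕ, k = -1 - i := ⟨(-1 - k).toNat, by omega⟩
      obtain ⟨t, rfl⟩ : ∃ t : ℕ, p = i + t := ⟨p - i, by omega⟩
      have e1 : (-1 - (-1 - (i : ℤ))).toNat = i := by omega
      have e2 : (((i + t : ℕ) : ℤ) + (-1 - (i : ℤ)) + 1).toNat = t := by omega
      have e3 : expCoeff (i + t : ℕ) i =
          ((((i + t : ℕ) : ℤ).negOnePow : ℤ) * expCoeff (i + t : ℕ) t) := by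
        rw [expCoeff, expCoeff, Ring.choose_natCast, Ring.choose_natCast,
          Nat.choose_symm_add, Int.negOnePow_def, zpow_natCast]
        push_cast
        have : (-1 : ℤ) ^ (i + t) * (-1) ^ t = (-1) ^ i := by
          rw [pow_add, mul_assoc, ← mul_pow]
          simp
        rw [← mul_assoc, this]
      rw [e1, e2, if_pos hk1, if_pos hk2, ← e3]
      by_cases ht : N ≤ t
      · have : a.1 (((i + t : ℕ) : ℤ) + (-1 - (i : ℤ)) + 1) v = 0 := by
          rw [show ((i + t : ℕ) : ℤ) + (-1 - (i : ℤ)) + 1 = t by omega]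
          exact hN t ht
        rw [this, smul_zero]
        simp only [ite_self]
      · rw [if_pos (by simp; omega), if_pos (by simp; omega)]
    · rw [if_neg hk2, if_pos hk1, expCoeff,
        show Ring.choose (p : ℤ) (-1 - k).toNat = 0 by
          rw [Ring.choose_natCast, Nat.choose_eq_zero_of_lt (by omega), Nat.cast_zero]]
      simp
  · rw [if_neg hk1, expCoeff,
      show Ring.choose (p : ℤ) ((p : ℤ) + k + 1).toNat = 0 by
        rw [Ring.choose_natCast, Nat.choose_eq_zero_of_lt (by omega), Nat.cast_zero]]
    simp

theorem commute_left_right (a b : Fields M) (p q : ℤ) (c : Fields M) :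
    prodLeft a p (prodRight b q c) = prodRight b q (prodLeft a p c) := by
  refine Subtype.ext (funext fun k => LinearMap.ext fun v => ?_)
  obtain ⟨N, hN⟩ := exists_nat b 0 v
  simp only [zero_add] at hN
  choose K hK using fun j : ℕ => exists_nat c (q + k - j) (b.1 j v)
  obtain ⟨K', hK'⟩ := exists_nat (prodRight b q c) k v
  have e : ∀ j < N, K j ≤ ∑ j ∈ Finset.range N, K j := fun j hj =>
    Finset.single_le_sum (f := K) (fun i _ => Nat.zero_le _) (Finset.mem_range.mpr hj)
  rw [prodLeft_apply _ _ _ _ _ (N := K' + ∑ j ∈ Finset.range N, K j)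
    (fun j hj => hK' j (by omega)), prodRight_apply _ _ _ _ _ hN]
  simp only [prodRight_apply _ _ _ _ _ hN, map_sum, Finset.smul_sum]
  rw [Finset.sum_comm]
  refine Finset.sum_congr rfl fun j hj => ?_
  rw [prodLeft_apply _ _ _ _ _ (N := K' + ∑ j ∈ Finset.range N, K j)
    (fun i hi => hK j i (by have := e j (Finset.mem_range.mp hj); omega)), Finset.smul_sum]
  refine Finset.sum_congr rfl fun i _ => ?_
  rw [map_zsmul, smul_comm, show q + k - j + (i : ℤ) = q + (k + i) - j by ring]

theorem comm_left (a b c : Fields M) (κ : ℂ)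
    (h : ∀ m n v, a.1 m (b.1 n v) - b.1 n (a.1 m v) =
      c.1 (m + n) v + (if m + n = 0 then (m : ℂ) * κ else 0) • v) (p q : ℤ) (d : Fields M) :
    prodLeft a p (prodLeft b q d) - prodLeft b q (prodLeft a p d) =
      prodLeft c (p + q) d + (if p + q = 0 then (p : ℂ) * κ else 0) • d := by
  refine Subtype.ext (funext fun k => LinearMap.ext fun v => ?_)
  obtain ⟨N, hN⟩ := exists_nat d k v
  replace hN : ∀ j : ℕ, N + 1 ≤ j → d.1 (k + j) v = 0 := fun j hj => hN j (by omega)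
  set N' := N + 1 with hN'
  have hz : ∀ (a : Fields M) (p : ℤ), ∀ j : ℕ, N' ≤ j → (prodLeft a p d).1 (k + j) v = 0 := by
    intro a p j hj
    rw [prodLeft_apply _ _ _ _ _ (N := 0)]
    · simp
    · intro i _
      rw [add_assoc, ← Nat.cast_add]
      exact hN _ (by omega)
  have key : ∀ (a b : Fields M) (p q : ℤ), (prodLeft a p (prodLeft b q d)).1 k v =
      ∑ i ∈ Finset.range N', ∑ j ∈ Finset.range N', (expCoeff p i * expCoeff q j) •
        a.1 (p - i) (b.1 (q - j) (d.1 (k + (i + j : ℕ)) v)) := by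
    intro a b p q
    rw [prodLeft_apply _ _ _ _ _ (hz b q)]
    refine Finset.sum_congr rfl fun i _ => ?_
    rw [prodLeft_apply _ _ _ _ _ (N := N') (fun j hj => by
      rw [add_assoc, ← Nat.cast_add]
      exact hN _ (by omega)), map_sum, Finset.smul_sum]
    refine Finset.sum_congr rfl fun j _ => ?_
    rw [map_zsmul, smul_smul, Nat.cast_add, add_assoc]
  simp only [Submodule.coe_sub, Submodule.coe_add, Submodule.coe_smul, Pi.sub_apply, Pi.add_apply,
    Pi.smul_apply, LinearMap.sub_apply, LinearMap.add_apply, LinearMap.smul_apply]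
  rw [key, key, Finset.sum_comm (f := fun i j => (expCoeff q i * expCoeff p j) • _),
    prodLeft_apply _ _ _ _ _ hN, ← Finset.sum_sub_distrib]
  simp only [← Finset.sum_sub_distrib]
  have e1 : ∀ i j : ℕ, (expCoeff p i * expCoeff q j) •
        a.1 (p - i) (b.1 (q - j) (d.1 (k + (i + j : ℕ)) v)) - (expCoeff q j * expCoeff p i) •
        b.1 (q - j) (a.1 (p - i) (d.1 (k + (j + i : ℕ)) v)) =
      (expCoeff p i * expCoeff q j) • c.1 (p + q - (i + j : ℕ)) (d.1 (k + (i + j : ℕ)) v) +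
      ((p - i) * (expCoeff p i * expCoeff q j)) •
        (if p + q = (i + j : ℕ) then κ else 0) • d.1 (k + (i + j : ℕ)) v := by
    intro i j
    rw [mul_comm (expCoeff q j), add_comm j i, ← smul_sub, h, smul_add,
      show p - i + (q - j) = p + q - (i + j : ℕ) by push_cast; ring]
    congr 1
    rw [mul_comm ((p : ℤ) - i), mul_smul (expCoeff p i * expCoeff q j)]
    congr 1
    have : p + q - ((i + j : ℕ) : ℤ) = 0 ↔ p + q = (i + j : ℕ) := sub_eq_zero
    simp only [this]
    split_ifs
    · rw [mul_smul, ← Int.cast_smul_eq_zsmul ℂ]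
    · simp
  simp only [e1]
  rw [sum_range_range (fun i j => (expCoeff p i * expCoeff q j) • c.1 (p + q - (i + j : ℕ))
        (d.1 (k + (i + j : ℕ)) v) + ((p - i) * (expCoeff p i * expCoeff q j)) •
        (if p + q = (i + j : ℕ) then κ else 0) • d.1 (k + (i + j : ℕ)) v) N'
      (fun i j hij => by simp only [hN _ hij]; simp)]
  have e2 : ∀ s ∈ Finset.range N', (∑ x ∈ Finset.HasAntidiagonal.antidiagonal s,
      ((expCoeff p x.1 * expCoeff q x.2) • c.1 (p + q - (x.1 + x.2 : ℕ))
        (d.1 (k + (x.1 + x.2 : ℕ)) v) + ((p - x.1) * (expCoeff p x.1 * expCoeff q x.2)) •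
        (if p + q = (x.1 + x.2 : ℕ) then κ else 0) • d.1 (k + (x.1 + x.2 : ℕ)) v)) =
      expCoeff (p + q) s • c.1 (p + q - s) (d.1 (k + s) v) +
        if s = 0 then (if p + q = 0 then (p : ℂ) * κ else 0) • d.1 k v else 0 := by
    intro s _
    rw [Finset.sum_congr rfl (g := fun x => (expCoeff p x.1 * expCoeff q x.2) •
        c.1 (p + q - s) (d.1 (k + s) v) + ((p - x.1) * (expCoeff p x.1 * expCoeff q x.2)) •
        (if p + q = s then κ else 0) • d.1 (k + s) v) (fun x hx => by
          rw [Finset.HasAntidiagonal.mem_antidiagonal.mp hx]), Finset.sum_add_distrib, ← Finset.sum_smul,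
      ← Finset.sum_smul, expCoeff_add]
    congr 1
    split_ifs with h1 h2 h3 h4 h5
    · subst h2
      rw [sum_sub_mul_expCoeff p q 0 (by simpa using h1), if_pos rfl]
      simp [mul_smul, Int.cast_smul_eq_zsmul]
    · subst h2; simp at h1; exact absurd h1 h3
    · rw [sum_sub_mul_expCoeff p q s h1, if_neg h2, zero_smul]
    · subst h4; simp at h1; exact absurd h5 h1
    · simp
    · simp
  rw [Finset.sum_congr rfl e2, Finset.sum_add_distrib, Finset.sum_ite_eq' (Finset.range N') 0,
    if_pos (by simp [hN'])]

theorem comm_right (a b c : Fields M) (κ : ℂ)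
    (h : ∀ m n v, a.1 m (b.1 n v) - b.1 n (a.1 m v) =
      c.1 (m + n) v + (if m + n = 0 then (m : ℂ) * κ else 0) • v) (p q : ℤ) (d : Fields M) :
    prodRight a p (prodRight b q d) - prodRight b q (prodRight a p d) =
      - prodRight c (p + q) d := by
  refine Subtype.ext (funext fun k => LinearMap.ext fun v => ?_)
  have bound : ∀ a b : Fields M, ∃ N : ℕ, (∀ j : ℕ, N ≤ j → a.1 j v = 0) ∧
      ∀ i j : ℕ, N ≤ i + j → b.1 j (a.1 i v) = 0 := by
    intro a b
    obtain ⟨N, hN⟩ := exists_nat a 0 v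
    simp only [zero_add] at hN
    choose K hK using fun j : ℕ => exists_nat b 0 (a.1 j v)
    simp only [zero_add] at hK
    refine ⟨N + ∑ j ∈ Finset.range N, K j, fun j hj => hN j (by omega), fun i j hij => ?_⟩
    by_cases hi : i < N
    · have := Finset.single_le_sum (f := K) (fun i _ => Nat.zero_le _) (Finset.mem_range.mpr hi)
      exact hK i j (by omega)
    · rw [hN i (by omega), map_zero]
  obtain ⟨N1, h1, h2⟩ := bound a b
  obtain ⟨N2, h3, h4⟩ := bound b a
  obtain ⟨N3, h5⟩ := exists_nat c 0 v
  simp only [zero_add] at h5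
  set N := N1 + N2 + N3 with hN
  have key : ∀ (a b : Fields M) (p q : ℤ), (∀ j : ℕ, N ≤ j → a.1 j v = 0) →
      (∀ i j : ℕ, N ≤ i + j → b.1 j (a.1 i v) = 0) →
      (prodRight a p (prodRight b q d)).1 k v =
      ∑ i ∈ Finset.range N, ∑ j ∈ Finset.range N,
        (((p + q).negOnePow : ℤ) * (expCoeff p i * expCoeff q j)) •
        d.1 (p + q + k - (i + j : ℕ)) (b.1 j (a.1 i v)) := by
    intro a b p q h1 h2
    rw [prodRight_apply _ _ _ _ _ h1]
    refine Finset.sum_congr rfl fun i _ => ?_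
    rw [prodRight_apply _ _ _ _ _ (N := N) (fun j hj => h2 i j (by omega)), Finset.smul_sum]
    refine Finset.sum_congr rfl fun j _ => ?_
    rw [smul_smul, Int.negOnePow_add]
    congr 1
    · push_cast; ring_nf
    · congr 2
      push_cast; ring_nf
  simp only [Submodule.coe_sub, Submodule.coe_neg, Pi.sub_apply, Pi.neg_apply,
    LinearMap.sub_apply, LinearMap.neg_apply]
  rw [key a b p q (fun j hj => h1 j (by omega)) (fun i j hij => h2 i j (by omega)),
    key b a q p (fun j hj => h3 j (by omega)) (fun i j hij => h4 i j (by omega)),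
    Finset.sum_comm (f := fun i j => (((q + p).negOnePow : ℤ) * (expCoeff q i * expCoeff p j)) • _),
    prodRight_apply _ _ _ _ _ (N := N) (fun j hj => h5 j (by omega)), ← Finset.sum_sub_distrib]
  simp only [← Finset.sum_sub_distrib]
  have e1 : ∀ i j : ℕ, (((p + q).negOnePow : ℤ) * (expCoeff p i * expCoeff q j)) •
        d.1 (p + q + k - (i + j : ℕ)) (b.1 j (a.1 i v)) -
        (((q + p).negOnePow : ℤ) * (expCoeff q j * expCoeff p i)) •
        d.1 (q + p + k - (j + i : ℕ)) (a.1 i (b.1 j v)) =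
      -((expCoeff p i * expCoeff q j) • (((p + q).negOnePow : ℤ) •
        d.1 (p + q + k - (i + j : ℕ)) (c.1 (i + j : ℕ) v))) := by
    intro i j
    have h0 : (if (i : ℤ) + j = 0 then ((i : ℤ) : ℂ) * κ else 0) = 0 := by
      split_ifs with hij
      · have : i = 0 := by omega
        simp [this]
      · rfl
    have := h i j v
    rw [h0, zero_smul, add_zero] at this
    rw [add_comm q p, add_comm j i, mul_comm (expCoeff q j), ← smul_sub, ← map_sub,
      ← neg_sub (a.1 i (b.1 j v)), this, map_neg, smul_neg, smul_smul, Nat.cast_add]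
    congr 2
    ring
  simp only [e1, Finset.sum_neg_distrib]
  rw [sum_range_range (fun i j => (expCoeff p i * expCoeff q j) • (((p + q).negOnePow : ℤ) •
        d.1 (p + q + k - (i + j : ℕ)) (c.1 (i + j : ℕ) v))) N
      (fun i j hij => by simp only [h5 _ (show N3 ≤ i + j by omega)]; simp)]
  congr 1
  refine Finset.sum_congr rfl fun s _ => ?_
  rw [Finset.sum_congr rfl (g := fun x => (expCoeff p x.1 * expCoeff q x.2) •
      (((p + q).negOnePow : ℤ) • d.1 (p + q + k - s) (c.1 s v))) (fun x hx => by
        rw [Finset.HasAntidiagonal.mem_antidiagonal.mp hx]), ← Finset.sum_smul, expCoeff_add,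
    smul_smul, mul_comm]

theorem fieldProd_comm (a b c : Fields M) (κ : ℂ)
    (h : ∀ m n v, a.1 m (b.1 n v) - b.1 n (a.1 m v) =
      c.1 (m + n) v + (if m + n = 0 then (m : ℂ) * κ else 0) • v) (p q : ℤ) :
    fieldProd a p * fieldProd b q - fieldProd b q * fieldProd a p =
      fieldProd c (p + q) + (if p + q = 0 then (p : ℂ) * κ else 0) • 1 := by
  refine LinearMap.ext fun d => ?_
  have h1 := comm_left a b c κ h p q d
  have h2 := comm_right a b c κ h p q d
  have h3 := commute_left_right a b p q d
  have h4 := commute_left_right b a q p d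
  simp only [fieldProd, LinearMap.sub_apply, LinearMap.add_apply, LinearMap.smul_apply,
    Module.End.mul_apply, Module.End.one_apply, map_sub]
  rw [h3, h4]
  generalize (if p + q = 0 then (p : ℂ) * κ else 0) = x at *
  have e : ∀ A B C D E F : Fields M, A - E - (F - B) - (C - F - (E - D)) = (A - C) + (B - D) := by
    intros; abel
  rw [e, h1, h2]
  abel

end
open scoped TensorProduct

/-- A symmetric bilinear form on the complex Lie algebra `g` with
`κ([X,Y],Z) = κ(X,[Y,Z])`. -/
structure InvForm (g : Type*) [LieRing g] [LieAlgebra ℂ g] where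
  form : LinearMap.BilinForm ℂ g
  symm : form.IsSymm
  inv : form.lieInvariant g

section
variable {g : Type*} [LieRing g] [LieAlgebra ℂ g]

theorem neg_inv (κ : InvForm g) : (-κ.form).lieInvariant g := fun x y z => by
  simp only [LinearMap.neg_apply, κ.inv x y z]

theorem neg_symm (κ : InvForm g) : (-κ.form).IsSymm :=
  ⟨fun x y => by simpa using κ.symm.eq x y⟩

/-- The cocycle `(X t^m, Y t^m') ↦ m δ_{m+m',0} κ(X, Y)` of the loop algebra `g[t, t⁻¹]`. The sign
in front of the form compensates for the sign convention of the residue pairing; see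
`Affine.lie_loop` for the resulting bracket. -/
def affineCocycle (κ : InvForm g) :=
  LieAlgebra.LoopAlgebra.twoCocycleOfBilinear ℂ ℤ g (-κ.form) (neg_inv κ) (neg_symm κ)

/-- The affine Lie algebra `ĝ = g[t, t⁻¹] ⊕ ℂ 𝟏` with central `𝟏` and
`[X t^m, Y t^m'] = [X, Y] t^(m+m') + m δ_{m+m',0} κ(X, Y) 𝟏`. -/
def Affine (κ : InvForm g) : Type _ := LieAlgebra.ofTwoCocycle (affineCocycle κ)

instance (κ : InvForm g) : LieRing (Affine κ) :=
  inferInstanceAs (LieRing (LieAlgebra.ofTwoCocycle (affineCocycle κ)))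
instance (κ : InvForm g) : LieAlgebra ℂ (Affine κ) :=
  inferInstanceAs (LieAlgebra ℂ (LieAlgebra.ofTwoCocycle (affineCocycle κ)))

variable (κ : InvForm g)

/-- The element `x + c 𝟏` of `ĝ` for `x ∈ g[t, t⁻¹]` and `c ∈ ℂ`. -/
def Affine.mk : LieAlgebra.loopAlgebra ℂ ℤ g × ℂ →ₗ[ℂ] Affine κ where
  toFun x := LieAlgebra.ofProd (affineCocycle κ) (x.1, (TrivialLieModule.equiv ℂ _ ℂ).symm x.2)
  map_add' _ _ := rfl
  map_smul' _ _ := rfl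

/-- The components of an element of `ĝ = g[t, t⁻¹] ⊕ ℂ 𝟏`. -/
def Affine.coords : Affine κ →ₗ[ℂ] LieAlgebra.loopAlgebra ℂ ℤ g × ℂ where
  toFun x := (((LieAlgebra.ofProd (affineCocycle κ)).symm x).1,
    TrivialLieModule.equiv ℂ _ ℂ ((LieAlgebra.ofProd (affineCocycle κ)).symm x).2)
  map_add' _ _ := rfl
  map_smul' _ _ := rfl

theorem Affine.mk_coords (x : Affine κ) : Affine.mk κ (Affine.coords κ x) = x := rfl

theorem Affine.coords_mk (x : LieAlgebra.loopAlgebra ℂ ℤ g × ℂ) :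
    Affine.coords κ (Affine.mk κ x) = x := rfl

/-- The element `X t^m` of `ĝ`. -/
def Affine.loop (X : g) (m : ℤ) : Affine κ :=
  Affine.mk κ (AddMonoidAlgebra.single m 1 ⊗ₜ[ℂ] X, 0)

/-- The central element `𝟏` of `ĝ`. -/
def Affine.one : Affine κ := Affine.mk κ (0, 1)

theorem Affine.lie_mk (f f' : LieAlgebra.loopAlgebra ℂ ℤ g) (c c' : ℂ) :
    ⁅Affine.mk κ (f, c), Affine.mk κ (f', c')⁆ =
      Affine.mk κ (⁅f, f'⁆, LieAlgebra.LoopAlgebra.residuePairing ℂ ℤ g (-κ.form) f f') := by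
  change LieAlgebra.ofProd (affineCocycle κ) (⁅f, f'⁆, _) =
    LieAlgebra.ofProd (affineCocycle κ) (⁅f, f'⁆, _)
  congr 2
  rw [trivial_lie_zero, trivial_lie_zero, add_zero, sub_zero]
  rfl

theorem Affine.lie_loop (X Y : g) (m m' : ℤ) :
    ⁅Affine.loop κ X m, Affine.loop κ Y m'⁆ =
      Affine.loop κ ⁅X, Y⁆ (m + m') +
        (if m + m' = 0 then (m : ℂ) * κ.form X Y else 0) • Affine.one κ := by
  simp only [Affine.loop, Affine.one, Affine.lie_mk]
  rw [← map_smul, ← map_add]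
  congr 1
  rw [LieAlgebra.ExtendScalars.bracket_tmul, AddMonoidAlgebra.single_mul_single, one_mul,
    LieAlgebra.LoopAlgebra.residuePairing_apply_apply,
    LieAlgebra.LoopAlgebra.toFinsupp_single_tmul, LieAlgebra.LoopAlgebra.toFinsupp_single_tmul,
    Finsupp.sum_single_index (by simp), Prod.smul_mk, Prod.mk_add_mk, smul_zero, add_zero,
    zero_add, smul_eq_mul, mul_one]
  split_ifs with h
  · have : m' = -m := by omega
    subst this
    simp
  · rw [Finsupp.single_eq_of_ne (by omega)]
    simp

theorem Affine.lie_one (x : Affine κ) : ⁅Affine.one κ, x⁆ = 0 := by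
  rw [← Affine.mk_coords κ x, Affine.one]
  obtain ⟨f, c⟩ := Affine.coords κ x
  rw [Affine.lie_mk]
  refine (congrArg (Affine.mk κ) (Prod.ext (zero_lie f) ?_)).trans (map_zero (Affine.mk κ))
  rw [map_zero, LinearMap.zero_apply]
  rfl

theorem Affine.loop_add (X Y : g) (m : ℤ) :
    Affine.loop κ (X + Y) m = Affine.loop κ X m + Affine.loop κ Y m := by
  simp only [Affine.loop, TensorProduct.tmul_add, ← map_add, Prod.mk_add_mk, add_zero]

theorem Affine.loop_smul (c : ℂ) (X : g) (m : ℤ) :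
    Affine.loop κ (c • X) m = c • Affine.loop κ X m := by
  simp only [Affine.loop, TensorProduct.tmul_smul, ← map_smul, Prod.smul_mk, smul_zero]

theorem Affine.span_induction {P : Affine κ → Prop} (hl : ∀ X m, P (Affine.loop κ X m))
    (h1 : P (Affine.one κ)) (ha : ∀ x y, P x → P y → P (x + y))
    (hs : ∀ (c : ℂ) x, P x → P (c • x)) (x : Affine κ) : P x := by
  have key : ∀ f : LieAlgebra.loopAlgebra ℂ ℤ g, P (Affine.mk κ (f, 0)) := by
    intro f
    rw [← (LieAlgebra.LoopAlgebra.toFinsupp ℂ ℤ g).symm_apply_apply f]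
    generalize LieAlgebra.LoopAlgebra.toFinsupp ℂ ℤ g f = F
    induction F using Finsupp.induction_linear with
    | zero =>
      have := hs 0 _ h1
      rwa [map_zero, Prod.mk_zero_zero, map_zero, ← zero_smul ℂ (Affine.one κ)]
    | add F G hF hG =>
      have := ha _ _ hF hG
      rwa [← map_add, Prod.mk_add_mk, ← map_add, add_zero] at this
    | single m X =>
      rw [LieAlgebra.LoopAlgebra.toFinsupp_symm_single]
      exact hl X m
  rw [← Affine.mk_coords κ x]
  obtain ⟨f, c⟩ := Affine.coords κ x
  have := ha _ _ (key f) (hs c _ h1)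
  rwa [Affine.one, ← map_smul, ← map_add, Prod.smul_mk, Prod.mk_add_mk, smul_zero, add_zero,
    zero_add, smul_eq_mul, mul_one] at this

/-- The linear map `ĝ → E` with `X t^m ↦ op m X` and `𝟏 ↦ 1`. -/
def affineLiftLin {E : Type*} [Ring E] [Algebra ℂ E] (op : ℤ → g →ₗ[ℂ] E) : Affine κ →ₗ[ℂ] E :=
  LinearMap.coprod ((Finsupp.lsum ℂ op) ∘ₗ (LieAlgebra.LoopAlgebra.toFinsupp ℂ ℤ g).toLinearMap)
    (LinearMap.toSpanSingleton ℂ E 1) ∘ₗ Affine.coords κ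

theorem affineLiftLin_loop {E : Type*} [Ring E] [Algebra ℂ E] (op : ℤ → g →ₗ[ℂ] E) (X : g)
    (m : ℤ) : affineLiftLin κ op (Affine.loop κ X m) = op m X := by
  rw [affineLiftLin, LinearMap.comp_apply, Affine.loop, Affine.coords_mk, LinearMap.coprod_apply,
    map_zero, add_zero, LinearMap.comp_apply, LinearEquiv.coe_coe,
    LieAlgebra.LoopAlgebra.toFinsupp_single_tmul, Finsupp.lsum_single]

theorem affineLiftLin_one {E : Type*} [Ring E] [Algebra ℂ E] (op : ℤ → g →ₗ[ℂ] E) :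
    affineLiftLin κ op (Affine.one κ) = 1 := by
  rw [affineLiftLin, LinearMap.comp_apply, Affine.one, Affine.coords_mk, LinearMap.coprod_apply,
    map_zero, zero_add, LinearMap.toSpanSingleton_apply, one_smul]

/-- The Lie algebra homomorphism `ĝ → E` with `X t^m ↦ op m X` and `𝟏 ↦ 1`, for operators that
satisfy the relations of `ĝ`. -/
def affineLift {E : Type*} [Ring E] [Algebra ℂ E] (op : ℤ → g →ₗ[ℂ] E)
    (hop : ∀ X Y m n, op m X * op n Y - op n Y * op m X =
      op (m + n) ⁅X, Y⁆ + (if m + n = 0 then (m : ℂ) * κ.form X Y else 0) • 1) :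
    Affine κ →ₗ⁅ℂ⁆ E :=
  { affineLiftLin κ op with
    map_lie' := by
      intro x y
      change affineLiftLin κ op ⁅x, y⁆ = ⁅affineLiftLin κ op x, affineLiftLin κ op y⁆
      rw [LieRing.of_associative_ring_bracket]
      induction x using Affine.span_induction with
      | hl X m =>
        induction y using Affine.span_induction with
        | hl Y n =>
          rw [Affine.lie_loop, map_add, map_smul, affineLiftLin_loop, affineLiftLin_loop,
            affineLiftLin_loop, affineLiftLin_one, hop]
        | h1 =>
          rw [← lie_skew, Affine.lie_one, neg_zero, map_zero, affineLiftLin_one, mul_one, one_mul,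
            sub_self]
        | ha x y hx hy => rw [lie_add, map_add, map_add, hx, hy, mul_add, add_mul]; abel
        | hs c x hx =>
          rw [lie_smul, map_smul, map_smul, hx, mul_smul_comm, smul_mul_assoc, smul_sub]
      | h1 => rw [Affine.lie_one, map_zero, affineLiftLin_one, mul_one, one_mul, sub_self]
      | ha x y hx hy => rw [add_lie, map_add, map_add, hx, hy, mul_add, add_mul]; abel
      | hs c x hx =>
        rw [smul_lie, map_smul, map_smul, hx, mul_smul_comm, smul_mul_assoc, smul_sub] }

theorem affineLift_loop {E : Type*} [Ring E] [Algebra ℂ E] (op : ℤ → g →ₗ[ℂ] E)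
    (hop : ∀ X Y m n, op m X * op n Y - op n Y * op m X =
      op (m + n) ⁅X, Y⁆ + (if m + n = 0 then (m : ℂ) * κ.form X Y else 0) • 1) (X : g) (m : ℤ) :
    affineLift κ op hop (Affine.loop κ X m) = op m X := affineLiftLin_loop κ op X m

theorem affineLift_one {E : Type*} [Ring E] [Algebra ℂ E] (op : ℤ → g →ₗ[ℂ] E)
    (hop : ∀ X Y m n, op m X * op n Y - op n Y * op m X =
      op (m + n) ⁅X, Y⁆ + (if m + n = 0 then (m : ℂ) * κ.form X Y else 0) • 1) :
    affineLift κ op hop (Affine.one κ) = 1 := affineLiftLin_one κ op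

/-- The universal enveloping algebra `U(ĝ)`. -/
abbrev AffineU : Type _ := UniversalEnvelopingAlgebra ℂ (Affine κ)

/-- The element `X(m) = X t^m` of `U(ĝ)`. -/
def AffineU.loop (X : g) (m : ℤ) : AffineU κ := UniversalEnvelopingAlgebra.ι ℂ (Affine.loop κ X m)

theorem affineU_induction {P : AffineU κ → Prop}
    (h1 : ∀ c : ℂ, P (algebraMap ℂ _ c))
    (hι : ∀ x, P (UniversalEnvelopingAlgebra.ι ℂ x))
    (ha : ∀ a b, P a → P b → P (a + b)) (hm : ∀ a b, P a → P b → P (a * b)) (u : AffineU κ) :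
    P u := by
  obtain ⟨t, rfl⟩ := RingCon.mk'_surjective _ u
  induction t using TensorAlgebra.induction with
  | algebraMap r => exact h1 r
  | ι x => exact hι x
  | mul a b ha hb => rw [map_mul]; exact hm _ _ ha hb
  | add a b h h' => rw [map_add]; exact ha _ _ h h'

/-- The left ideal of `U(ĝ)` generated by `X(m)` for `X ∈ g`, `m ≥ 0`, and by `𝟏 - 1`. -/
def vacuumIdeal : Submodule (AffineU κ) (AffineU κ) :=
  Submodule.span (AffineU κ)
    ({x | ∃ (X : g) (m : ℤ), 0 ≤ m ∧ x = AffineU.loop κ X m} ∪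
      {UniversalEnvelopingAlgebra.ι ℂ (Affine.one κ) - 1})

/-- The universal affine vertex algebra `V^κ(g) = U(ĝ) ⊗_{U(g[t] ⊕ ℂ 𝟏)} ℂ`, where `g[t]` acts on
`ℂ` by `0` and `𝟏` acts by `1`, as the quotient of `U(ĝ)` by the left ideal generated by `g[t]` and
`𝟏 - 1`. -/
def AffineVA : Type _ := AffineU κ ⧸ vacuumIdeal κ

instance : AddCommGroup (AffineVA κ) := inferInstanceAs (AddCommGroup (AffineU κ ⧸ vacuumIdeal κ))
instance : Module (AffineU κ) (AffineVA κ) :=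
  inferInstanceAs (Module (AffineU κ) (AffineU κ ⧸ vacuumIdeal κ))
instance : Module ℂ (AffineVA κ) := inferInstanceAs (Module ℂ (AffineU κ ⧸ vacuumIdeal κ))
instance : IsScalarTower ℂ (AffineU κ) (AffineVA κ) :=
  inferInstanceAs (IsScalarTower ℂ (AffineU κ) (AffineU κ ⧸ vacuumIdeal κ))

/-- The quotient map `U(ĝ) → V^κ(g)`. -/
def toVA : AffineU κ →ₗ[AffineU κ] AffineVA κ := (vacuumIdeal κ).mkQ

theorem toVA_surjective : Function.Surjective (toVA κ) := (vacuumIdeal κ).mkQ_surjective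

theorem toVA_eq_zero {u : AffineU κ} : toVA κ u = 0 ↔ u ∈ vacuumIdeal κ :=
  Submodule.Quotient.mk_eq_zero _

/-- The vacuum vector `|0⟩`. -/
def vacuum : AffineVA κ := toVA κ 1

/-- The action of `X(m)` on `V^κ(g)`. -/
def mode (X : g) (m : ℤ) : Module.End ℂ (AffineVA κ) :=
  Module.toModuleEnd ℂ (S := AffineU κ) (AffineVA κ) (AffineU.loop κ X m)

theorem mode_apply (X : g) (m : ℤ) (v : AffineVA κ) : mode κ X m v = AffineU.loop κ X m • v := rfl

theorem one_smul_affine (v : AffineVA κ) :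
    UniversalEnvelopingAlgebra.ι ℂ (Affine.one κ) • v = v := by
  obtain ⟨u, rfl⟩ := toVA_surjective κ v
  have hc : UniversalEnvelopingAlgebra.ι ℂ (Affine.one κ) * u =
      u * UniversalEnvelopingAlgebra.ι ℂ (Affine.one κ) := by
    induction u using affineU_induction with
    | h1 c => exact (Algebra.commutes c _).symm
    | hι x =>
      rw [← sub_eq_zero, ← LieRing.of_associative_ring_bracket, ← LieHom.map_lie,
        Affine.lie_one, map_zero]
    | ha a b ha hb => rw [mul_add, add_mul, ha, hb]
    | hm a b ha hb => rw [← mul_assoc, ha, mul_assoc, hb, mul_assoc]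
  rw [← sub_eq_zero, ← map_smul, ← map_sub, toVA_eq_zero, smul_eq_mul, hc]
  have : u * UniversalEnvelopingAlgebra.ι ℂ (Affine.one κ) - u =
    u • (UniversalEnvelopingAlgebra.ι ℂ (Affine.one κ) - 1) := by
    rw [smul_eq_mul, mul_sub, mul_one]
  rw [this]
  exact Submodule.smul_mem _ _ (Submodule.subset_span (Or.inr rfl))

theorem mode_comm (X Y : g) (m n : ℤ) (v : AffineVA κ) :
    mode κ X m (mode κ Y n v) - mode κ Y n (mode κ X m v) =
      mode κ ⁅X, Y⁆ (m + n) v + (if m + n = 0 then (m : ℂ) * κ.form X Y else 0) • v := by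
  simp only [mode_apply]
  rw [← mul_smul, ← mul_smul, ← sub_smul]
  have : AffineU.loop κ X m * AffineU.loop κ Y n - AffineU.loop κ Y n * AffineU.loop κ X m =
      AffineU.loop κ ⁅X, Y⁆ (m + n) + (if m + n = 0 then (m : ℂ) * κ.form X Y else 0) •
        UniversalEnvelopingAlgebra.ι ℂ (Affine.one κ) := by
    simp only [AffineU.loop]
    rw [← LieRing.of_associative_ring_bracket, ← LieHom.map_lie, Affine.lie_loop, map_add, map_smul]
  rw [this, add_smul, smul_assoc, one_smul_affine]

theorem mode_vacuum (X : g) (m : ℤ) (hm : 0 ≤ m) : mode κ X m (vacuum κ) = 0 := by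
  rw [mode_apply, vacuum, ← map_smul, toVA_eq_zero, smul_eq_mul, mul_one]
  exact Submodule.subset_span (Or.inl ⟨X, m, hm, rfl⟩)

theorem affineVA_induction {P : AffineVA κ → Prop} (hv : P (vacuum κ))
    (hm : ∀ X m v, P v → P (mode κ X m v)) (ha : ∀ v w, P v → P w → P (v + w))
    (hs : ∀ (c : ℂ) v, P v → P (c • v)) (v : AffineVA κ) : P v := by
  have key : ∀ u : AffineU κ, ∀ v, P v → P (u • v) := by
    intro u
    induction u using affineU_induction with
    | h1 c => intro v hv; rw [algebraMap_smul]; exact hs c v hv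
    | hι x =>
      induction x using Affine.span_induction with
      | hl X m => exact fun v hv => hm X m v hv
      | h1 => intro v hv; rwa [one_smul_affine]
      | ha x y hx hy => intro v hv; rw [map_add, add_smul]; exact ha _ _ (hx v hv) (hy v hv)
      | hs c x hx => intro v hv; rw [map_smul, smul_assoc]; exact hs _ _ (hx v hv)
    | ha a b h h' => intro v hv; rw [add_smul]; exact ha _ _ (h v hv) (h' v hv)
    | hm a b h h' => intro v hv; rw [mul_smul]; exact h _ (h' v hv)
  obtain ⟨u, rfl⟩ := toVA_surjective κ v
  have := key u _ hv
  rwa [vacuum, ← map_smul, smul_eq_mul, mul_one] at this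

theorem mode_mem_fields (X : g) : mode κ X ∈ Fields (AffineVA κ) := by
  intro v
  have : ∀ v : AffineVA κ, ∀ X : g, ∃ N : ℤ, ∀ m, N ≤ m → mode κ X m v = 0 := by
    intro v
    induction v using affineVA_induction with
    | hv => exact fun X => ⟨0, fun m hm => mode_vacuum κ X m hm⟩
    | hm Y n v ih =>
      intro X
      obtain ⟨N, hN⟩ := ih X
      obtain ⟨N', hN'⟩ := ih ⁅X, Y⁆
      refine ⟨max N (max (N' - n) (1 - n)), fun m hm => ?_⟩
      have h := mode_comm κ X Y m n v
      rw [hN m (by omega), hN' (m + n) (by omega), if_neg (by omega)] at h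
      simpa using h
    | ha v w hv hw =>
      intro X
      obtain ⟨N, hN⟩ := hv X
      obtain ⟨N', hN'⟩ := hw X
      exact ⟨max N N', fun m hm => by rw [map_add, hN m (by omega), hN' m (by omega), add_zero]⟩
    | hs c v hv =>
      intro X
      obtain ⟨N, hN⟩ := hv X
      exact ⟨N, fun m hm => by rw [map_smul, hN m hm, smul_zero]⟩
  exact this v X

/-- The current `X(z) = ∑ X(m) z^(-m-1)` on `V^κ(g)`. -/
def current (X : g) : Fields (AffineVA κ) := ⟨mode κ X, mode_mem_fields κ X⟩


theorem current_add (X Y : g) : current κ (X + Y) = current κ X + current κ Y := by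
  refine Subtype.ext (funext fun k => LinearMap.ext fun v => ?_)
  change mode κ (X + Y) k v = mode κ X k v + mode κ Y k v
  simp only [mode_apply, AffineU.loop, Affine.loop_add, map_add, add_smul]

theorem current_smul (c : ℂ) (X : g) : current κ (c • X) = c • current κ X := by
  refine Subtype.ext (funext fun k => LinearMap.ext fun v => ?_)
  change mode κ (c • X) k v = c • mode κ X k v
  simp only [mode_apply, AffineU.loop, Affine.loop_smul, map_smul, smul_assoc]

theorem fieldProd_add {M : Type*} [AddCommGroup M] [Module ℂ M] (a b : Fields M) (p : ℤ) :
    fieldProd (a + b) p = fieldProd a p + fieldProd b p := by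
  refine LinearMap.ext fun c => Subtype.ext (funext fun k => LinearMap.ext fun v => ?_)
  obtain ⟨N1, h1⟩ := exists_nat a 0 v
  obtain ⟨N2, h2⟩ := exists_nat b 0 v
  obtain ⟨N3, h3⟩ := exists_nat c k v
  simp only [zero_add] at h1 h2
  simp only [fieldProd, LinearMap.sub_apply, LinearMap.add_apply, Submodule.coe_sub,
    Submodule.coe_add, Pi.sub_apply, Pi.add_apply]
  have h4 : ∀ j : ℕ, N1 + N2 ≤ j → (a + b).1 j v = 0 := fun j hj => by
    simp [h1 j (by omega), h2 j (by omega)]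
  rw [prodLeft_apply _ _ _ _ _ h3, prodLeft_apply _ _ _ _ _ h3, prodLeft_apply _ _ _ _ _ h3,
    prodRight_apply _ _ _ _ _ h4,
    prodRight_apply _ _ _ _ _ (N := N1 + N2) (fun j hj => h1 j (by omega)),
    prodRight_apply _ _ _ _ _ (N := N1 + N2) (fun j hj => h2 j (by omega))]
  simp only [Submodule.coe_add, Pi.add_apply, LinearMap.add_apply, smul_add, map_add,
    Finset.sum_add_distrib]
  abel

theorem fieldProd_smul {M : Type*} [AddCommGroup M] [Module ℂ M] (x : ℂ) (a : Fields M) (p : ℤ) :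
    fieldProd (x • a) p = x • fieldProd a p := by
  refine LinearMap.ext fun c => Subtype.ext (funext fun k => LinearMap.ext fun v => ?_)
  obtain ⟨N1, h1⟩ := exists_nat a 0 v
  obtain ⟨N3, h3⟩ := exists_nat c k v
  simp only [zero_add] at h1
  simp only [fieldProd, LinearMap.sub_apply, LinearMap.smul_apply, Submodule.coe_sub,
    Submodule.coe_smul, Pi.sub_apply, Pi.smul_apply]
  have h4 : ∀ j : ℕ, N1 ≤ j → (x • a).1 j v = 0 := fun j hj => by simp [h1 j hj]
  rw [prodLeft_apply _ _ _ _ _ h3, prodLeft_apply _ _ _ _ _ h3,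
    prodRight_apply _ _ _ _ _ h4, prodRight_apply _ _ _ _ _ h1, smul_sub, Finset.smul_sum,
    Finset.smul_sum]
  simp only [Submodule.coe_smul, Pi.smul_apply, LinearMap.smul_apply, map_smul, smul_comm x]

/-- The operator `b(z) ↦ X(z)_(m) b(z)` on the fields on `V^κ(g)`. -/
def fieldOp (m : ℤ) : g →ₗ[ℂ] Module.End ℂ (Fields (AffineVA κ)) where
  toFun X := fieldProd (current κ X) m
  map_add' X Y := by rw [current_add, fieldProd_add]
  map_smul' c X := by rw [current_smul, fieldProd_smul, RingHom.id_apply]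

theorem fieldOp_comm (X Y : g) (m n : ℤ) :
    fieldOp κ m X * fieldOp κ n Y - fieldOp κ n Y * fieldOp κ m X =
      fieldOp κ (m + n) ⁅X, Y⁆ + (if m + n = 0 then (m : ℂ) * κ.form X Y else 0) • 1 :=
  fieldProd_comm (current κ X) (current κ Y) (current κ ⁅X, Y⁆) (κ.form X Y) (mode_comm κ X Y) m n

/-- The representation of `U(ĝ)` on the space of fields on `V^κ(g)` in which `X(m)` acts by
`b(z) ↦ X(z)_(m) b(z)` and `𝟏` acts by `1`. -/
def fieldAct : AffineU κ →ₐ[ℂ] Module.End ℂ (Fields (AffineVA κ)) :=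
  UniversalEnvelopingAlgebra.lift ℂ (A := Module.End ℂ (Fields (AffineVA κ)))
    (affineLift κ (E := Module.End ℂ (Fields (AffineVA κ))) (fieldOp κ) (fieldOp_comm κ))

theorem fieldAct_loop (X : g) (m : ℤ) :
    fieldAct κ (AffineU.loop κ X m) = fieldProd (current κ X) m := by
  rw [fieldAct, AffineU.loop, UniversalEnvelopingAlgebra.lift_ι_apply, affineLift_loop]
  rfl

theorem fieldAct_vacuumIdeal (u : AffineU κ) (hu : u ∈ vacuumIdeal κ) :
    fieldAct κ u (idField (AffineVA κ)) = 0 := by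
  induction hu using Submodule.span_induction with
  | mem x hx =>
    rcases hx with ⟨X, m, hm, rfl⟩ | rfl
    · rw [fieldAct_loop, fieldProd_idField _ _ hm]
    · rw [map_sub, map_one, fieldAct, UniversalEnvelopingAlgebra.lift_ι_apply, affineLift_one,
        sub_self, LinearMap.zero_apply]
  | zero => rw [map_zero, LinearMap.zero_apply]
  | add x y _ _ hx hy => rw [map_add, LinearMap.add_apply, hx, hy, add_zero]
  | smul a x _ hx => rw [smul_eq_mul, map_mul, Module.End.mul_apply, hx, map_zero]

/-- The state-field correspondence of `V^κ(g)`. It is the linear map with `|0⟩ ↦ id` and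
`X(m) v ↦ X(z)_(m) Y(v, z)`; see `stateField_vacuum` and `stateField_mode`. -/
def stateField : AffineVA κ →ₗ[ℂ] Fields (AffineVA κ) where
  toFun := Quotient.lift (s := (vacuumIdeal κ).quotientRel)
    (fun u => fieldAct κ u (idField (AffineVA κ))) (fun u w h => by
      have := fieldAct_vacuumIdeal κ _ ((Submodule.quotientRel_def _).mp h)
      rwa [map_sub, LinearMap.sub_apply, sub_eq_zero] at this)
  map_add' v w := by
    obtain ⟨u, rfl⟩ := toVA_surjective κ v
    obtain ⟨u', rfl⟩ := toVA_surjective κ w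
    rw [← map_add]
    change fieldAct κ (u + u') _ = fieldAct κ u _ + fieldAct κ u' _
    rw [map_add, LinearMap.add_apply]
  map_smul' c v := by
    obtain ⟨u, rfl⟩ := toVA_surjective κ v
    change fieldAct κ (c • u) _ = c • fieldAct κ u _
    rw [map_smul, LinearMap.smul_apply]

theorem stateField_toVA (u : AffineU κ) :
    stateField κ (toVA κ u) = fieldAct κ u (idField (AffineVA κ)) := rfl

theorem stateField_vacuum : stateField κ (vacuum κ) = idField (AffineVA κ) := by
  rw [vacuum, stateField_toVA, map_one, Module.End.one_apply]

theorem stateField_mode (X : g) (m : ℤ) (v : AffineVA κ) :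
    stateField κ (mode κ X m v) = fieldProd (current κ X) m (stateField κ v) := by
  obtain ⟨u, rfl⟩ := toVA_surjective κ v
  rw [mode_apply, ← map_smul, stateField_toVA, stateField_toVA, smul_eq_mul, map_mul,
    Module.End.mul_apply, fieldAct_loop]

end

section
/-- The part of the structure of a conformally graded vertex algebra on `V` from which vertex
subalgebras and the current algebra are built: the vacuum vector, the products
`Y u n v = u_(n) v`, and the subspaces `wt d` of vectors of conformal weight `d`. -/
structure VertexData (V : Type*) [AddCommGroup V] [Module ℂ V] where
  vac : V
  Y : V →ₗ[ℂ] ℤ → Module.End ℂ V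
  wt : ℤ → Submodule ℂ V
  vac_mem : vac ∈ wt 0
  Y_mem : ∀ {d e : ℤ} {u v : V} (n : ℤ), u ∈ wt d → v ∈ wt e → Y u n v ∈ wt (d + e - n - 1)
  iSup_wt : ⨆ d, wt d = ⊤

namespace VertexData
variable {V : Type*} [AddCommGroup V] [Module ℂ V] (D : VertexData V)

/-- The vertex subalgebra generated by `S`: the smallest subspace that contains `S` and the vacuum
vector and is closed under all products `u_(n) v`. -/
def closure (S : Set V) : Submodule ℂ V :=
  sInf {K | D.vac ∈ K ∧ S ⊆ K ∧ ∀ u ∈ K, ∀ v ∈ K, ∀ n, D.Y u n v ∈ K}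

variable {D} in
theorem vac_mem_closure (S : Set V) : D.vac ∈ D.closure S :=
  Submodule.mem_sInf.mpr fun _ hK => hK.1

variable {D} in
theorem subset_closure (S : Set V) : S ⊆ D.closure S :=
  fun _ hx => Submodule.mem_sInf.mpr fun _ hK => hK.2.1 hx

variable {D} in
theorem Y_mem_closure {S : Set V} {u v : V} (hu : u ∈ D.closure S) (hv : v ∈ D.closure S) (n : ℤ) :
    D.Y u n v ∈ D.closure S :=
  Submodule.mem_sInf.mpr fun K hK => hK.2.2 u (Submodule.mem_sInf.mp hu K hK) v
    (Submodule.mem_sInf.mp hv K hK) n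

theorem closure_le_iSup {S : Set V} (hS : ∀ x ∈ S, ∃ d, x ∈ D.wt d) :
    D.closure S ≤ ⨆ d, D.closure S ⊓ D.wt d := by
  refine sInf_le ⟨?_, ?_, ?_⟩
  · exact Submodule.mem_iSup_of_mem 0 ⟨vac_mem_closure S, D.vac_mem⟩
  · intro x hx
    obtain ⟨d, hd⟩ := hS x hx
    exact Submodule.mem_iSup_of_mem d ⟨subset_closure S hx, hd⟩
  · intro u hu v hv n
    induction hu using Submodule.iSup_induction' with
    | mem d u hu =>
      induction hv using Submodule.iSup_induction' with
      | mem e v hv =>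
        exact Submodule.mem_iSup_of_mem (d + e - n - 1)
          ⟨Y_mem_closure hu.1 hv.1 n, D.Y_mem n hu.2 hv.2⟩
      | zero => rw [map_zero]; exact Submodule.zero_mem _
      | add v w _ _ hv hw => rw [map_add]; exact Submodule.add_mem _ hv hw
    | zero => rw [map_zero]; exact Submodule.zero_mem _
    | add u w _ _ hu hw => rw [map_add]; exact Submodule.add_mem _ hu hw

/-- The vertex subalgebra generated by a set of homogeneous vectors, with the restricted vacuum
vector, products and grading. -/
def sub (S : Set V) (hS : ∀ x ∈ S, ∃ d, x ∈ D.wt d) : VertexData (D.closure S) where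
  vac := ⟨D.vac, vac_mem_closure S⟩
  Y :=
    { toFun u n := (D.Y u n).restrict (fun _ hv => Y_mem_closure u.2 hv n)
      map_add' u u' := by
        refine funext fun n => LinearMap.ext fun v => Subtype.ext ?_
        change D.Y (u.1 + u'.1) n v.1 = D.Y u.1 n v.1 + D.Y u'.1 n v.1
        rw [map_add]; rfl
      map_smul' c u := by
        refine funext fun n => LinearMap.ext fun v => Subtype.ext ?_
        change D.Y (c • u.1) n v.1 = c • D.Y u.1 n v.1
        rw [map_smul]; rfl }
  wt d := (D.wt d).comap (D.closure S).subtype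
  vac_mem := D.vac_mem
  Y_mem n hu hv := D.Y_mem n hu hv
  iSup_wt := by
    refine Submodule.map_injective_of_injective (D.closure S).injective_subtype ?_
    rw [Submodule.map_iSup, Submodule.map_subtype_top]
    simp only [Submodule.map_comap_subtype]
    exact le_antisymm (iSup_le fun d => inf_le_left) (D.closure_le_iSup hS)

/-- The free unital associative algebra on the space `V[t, t⁻¹]` of symbols `v t^m`, linear in
`v`. -/
def Free (_ : VertexData V) : Type _ := TensorAlgebra ℂ (ℤ →₀ V)

instance : Ring D.Free := inferInstanceAs (Ring (TensorAlgebra ℂ (ℤ →₀ V)))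
instance : Algebra ℂ D.Free := inferInstanceAs (Algebra ℂ (TensorAlgebra ℂ (ℤ →₀ V)))

/-- The generator `v t^m`. -/
def gen (v : V) (m : ℤ) : D.Free := TensorAlgebra.ι ℂ (Finsupp.single m v)

theorem gen_add (v w : V) (m : ℤ) : D.gen (v + w) m = D.gen v m + D.gen w m := by
  rw [gen, Finsupp.single_add]; exact map_add _ _ _

theorem free_induction {P : D.Free → Prop} (h1 : ∀ c : ℂ, P (algebraMap ℂ _ c))
    (hg : ∀ v m, P (D.gen v m)) (ha : ∀ a b, P a → P b → P (a + b))
    (hm : ∀ a b, P a → P b → P (a * b)) (x : D.Free) : P x := by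
  induction x using TensorAlgebra.induction with
  | algebraMap r => exact h1 r
  | ι f =>
    induction f using Finsupp.induction_linear with
    | zero =>
      have := h1 0
      rw [map_zero] at this
      rw [map_zero]
      exact this
    | add f g hf hg => rw [map_add]; exact ha _ _ hf hg
    | single m v => exact hg v m
  | mul a b h h' => exact hm a b h h'
  | add a b h h' => exact ha a b h h'

/-- The subspace of degree `d`, where `v t^m` has degree `m - e + 1` if `v` has conformal
weight `e`. -/
def deg (d : ℤ) : Submodule ℂ D.Free :=
  Submodule.span ℂ {x | ∃ L : List (V × ℤ × ℤ), (∀ p ∈ L, p.1 ∈ D.wt p.2.1) ∧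
    (L.map fun p => p.2.2 - p.2.1 + 1).sum = d ∧ x = (L.map fun p => D.gen p.1 p.2.2).prod}

theorem one_mem_deg : 1 ∈ D.deg 0 := Submodule.subset_span ⟨[], by simp⟩

theorem gen_mem_deg {v : V} {e : ℤ} (hv : v ∈ D.wt e) (m : ℤ) : D.gen v m ∈ D.deg (m - e + 1) :=
  Submodule.subset_span ⟨[(v, e, m)], by simpa using hv⟩

theorem deg_mul_deg (d e : ℤ) : D.deg d * D.deg e ≤ D.deg (d + e) := by
  rw [deg, deg, Submodule.span_mul_span]
  refine Submodule.span_mono ?_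
  rintro _ ⟨x, ⟨L, h1, h2, rfl⟩, y, ⟨L', h1', h2', rfl⟩, rfl⟩
  refine ⟨L ++ L', fun p hp => ?_, by simp [h2, h2'], by simp⟩
  rcases List.mem_append.mp hp with h | h
  exacts [h1 p h, h1' p h]

theorem iSup_deg : ⨆ d, D.deg d = ⊤ := by
  refine eq_top_iff.mpr fun x _ => ?_
  induction x using free_induction with
  | h1 c =>
    rw [Algebra.algebraMap_eq_smul_one]
    exact Submodule.smul_mem _ _ (Submodule.mem_iSup_of_mem 0 D.one_mem_deg)
  | hg v m =>
    have hv : v ∈ ⨆ d, D.wt d := by rw [D.iSup_wt]; trivial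
    induction hv using Submodule.iSup_induction' with
    | mem e v hv => exact Submodule.mem_iSup_of_mem _ (D.gen_mem_deg hv m)
    | zero =>
      have : D.gen 0 m = 0 := by rw [gen, Finsupp.single_zero]; exact map_zero _
      rw [this]; exact Submodule.zero_mem _
    | add v w _ _ hv hw => rw [gen_add]; exact Submodule.add_mem _ (hv trivial) (hw trivial)
  | ha a b h h' => exact Submodule.add_mem _ (h trivial) (h' trivial)
  | hm a b h h' =>
    have := Submodule.mul_mem_mul (h trivial) (h' trivial)
    rw [Submodule.iSup_mul] at this
    simp only [Submodule.mul_iSup] at this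
    exact iSup_le (fun d => iSup_le fun e =>
      (D.deg_mul_deg d e).trans (le_iSup D.deg (d + e))) this

/-- The subspace `∑_{r > N} A_{d-r} A_r` of the degree `d` component `A_d`. -/
def tail (N d : ℤ) : Submodule ℂ D.Free := ⨆ (r : ℤ) (_ : N < r), D.deg (d - r) * D.deg r

theorem tail_mono {N N' : ℤ} (h : N ≤ N') (d : ℤ) : D.tail N' d ≤ D.tail N d :=
  iSup₂_le fun r hr => le_iSup₂_of_le r (h.trans_lt hr) le_rfl

theorem tail_le_deg (N d : ℤ) : D.tail N d ≤ D.deg d :=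
  iSup₂_le fun r _ => (D.deg_mul_deg _ _).trans (by rw [sub_add_cancel])

theorem tail_mul_deg (N d e : ℤ) : D.tail N d * D.deg e ≤ D.tail (N + e) (d + e) := by
  simp only [tail, Submodule.iSup_mul]
  refine iSup₂_le fun r hr => le_iSup₂_of_le (r + e) (by omega) ?_
  rw [mul_assoc, show d + e - (r + e) = d - r by ring]
  exact mul_le_mul' le_rfl (D.deg_mul_deg r e)

theorem deg_mul_tail (N d e : ℤ) : D.deg d * D.tail N e ≤ D.tail N (d + e) := by
  simp only [tail, Submodule.mul_iSup]
  refine iSup₂_le fun r hr => le_iSup₂_of_le r hr ?_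
  rw [← mul_assoc, show d + e - r = d + (e - r) by ring]
  exact mul_le_mul' (D.deg_mul_deg d (e - r)) le_rfl

/-- A basic neighbourhood of zero for the direct sum topology on `A = ⨁ A_d`, where
`∑_{r > N} A_{d-r} A_r` for `N ∈ ℤ` are the basic neighbourhoods of zero of `A_d`. -/
def nbhd (f : ℤ → ℤ) : Submodule ℂ D.Free := ⨆ d, D.tail (f d) d

theorem nbhd_mono {f f' : ℤ → ℤ} (h : f ≤ f') : D.nbhd f' ≤ D.nbhd f :=
  iSup_mono fun d => D.tail_mono (h d) d

theorem exists_bound (f : ℤ → ℤ) : ∃ h : ℤ → ℤ, ∀ d t, |t| ≤ 2 * |d| → f t + |d| ≤ h d := by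
  refine ⟨fun d => ∑ t ∈ Finset.Icc (-2 * |d|) (2 * |d|), |f t| + |d|, fun d t ht => ?_⟩
  have h1 := abs_le.mp ht
  have h2 : |f t| ≤ ∑ t ∈ Finset.Icc (-2 * |d|) (2 * |d|), |f t| :=
    Finset.single_le_sum (f := fun t => |f t|) (fun i _ => abs_nonneg _)
      (Finset.mem_Icc.mpr ⟨by linarith [h1.1], h1.2⟩)
  have h3 := le_abs_self (f t)
  change f t + |d| ≤ ∑ t ∈ Finset.Icc (-2 * |d|) (2 * |d|), |f t| + |d|
  linarith

theorem tail_mul_tail_le_right (N N' d e : ℤ) : D.tail N d * D.tail N' e ≤ D.tail N' (d + e) :=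
  (mul_le_mul' (D.tail_le_deg N d) le_rfl).trans (D.deg_mul_tail N' d e)

theorem tail_mul_tail_le_left (N N' d e : ℤ) :
    D.tail N d * D.tail N' e ≤ D.tail (N + e) (d + e) :=
  (mul_le_mul' le_rfl (D.tail_le_deg N' e)).trans (D.tail_mul_deg N d e)

theorem tail_mul_tail_le {f h : ℤ → ℤ} (hh : ∀ d t, |t| ≤ 2 * |d| → f t + |d| ≤ h d) (d e : ℤ) :
    D.tail (h d) d * D.tail (h e) e ≤ D.tail (f (d + e)) (d + e) := by
  rcases le_total |d| |e| with hde | hde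
  · refine (D.tail_mul_tail_le_right _ _ d e).trans (D.tail_mono ?_ _)
    have h1 := hh e (d + e) ((abs_add_le d e).trans (by linarith))
    have h2 := abs_nonneg e
    linarith
  · refine (D.tail_mul_tail_le_left _ _ d e).trans (D.tail_mono ?_ _)
    have h1 := hh d (d + e) ((abs_add_le d e).trans (by linarith))
    have h2 := neg_abs_le e
    linarith

theorem nbhd_mul_nbhd (f : ℤ → ℤ) : ∃ h : ℤ → ℤ, D.nbhd h * D.nbhd h ≤ D.nbhd f := by
  obtain ⟨h, hh⟩ := exists_bound f
  refine ⟨h, ?_⟩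
  have main : ∀ d e, D.tail (h d) d * D.tail (h e) e ≤ ⨆ t, D.tail (f t) t := by
    intro d e
    refine le_trans ?_ (le_iSup (fun t => D.tail (f t) t) (d + e))
    exact D.tail_mul_tail_le hh d e
  simp only [nbhd, Submodule.iSup_mul, Submodule.mul_iSup]
  exact iSup_le fun d => iSup_le fun e => main _ _

theorem basis : RingSubgroupsBasis (fun f : ℤ → ℤ => (D.nbhd f).toAddSubgroup) where
  inter f f' := ⟨f ⊔ f', le_inf (D.nbhd_mono le_sup_left) (D.nbhd_mono le_sup_right)⟩
  mul f := by
    obtain ⟨h, hh⟩ := D.nbhd_mul_nbhd f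
    refine ⟨h, ?_⟩
    rintro _ ⟨x, hx, y, hy, rfl⟩
    exact hh (Submodule.mul_mem_mul hx hy)
  leftMul x f := by
    have hx : x ∈ ⨆ d, D.deg d := by rw [D.iSup_deg]; trivial
    induction hx using Submodule.iSup_induction' with
    | mem d x hx =>
      refine ⟨fun e => f (d + e), fun y hy => ?_⟩
      have main : D.deg d * D.nbhd (fun e => f (d + e)) ≤ D.nbhd f := by
        simp only [nbhd, Submodule.mul_iSup]
        exact iSup_le fun e => le_iSup_of_le (d + e) (D.deg_mul_tail _ _ _)
      exact main (Submodule.mul_mem_mul hx hy)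
    | zero => exact ⟨f, fun y _ => by simp⟩
    | add x x' _ _ hx hx' =>
      obtain ⟨f1, h1⟩ := hx
      obtain ⟨f2, h2⟩ := hx'
      refine ⟨f1 ⊔ f2, fun y hy => ?_⟩
      have e1 := h1 (D.nbhd_mono le_sup_left hy)
      have e2 := h2 (D.nbhd_mono le_sup_right hy)
      simp only [Set.mem_preimage] at e1 e2 ⊢
      rw [add_mul]
      exact add_mem e1 e2
  rightMul x f := by
    have hx : x ∈ ⨆ d, D.deg d := by rw [D.iSup_deg]; trivial
    induction hx using Submodule.iSup_induction' with
    | mem e x hx =>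
      refine ⟨fun d => f (d + e) - e, fun y hy => ?_⟩
      have main : D.nbhd (fun d => f (d + e) - e) * D.deg e ≤ D.nbhd f := by
        simp only [nbhd, Submodule.iSup_mul]
        refine iSup_le fun d => le_iSup_of_le (d + e) ((D.tail_mul_deg _ _ _).trans ?_)
        rw [sub_add_cancel]
      exact main (Submodule.mul_mem_mul hy hx)
    | zero => exact ⟨f, fun y _ => by simp⟩
    | add x x' _ _ hx hx' =>
      obtain ⟨f1, h1⟩ := hx
      obtain ⟨f2, h2⟩ := hx'
      refine ⟨f1 ⊔ f2, fun y hy => ?_⟩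
      have e1 := h1 (D.nbhd_mono le_sup_left hy)
      have e2 := h2 (D.nbhd_mono le_sup_right hy)
      simp only [Set.mem_preimage] at e1 e2 ⊢
      rw [mul_add]
      exact add_mem e1 e2

instance : TopologicalSpace D.Free := D.basis.topology
instance : IsTopologicalRing D.Free := D.basis.toRingFilterBasis.isTopologicalRing
instance : UniformSpace D.Free := IsTopologicalAddGroup.rightUniformSpace D.Free
instance : IsUniformAddGroup D.Free := isUniformAddGroup_of_addCommGroup

instance : UniformContinuousConstSMul ℂ D.Free where
  uniformContinuous_const_smul c := by
    refine uniformContinuous_of_continuousAt_zero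
      (DistribSMul.toAddMonoidHom D.Free c) ?_
    rw [ContinuousAt, map_zero, D.basis.hasBasis_nhds_zero.tendsto_iff D.basis.hasBasis_nhds_zero]
    exact fun f _ => ⟨f, trivial, fun x hx => (D.nbhd f).smul_mem c hx⟩

/-- The degreewise completion `⨁_d lim_N (A_d / ∑_{r > N} A_{d-r} A_r)`, obtained as the completion
of `A = ⨁ A_d` for the direct sum topology. -/
abbrev Completed : Type _ := UniformSpace.Completion D.Free

/-- The generator `v t^m` as an element of the completion. -/
def cmode (v : V) (m : ℤ) : D.Completed := (D.gen v m : D.Free)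

/-- The defining relations of the current algebra: `|0⟩ t^m = δ_{m,-1}` and the Borcherds identities
`∑_j (p choose j) (u_(r+j) v) t^(p+q-j) = ∑_j (-1)^j (r choose j)
(u t^(p+r-j) v t^(q+j) - (-1)^r v t^(q+r-j) u t^(p+j))`. The sums converge in the completion. -/
def relations : Set D.Completed :=
  {x | ∃ m : ℤ, x = D.cmode D.vac m - if m = -1 then 1 else 0} ∪
  {x | ∃ (u v : V) (p q r : ℤ), HasSum (fun j : ℕ =>
    Ring.choose p j • D.cmode (D.Y u (r + j) v) (p + q - j) -
      ((-1) ^ j * Ring.choose r j) •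
        (D.cmode u (p + r - j) * D.cmode v (q + j) -
          (r.negOnePow : ℤ) • (D.cmode v (q + r - j) * D.cmode u (p + j)))) x}

/-- Congruence modulo the closed two-sided ideal generated by the relations. -/
def Rel (x y : D.Completed) : Prop :=
  x - y ∈ _root_.closure (TwoSidedIdeal.span D.relations : Set D.Completed)

/-- The current algebra (universal enveloping algebra) `𝔘(V)`: the quotient of the degreewise
completed algebra by the closed two-sided ideal generated by the relations. -/
def CurrentAlgebra : Type _ := RingQuot D.Rel

instance : Ring D.CurrentAlgebra := inferInstanceAs (Ring (RingQuot D.Rel))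
instance : Algebra ℂ D.CurrentAlgebra := inferInstanceAs (Algebra ℂ (RingQuot D.Rel))

/-- The quotient map onto `𝔘(V)`. -/
def toCurrent : D.Completed →ₐ[ℂ] D.CurrentAlgebra := RingQuot.mkAlgHom ℂ D.Rel

/-- The quotient topology. -/
instance : TopologicalSpace D.CurrentAlgebra := TopologicalSpace.coinduced D.toCurrent inferInstance

/-- The element `v t^m` of `𝔘(V)`, the Fourier coefficient `v_(m)` of the field `Y(v, z)`. -/
def fourier (v : V) (m : ℤ) : D.CurrentAlgebra := D.toCurrent (D.cmode v m)

end VertexData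
end

section
variable {g : Type*} [LieRing g] [LieAlgebra ℂ g] (κ : InvForm g)

/-- The subspace of `V^κ(g)` of conformal weight `d`, spanned by the vectors
`X₁(m₁) ⋯ X_s(m_s)|0⟩` with `m₁ + ⋯ + m_s = -d`. -/
def weight (d : ℤ) : Submodule ℂ (AffineVA κ) :=
  Submodule.span ℂ {x | ∃ L : List (g × ℤ), (L.map Prod.snd).sum = -d ∧
    x = L.foldr (fun p v => mode κ p.1 p.2 v) (vacuum κ)}

theorem vacuum_mem_weight : vacuum κ ∈ weight κ 0 := Submodule.subset_span ⟨[], by simp⟩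

theorem mode_mem_weight (X : g) (m : ℤ) {d : ℤ} {v : AffineVA κ} (hv : v ∈ weight κ d) :
    mode κ X m v ∈ weight κ (d - m) := by
  induction hv using Submodule.span_induction with
  | mem v hv =>
    obtain ⟨L, hL, rfl⟩ := hv
    exact Submodule.subset_span ⟨(X, m) :: L, by rw [List.map_cons, List.sum_cons, hL]; ring, rfl⟩
  | zero => rw [map_zero]; exact Submodule.zero_mem _
  | add v w _ _ hv hw => rw [map_add]; exact Submodule.add_mem _ hv hw
  | smul c v _ hv => rw [map_smul]; exact Submodule.smul_mem _ c hv

theorem iSup_weight : ⨆ d, weight κ d = ⊤ := by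
  refine (Submodule.eq_top_iff' ).mpr fun v => ?_
  induction v using affineVA_induction with
  | hv => exact Submodule.mem_iSup_of_mem 0 (vacuum_mem_weight κ)
  | hm X m v hv =>
    induction hv using Submodule.iSup_induction' with
    | mem d v hv => exact Submodule.mem_iSup_of_mem (d - m) (mode_mem_weight κ X m hv)
    | zero => rw [map_zero]; exact Submodule.zero_mem _
    | add v w _ _ hv hw => rw [map_add]; exact Submodule.add_mem _ hv hw
  | ha v w hv hw => exact Submodule.add_mem _ hv hw
  | hs c v hv => exact Submodule.smul_mem _ c hv

theorem stateField_mem_weight {d e : ℤ} {u v : AffineVA κ} (n : ℤ) (hu : u ∈ weight κ d)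
    (hv : v ∈ weight κ e) : (stateField κ u).1 n v ∈ weight κ (d + e - n - 1) := by
  have key : ∀ (L : List (g × ℤ)) (e n : ℤ) (v : AffineVA κ), v ∈ weight κ e →
      (stateField κ (L.foldr (fun p v => mode κ p.1 p.2 v) (vacuum κ))).1 n v ∈
        weight κ (-(L.map Prod.snd).sum + e - n - 1) := by
    intro L
    induction L with
    | nil =>
      intro e n v hv
      rw [List.foldr_nil, stateField_vacuum]
      by_cases hn : n = -1
      · subst hn
        simpa [idField] using hv
      · have : (idField (AffineVA κ)).1 n v = 0 := by simp [idField, hn]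
        rw [this]
        exact Submodule.zero_mem _
    | cons p L ih =>
      intro e n v hv
      obtain ⟨X, m⟩ := p
      rw [List.foldr_cons, stateField_mode]
      set b := stateField κ (L.foldr (fun p v => mode κ p.1 p.2 v) (vacuum κ)) with hb
      obtain ⟨N, hN⟩ := exists_nat b n v
      obtain ⟨N', hN'⟩ := exists_nat (current κ X) 0 v
      simp only [zero_add] at hN'
      simp only [fieldProd, LinearMap.sub_apply, Submodule.coe_sub, Pi.sub_apply]
      rw [prodLeft_apply _ _ _ _ _ hN, prodRight_apply _ _ _ _ _ hN']
      refine Submodule.sub_mem _ (Submodule.sum_mem _ fun j _ => zsmul_mem ?_ _)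
        (Submodule.sum_mem _ fun j _ => zsmul_mem ?_ _)
      · have := mode_mem_weight κ X (m - j) (ih e (n + j) v hv)
        rw [List.map_cons, List.sum_cons]
        rw [show -(m + (L.map Prod.snd).sum) + e - n - 1 =
          -(L.map Prod.snd).sum + e - (n + j) - 1 - (m - j) by ring]
        exact this
      · have := ih (e - j) (m + n - j) _ (mode_mem_weight κ X j hv)
        rw [List.map_cons, List.sum_cons]
        rw [show -(m + (L.map Prod.snd).sum) + e - n - 1 =
          -(L.map Prod.snd).sum + (e - j) - (m + n - j) - 1 by ring]
        exact this
  induction hu using Submodule.span_induction with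
  | mem u hu =>
    obtain ⟨L, hL, rfl⟩ := hu
    have := key L e n v hv
    rwa [hL, neg_neg] at this
  | zero => rw [map_zero]; exact Submodule.zero_mem _
  | add u w _ _ hu hw =>
    rw [map_add]
    exact Submodule.add_mem _ hu hw
  | smul c u _ hu =>
    rw [map_smul]
    exact Submodule.smul_mem _ c hu

/-- The universal affine vertex algebra `V^κ(g)` with its state-field correspondence
`Y(u, z) = ∑ u_(n) z^(-n-1)` and its conformal grading. -/
def affineVertexData : VertexData (AffineVA κ) where
  vac := vacuum κ
  Y := (Fields (AffineVA κ)).subtype ∘ₗ stateField κ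
  wt := weight κ
  vac_mem := vacuum_mem_weight κ
  Y_mem n hu hv := stateField_mem_weight κ n hu hv
  iSup_wt := iSup_weight κ

end

section
variable (l n : ℕ)

/-- The Lie algebra `gl_n ⊕ ⋯ ⊕ gl_n` with `l` summands. -/
abbrev LeviAlgebra : Type := Fin l → Matrix (Fin n) (Fin n) ℂ

/-- The matrix unit `E_{ij}` placed in the `s`-th summand. -/
def unit {l n : ℕ} (s : Fin l) (i j : Fin n) : LeviAlgebra l n :=
  Pi.single s (Matrix.single i j 1)

/-- The parameter `α = k + (l - 1) n`. -/
def alpha (k : ℂ) : ℂ := k + ((l : ℂ) - 1) * n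

/-- The invariant form `∑_s (α tr(X_s Y_s) + tr(X_s) tr(Y_s))` on `gl_n ⊕ ⋯ ⊕ gl_n`, with value
`δ_{st} (δ_{iq} δ_{jp} α + δ_{ij} δ_{pq})` at `(E^{[s]}_{ij}, E^{[t]}_{pq})`. -/
def leviForm (k : ℂ) : InvForm (LeviAlgebra l n) where
  form := LinearMap.mk₂ ℂ
    (fun X Y => ∑ s, (alpha l n k * (X s * Y s).trace + (X s).trace * (Y s).trace))
    (fun X X' Y => by
      rw [← Finset.sum_add_distrib]
      refine Finset.sum_congr rfl fun s _ => ?_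
      rw [Pi.add_apply, add_mul, Matrix.trace_add, Matrix.trace_add]; ring)
    (fun c X Y => by
      rw [smul_eq_mul, Finset.mul_sum]
      refine Finset.sum_congr rfl fun s _ => ?_
      rw [Pi.smul_apply, smul_mul_assoc, Matrix.trace_smul, Matrix.trace_smul, smul_eq_mul,
        smul_eq_mul]; ring)
    (fun X Y Y' => by
      rw [← Finset.sum_add_distrib]
      refine Finset.sum_congr rfl fun s _ => ?_
      rw [Pi.add_apply, mul_add, Matrix.trace_add, Matrix.trace_add]; ring)
    (fun c X Y => by
      rw [smul_eq_mul, Finset.mul_sum]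
      refine Finset.sum_congr rfl fun s _ => ?_
      rw [Pi.smul_apply, mul_smul_comm, Matrix.trace_smul, Matrix.trace_smul, smul_eq_mul,
        smul_eq_mul]; ring)
  symm := ⟨fun X Y => by
    simp only [LinearMap.mk₂_apply]
    refine Finset.sum_congr rfl fun s _ => ?_
    rw [Matrix.trace_mul_comm, mul_comm (X s).trace]⟩
  inv X Y Z := by
    simp only [LinearMap.mk₂_apply]
    rw [← Finset.sum_neg_distrib]
    refine Finset.sum_congr rfl fun s _ => ?_
    have h1 : ⁅X, Y⁆ s = X s * Y s - Y s * X s := rfl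
    have h2 : ⁅X, Z⁆ s = X s * Z s - Z s * X s := rfl
    have h3 : (Y s * X s * Z s).trace = (Y s * (X s * Z s)).trace := by rw [mul_assoc]
    have h4 : (X s * Y s * Z s).trace = (Y s * (Z s * X s)).trace := by
      rw [mul_assoc, Matrix.trace_mul_comm, mul_assoc]
    have h5 : (X s * Y s - Y s * X s).trace = 0 := by
      rw [Matrix.trace_sub, Matrix.trace_mul_comm, sub_self]
    have h6 : (X s * Z s - Z s * X s).trace = 0 := by
      rw [Matrix.trace_sub, Matrix.trace_mul_comm, sub_self]
    rw [h1, h2, h5, h6, sub_mul, mul_sub, Matrix.trace_sub, Matrix.trace_sub, h3, h4]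
    ring

variable {n} in
/-- Left multiplication by the factor `τ + (E^{[s]}_{ij}[-1])_{ij}`. A family `w` represents the
matrix `∑_{c ≤ l} τ^c w c` of differential operators, with states as entries; the powers of
`τ` are moved to the left through `[X[-m], τ] = α m X[-m-1]`, which gives
`X[-1] τ^a = ∑_c (a choose c) (a-c)! α^(a-c) τ^c X[-1-(a-c)]`, and `X[-m]` acts on states as
the mode `X(-m)`. -/
def miuraFactor (k : ℂ) (s : Fin l) (w : ℕ → Fin n → Fin n → AffineVA (leviForm l n k)) :
    ℕ → Fin n → Fin n → AffineVA (leviForm l n k) :=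
  fun c i j => (if c = 0 then 0 else w (c - 1) i j) +
    ∑ a ∈ Finset.Icc c l, ((a.choose c : ℂ) * ((a - c).factorial : ℂ) * alpha l n k ^ (a - c)) •
      ∑ p, mode (leviForm l n k) (unit s i p) (-1 - ((a - c : ℕ) : ℤ)) (w a p j)

/-- The coefficients `w c` in
`(τ + E^{[1]}[-1]) ⋯ (τ + E^{[l]}[-1]) |0⟩ = ∑_c τ^c w c`. -/
def miuraCoeff (k : ℂ) : ℕ → Fin n → Fin n → AffineVA (leviForm l n k) :=
  (List.finRange l).foldr (fun s w => miuraFactor l k s w)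
    (fun c i j => if c = 0 ∧ i = j then vacuum (leviForm l n k) else 0)

/-- The element `W^{(r)}_{ij}` for `1 ≤ r ≤ l`, the `(i, j)` entry of the matrix `W^{(r)}` in
`(τ + A^{[1]}) ⋯ (τ + A^{[l]}) = τ^l + ∑_{r=1}^l τ^(l-r) W^{(r)}`, `A^{[s]} = (E^{[s]}_{ij}[-1])`. -/
def W (k : ℂ) (r : ℕ) (i j : Fin n) : AffineVA (leviForm l n k) := miuraCoeff l n k (l - r) i j

theorem miuraFactor_mem {n : ℕ} (k : ℂ) (s : Fin l) {t : ℤ}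
    {w : ℕ → Fin n → Fin n → AffineVA (leviForm l n k)}
    (hw : ∀ (c : ℕ) i j, w c i j ∈ weight (leviForm l n k) (t - c)) (c : ℕ) (i j : Fin n) :
    miuraFactor l k s w c i j ∈ weight (leviForm l n k) (t + 1 - c) := by
  refine Submodule.add_mem _ ?_ (Submodule.sum_mem _ fun a ha => Submodule.smul_mem _ _
    (Submodule.sum_mem _ fun p _ => ?_))
  · split_ifs with hc
    · exact Submodule.zero_mem _
    · have := hw (c - 1) i j
      rwa [show t - ((c - 1 : ℕ) : ℤ) = t + 1 - c by omega] at this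
  · have h1 := mode_mem_weight _ (unit s i p) (-1 - ((a - c : ℕ) : ℤ)) (hw a p j)
    have h2 := (Finset.mem_Icc.mp ha).1
    rwa [show t - (a : ℤ) - (-1 - ((a - c : ℕ) : ℤ)) = t + 1 - c by omega] at h1

theorem miuraCoeff_mem (k : ℂ) (c : ℕ) (i j : Fin n) :
    miuraCoeff l n k c i j ∈ weight (leviForm l n k) (l - c) := by
  have key : ∀ (L : List (Fin l)) (c : ℕ) (i j : Fin n),
      L.foldr (fun s w => miuraFactor l k s w)
        (fun c i j => if c = 0 ∧ i = j then vacuum (leviForm l n k) else 0) c i j ∈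
        weight (leviForm l n k) (L.length - c) := by
    intro L
    induction L with
    | nil =>
      intro c i j
      rw [List.foldr_nil]
      split_ifs with h
      · rw [h.1]
        exact vacuum_mem_weight _
      · exact Submodule.zero_mem _
    | cons s L ih =>
      intro c i j
      have := miuraFactor_mem l k s ih c i j
      rw [List.length_cons, Nat.cast_succ]
      exact this
  have := key (List.finRange l) c i j
  rwa [List.length_finRange] at this

theorem W_mem (k : ℂ) {r : ℕ} (hr : r ≤ l) (i j : Fin n) :
    W l n k r i j ∈ weight (leviForm l n k) r := by
  have := miuraCoeff_mem l n k (l - r) i j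
  rwa [show (l : ℤ) - ((l - r : ℕ) : ℤ) = r by omega] at this

/-- The strong generators `W^{(r)}_{ij}`, `1 ≤ r ≤ l`. -/
def strongGenerators (k : ℂ) : Set (AffineVA (leviForm l n k)) :=
  {x | ∃ (r : ℕ) (i j : Fin n), 1 ≤ r ∧ r ≤ l ∧ x = W l n k r i j}

/-- The rectangular `W`-algebra `W^κ(gl_N, f)`, `N = l n`, with `f` nilpotent of Jordan type `(l^n)`,
identified through the Miura map with the vertex subalgebra of the universal affine vertex algebra
of `gl_n ⊕ ⋯ ⊕ gl_n` generated by the elements `W^{(r)}_{ij}`. -/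
def rectW (k : ℂ) :
    VertexData ((affineVertexData (leviForm l n k)).closure (strongGenerators l n k)) :=
  (affineVertexData (leviForm l n k)).sub (strongGenerators l n k) (by
    rintro _ ⟨r, i, j, _, hr, rfl⟩
    exact ⟨r, W_mem l n k hr i j⟩)

/-- The current algebra `𝔘(W^κ(gl_N, (l^n)))`. -/
abbrev CurrentW (k : ℂ) : Type := (rectW l n k).CurrentAlgebra

variable {l n} in
/-- The element `W^{(r)}_{ij}(m) = W^{(r)}_{ij} t^{m+r-1}` of the current algebra, for
`1 ≤ r ≤ l`. -/
def Wmode (k : ℂ) (r : ℕ) (h1 : 1 ≤ r) (hr : r ≤ l) (i j : Fin n) (m : ℤ) : CurrentW l n k :=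
  (rectW l n k).fourier
    ⟨W l n k r i j, VertexData.subset_closure _ ⟨r, i, j, h1, hr, rfl⟩⟩ (m + r - 1)
end

end RectW

end

noncomputable section

attribute [local instance 100] LieRing.ofAssociativeRing

/-! ### Closed subalgebras of the completion and the states whose modes they contain. -/

namespace RectW.VertexData
open Filter Topology

variable {V : Type*} [AddCommGroup V] [Module ℂ V] (D : VertexData V)

/-! Let P be the closure, in the completed free algebra, of the preimage of the subalgebra generated
by the given elements; it has to be everything. P contains the relations, so the Borcherds
identities hold modulo P. Their case p = 0 expresses a mode of u_(r) v as a convergent sum of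
products of modes of u and of v, and P is closed. Hence the homogeneous states all of whose modes
lie in P span a vertex subalgebra (`Y_mem_homModeSub`), and it suffices that this subalgebra
contains every W^{(r)}_{ij}.

The states W^{(1)}_{ij} = ∑_s E^{[s]}_{ij}[-1] generate an affine gl_n; write E_ij(m) for their
modes. Commutators of the given elements yield all E_ij(m) with i ≠ j (`single_mem_of_loop`).
Bracketing with the loops of E_ii - E_jj then spreads a single mode of an off-diagonal second
coefficient to all of its modes (`U_mem_modeSub`).

For higher r, the operator τ is traded for a central variable σ. Let M = ∏_s (σ - αT + A^{[s]}(-1))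
|0⟩, with T the translation operator, and let U_c be the matrix of coefficients of σ^c in M. The
generating function of the W^{(r)} is exp(αT∂_σ) M (`foldr_miuraFactor`), so W^{(r)} and U_{l-r}
differ by derivatives of the U_c with c > l - r, and the U_c may be used instead.

The modes E_ij(m) with m ≥ 0 act on M by closed formulas (`diagOp_zero_miura`, `diagOp_succ_miura`).
The zero mode Q_ij of (U_{l-2})_ij is the zero mode of the quadratic expression ∑_{s<t} A^{[s]}
A^{[t]}, and its action on the i-th column of M is found by induction on the number of factors
(`quadOp_miura`). Now let K be a subspace stable under T, under the E_ij(m) and under the Q_ij with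
i ≠ j, and suppose that K contains all U_{c'} with c' > c and the off-diagonal entries of U_c, where
c < l. Applying Q_ij to (U_c)_ji and then E_ij(0) shows that (U_{c-1})_ij - E_ij(-1)(U_c)_ii lies in
K. Applying E_ji(1) to this element gives α(c - l)(U_c)_ii. As α ≠ 0 and c < l, the diagonal entries
of U_c lie in K, and therefore so do the off-diagonal entries of U_{c-1}. Descending from c = l - 2
exhausts all coefficients (`miura_mem`). -/

theorem toCurrent_eq_zero {x : D.Completed} (hx : x ∈ D.relations) : D.toCurrent x = 0 := by
  rw [← map_zero D.toCurrent]
  refine RingQuot.mkAlgHom_rel ℂ ?_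
  change x - 0 ∈ _
  rw [sub_zero]
  exact _root_.subset_closure (TwoSidedIdeal.subset_span hx)

theorem toCurrent_surjective : Function.Surjective D.toCurrent := RingQuot.mkAlgHom_surjective ℂ _

theorem continuous_toCurrent : Continuous D.toCurrent := continuous_coinduced_rng

/-- A subset of the current algebra generates it topologically if the closed subalgebra generated by
its preimage is everything. -/
theorem dense_adjoin_of_closure_comap_eq_top (S : Set D.CurrentAlgebra)
    (h : ((Algebra.adjoin ℂ S).comap D.toCurrent).topologicalClosure = ⊤) :
    Dense (Algebra.adjoin ℂ S : Set D.CurrentAlgebra) := by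
  have hd : Dense ((Algebra.adjoin ℂ S).comap D.toCurrent : Set D.Completed) := by
    intro x
    rw [← Subalgebra.topologicalClosure_coe, h]
    trivial
  refine (D.toCurrent_surjective.denseRange.dense_image D.continuous_toCurrent hd).mono ?_
  rintro _ ⟨x, hx, rfl⟩
  exact hx

theorem cmode_add (u v : V) (m : ℤ) : D.cmode (u + v) m = D.cmode u m + D.cmode v m := by
  simp only [cmode, gen_add, UniformSpace.Completion.coe_add]

theorem gen_smul (c : ℂ) (v : V) (m : ℤ) : D.gen (c • v) m = c • D.gen v m := by
  rw [gen, ← Finsupp.smul_single]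
  exact map_smul _ _ _

theorem cmode_smul (c : ℂ) (v : V) (m : ℤ) : D.cmode (c • v) m = c • D.cmode v m := by
  simp only [cmode, gen_smul, UniformSpace.Completion.coe_smul]

/-- The map `v ↦ v t^m` to the completion. -/
def cmodeLin (m : ℤ) : V →ₗ[ℂ] D.Completed where
  toFun v := D.cmode v m
  map_add' u v := D.cmode_add u v m
  map_smul' c v := D.cmode_smul c v m

/-- Basic neighbourhoods of zero are subspaces, so a finite sum of late terms stays in the
neighbourhood that contains each of them; completeness does the rest. -/
theorem summable_of_eventually_mem_tail (d : ℤ) (g : ℕ → D.Free)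
    (hg : ∀ N : ℤ, ∃ J : ℕ, ∀ j, J ≤ j → g j ∈ D.tail N d) :
    Summable fun j => (g j : D.Completed) := by
  rw [summable_iff_vanishing]
  intro e he
  have h1 : (fun x : D.Free => (x : D.Completed)) ⁻¹' e ∈ 𝓝 (0 : D.Free) := by
    refine (UniformSpace.Completion.continuous_coe D.Free).continuousAt.preimage_mem_nhds ?_
    rwa [UniformSpace.Completion.coe_zero]
  obtain ⟨f, -, hf⟩ := D.basis.hasBasis_nhds_zero.mem_iff.mp h1
  obtain ⟨J, hJ⟩ := hg (f d)
  refine ⟨Finset.range J, fun t ht => ?_⟩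
  have h2 : ∑ j ∈ t, g j ∈ D.nbhd f := Submodule.sum_mem _ fun j hj =>
    Submodule.mem_iSup_of_mem d (hJ j (not_lt.mp fun h =>
      Finset.disjoint_left.mp ht hj (Finset.mem_range.mpr h)))
  have h3 := hf h2
  rw [Set.mem_preimage] at h3
  have h4 : ((∑ j ∈ t, g j : D.Free) : D.Completed) = ∑ j ∈ t, (g j : D.Completed) :=
    map_sum (UniformSpace.Completion.coeRingHom (α := D.Free)) _ _
  rwa [h4] at h3

/-- The total degree does not depend on j while the degree of the right factor grows with j, which
is convergence to zero in the degreewise topology. This is where homogeneity of the states is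
needed. -/
theorem summable_cmode_mul_cmode {d e : ℤ} {u v : V} (hu : u ∈ D.wt d) (hv : v ∈ D.wt e)
    (c : ℕ → ℤ) (p q : ℤ) :
    Summable fun j : ℕ => c j • (D.cmode u (p - j) * D.cmode v (q + j)) := by
  have h1 : ∀ j : ℕ, c j • (D.cmode u (p - j) * D.cmode v (q + j)) =
      ((c j • (D.gen u (p - j) * D.gen v (q + j)) : D.Free) : D.Completed) := by
    intro j
    rw [cmode, cmode, ← UniformSpace.Completion.coe_mul]
    exact (map_zsmul (UniformSpace.Completion.coeRingHom (α := D.Free)) _ _).symm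
  simp only [h1]
  refine D.summable_of_eventually_mem_tail (p - d + 1 + (q - e + 1)) _ fun N =>
    ⟨(N - q + e).toNat, fun j hj => zsmul_mem ?_ _⟩
  refine Submodule.mem_iSup_of_mem (q + j - e + 1)
    (Submodule.mem_iSup_of_mem (by omega) (Submodule.mul_mem_mul ?_ (D.gen_mem_deg hv _)))
  have := D.gen_mem_deg hu (p - j)
  rwa [show p - d + 1 + (q - e + 1) - (q + j - e + 1) = p - j - d + 1 by ring]

section
variable (P : Subalgebra ℂ D.Completed)

/-- The states all of whose Fourier modes lie in `P`. -/
def modeSub : Submodule ℂ V := ⨅ m, P.toSubmodule.comap (D.cmodeLin m)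

variable {P}

theorem mem_modeSub {v : V} : v ∈ D.modeSub P ↔ ∀ m, D.cmode v m ∈ P := by
  rw [modeSub, Submodule.mem_iInf]
  rfl

theorem cmode_vac_sub_mem (hrel : D.relations ⊆ P) (m : ℤ) : D.cmode D.vac m ∈ P := by
  have h : D.cmode D.vac m - (if m = -1 then 1 else 0) ∈ P := hrel (Or.inl ⟨m, rfl⟩)
  have h2 : (if m = -1 then 1 else 0 : D.Completed) ∈ P := by
    split_ifs
    exacts [one_mem _, zero_mem _]
  simpa using add_mem h h2

theorem vac_mem_modeSub (hrel : D.relations ⊆ P) : D.vac ∈ D.modeSub P :=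
  D.mem_modeSub.mpr (D.cmode_vac_sub_mem hrel)

/-- This is the Borcherds identity with r = 0: binom(0, j) leaves one term on the product side,
which is the commutator. -/
theorem commutator_sub_mem (hrel : D.relations ⊆ P) (u v : V) (p q : ℤ) {N : ℕ}
    (hN : ∀ j : ℕ, N ≤ j → D.Y u j v = 0) :
    D.cmode u p * D.cmode v q - D.cmode v q * D.cmode u p -
      ∑ j ∈ Finset.range N, Ring.choose p j • D.cmode (D.Y u j v) (p + q - j) ∈ P := by
  have h0 : ∀ m, D.cmode 0 m = 0 := fun m => map_zero (D.cmodeLin m)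
  rw [← neg_mem_iff]
  refine hrel (Or.inr ⟨u, v, p, q, 0, ?_⟩)
  -- The range has N + 1 terms so that the commutator, which sits at j = 0, is included even when N
  -- = 0.
  have h := hasSum_sum_of_ne_finset_zero (L := .unconditional ℕ) (s := Finset.range (N + 1)) (f := fun j : ℕ =>
    Ring.choose p j • D.cmode (D.Y u (0 + j) v) (p + q - j) -
      ((-1) ^ j * Ring.choose 0 j : ℤ) •
        (D.cmode u (p + 0 - j) * D.cmode v (q + j) -
          ((0 : ℤ).negOnePow : ℤ) • (D.cmode v (q + 0 - j) * D.cmode u (p + j)))) (by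
    intro j hj
    have hj' : N + 1 ≤ j := not_lt.mp fun h => hj (Finset.mem_range.mpr h)
    rw [zero_add, hN j (by omega), h0, smul_zero, Ring.choose_zero_pos ℤ (by omega)]
    simp)
  convert h using 1
  have e1 : ∑ j ∈ Finset.range (N + 1), ((-1) ^ j * Ring.choose 0 j : ℤ) •
        (D.cmode u (p + 0 - j) * D.cmode v (q + j) -
          ((0 : ℤ).negOnePow : ℤ) • (D.cmode v (q + 0 - j) * D.cmode u (p + j))) =
      D.cmode u p * D.cmode v q - D.cmode v q * D.cmode u p := by
    rw [Finset.sum_range_succ', Finset.sum_eq_zero (fun j _ => by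
      rw [Ring.choose_zero_pos ℤ (Nat.succ_pos j)]; simp)]
    simp
  rw [Finset.sum_sub_distrib, e1, Finset.sum_range_succ, zero_add, hN N le_rfl, h0, smul_zero,
    add_zero]
  simp

/-- In the Borcherds identity with p = 0 the side containing the products u_(r+j) v reduces to its
term j = 0. The other side converges, its partial sums lie in P, and P is closed. -/
theorem Y_mem_modeSub (hP : IsClosed (P : Set D.Completed)) (hrel : D.relations ⊆ P)
    {d e : ℤ} {u v : V} (hu : u ∈ D.wt d) (hv : v ∈ D.wt e) (hu' : u ∈ D.modeSub P)
    (hv' : v ∈ D.modeSub P) (r : ℤ) : D.Y u r v ∈ D.modeSub P := by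
  rw [mem_modeSub] at hu' hv' ⊢
  intro q
  set a := fun j : ℕ => ((-1) ^ j * Ring.choose r j) •
        (D.cmode u (0 + r - j) * D.cmode v (q + j) -
          (r.negOnePow : ℤ) • (D.cmode v (q + r - j) * D.cmode u (0 + j))) with ha
  have hs : Summable a := by
    have h1 := D.summable_cmode_mul_cmode hu hv (fun j => (-1) ^ j * Ring.choose r j) (0 + r) q
    have h2 := D.summable_cmode_mul_cmode hv hu
      (fun j => ((-1) ^ j * Ring.choose r j) * (r.negOnePow : ℤ)) (q + r) 0
    refine (h1.sub h2).congr fun j => ?_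
    simp only [ha, smul_sub, mul_smul]
  obtain ⟨y, hy⟩ := hs
  have hyP : y ∈ P := by
    refine hP.mem_of_tendsto hy (Eventually.of_forall fun s => ?_)
    refine sum_mem fun j _ => ?_
    exact zsmul_mem (sub_mem (mul_mem (hu' _) (hv' _)) (zsmul_mem (mul_mem (hv' _) (hu' _)) _)) _
  have hb : HasSum (fun j : ℕ => Ring.choose (0 : ℤ) j • D.cmode (D.Y u (r + j) v) (0 + q - j))
      (D.cmode (D.Y u r v) q) := by
    convert hasSum_single (f := fun j : ℕ => Ring.choose (0 : ℤ) j •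
      D.cmode (D.Y u (r + j) v) (0 + q - j)) 0 (fun j hj => by
        rw [Ring.choose_zero_pos ℤ (Nat.pos_of_ne_zero hj), zero_smul]) using 1
    simp
  have := hrel (Or.inr ⟨u, v, 0, q, r, hb.sub hy⟩)
  have h3 := add_mem (S := Subalgebra ℂ D.Completed) this hyP
  rwa [sub_add_cancel] at h3

variable (P) in
/-- The span of the homogeneous states all of whose Fourier modes lie in `P`. -/
def homModeSub : Submodule ℂ V := ⨆ d, D.modeSub P ⊓ D.wt d

theorem homModeSub_le : D.homModeSub P ≤ D.modeSub P := iSup_le fun _ => inf_le_left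

theorem vac_mem_homModeSub (hrel : D.relations ⊆ P) : D.vac ∈ D.homModeSub P :=
  Submodule.mem_iSup_of_mem 0 ⟨D.vac_mem_modeSub hrel, D.vac_mem⟩

/-- Products of homogeneous states are homogeneous, so passing to the span of homogeneous states
makes the convergence argument available and loses nothing under products. -/
theorem Y_mem_homModeSub (hP : IsClosed (P : Set D.Completed)) (hrel : D.relations ⊆ P)
    {u v : V} (hu : u ∈ D.homModeSub P) (hv : v ∈ D.homModeSub P) (n : ℤ) :
    D.Y u n v ∈ D.homModeSub P := by
  induction hu using Submodule.iSup_induction' with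
  | mem d u hu =>
    induction hv using Submodule.iSup_induction' with
    | mem e v hv =>
      exact Submodule.mem_iSup_of_mem (d + e - n - 1)
        ⟨D.Y_mem_modeSub hP hrel hu.2 hv.2 hu.1 hv.1 n, D.Y_mem n hu.2 hv.2⟩
    | zero => rw [map_zero]; exact Submodule.zero_mem _
    | add v w _ _ hv hw => rw [map_add]; exact Submodule.add_mem _ hv hw
  | zero => rw [map_zero]; exact Submodule.zero_mem _
  | add u w _ _ hu hw => rw [map_add]; exact Submodule.add_mem _ hu hw

theorem eq_top_of_modeSub_eq_top (hP : IsClosed (P : Set D.Completed)) (h : D.modeSub P = ⊤) :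
    P = ⊤ := by
  have h1 : ∀ x : D.Free, (x : D.Completed) ∈ P := by
    intro x
    induction x using free_induction with
    | h1 c =>
      have := P.algebraMap_mem c
      rwa [UniformSpace.Completion.algebraMap_def] at this
    | hg v m =>
      have : v ∈ D.modeSub P := by rw [h]; trivial
      exact D.mem_modeSub.mp this m
    | ha a b ha hb => rw [UniformSpace.Completion.coe_add]; exact add_mem ha hb
    | hm a b ha hb => rw [UniformSpace.Completion.coe_mul]; exact mul_mem ha hb
  refine (Algebra.eq_top_iff).mpr fun x => ?_
  induction x using UniformSpace.Completion.induction_on with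
  | hp => exact hP
  | ih a => exact h1 a

end
end RectW.VertexData

namespace RectW

theorem expCoeff_neg_one (j : ℕ) : expCoeff (-1) j = 1 := by
  have h := Ring.choose_neg (R := ℤ) 1 j
  rw [expCoeff, h]
  simp [Int.negOnePow_def, Ring.choose_natCast, ← mul_pow, Units.smul_def]

/-! ### Families of coefficients as polynomials in a central variable σ. -/

section Coefficients
variable {V : Type*} [AddCommGroup V] [Module ℂ V]

/-- The coefficientwise action of an operator on families of coefficients. -/
def coeffwise (f : Module.End ℂ V) : Module.End ℂ (ℕ → V) := f.compLeft ℕ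

theorem coeffwise_apply (f : Module.End ℂ V) (x : ℕ → V) (c : ℕ) : coeffwise f x c = f (x c) := rfl

theorem coeffwise_add (f g : Module.End ℂ V) : coeffwise (f + g) = coeffwise f + coeffwise g := rfl

theorem coeffwise_sum {β : Type*} (s : Finset β) (f : β → Module.End ℂ V) :
    coeffwise (∑ b ∈ s, f b) = ∑ b ∈ s, coeffwise (f b) := by
  refine LinearMap.ext fun x => funext fun c => ?_
  simp only [LinearMap.sum_apply, coeffwise_apply, Finset.sum_apply]

variable (V) in
/-- The derivative of `∑ σ^c x_c` with respect to `σ`. -/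
def coeffDeriv : Module.End ℂ (ℕ → V) where
  toFun x c := ((c : ℂ) + 1) • x (c + 1)
  map_add' _ _ := funext fun _ => smul_add _ _ _
  map_smul' _ _ := funext fun _ => smul_comm _ _ _

variable (V) in
/-- The multiplication of `∑ σ^c x_c` by `σ`. -/
def coeffShift : Module.End ℂ (ℕ → V) where
  toFun x c := if c = 0 then 0 else x (c - 1)
  map_add' x y := funext fun c => by
    simp only [Pi.add_apply]; split_ifs
    exacts [(add_zero 0).symm, rfl]
  map_smul' a x := funext fun c => by
    simp only [Pi.smul_apply, RingHom.id_apply]; split_ifs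
    exacts [(smul_zero a).symm, rfl]

theorem coeffDeriv_apply (x : ℕ → V) (c : ℕ) :
    coeffDeriv V x c = ((c : ℂ) + 1) • x (c + 1) := rfl

theorem coeffShift_apply (x : ℕ → V) (c : ℕ) :
    coeffShift V x c = if c = 0 then 0 else x (c - 1) := rfl

theorem coeffDeriv_coeffwise (f : Module.End ℂ V) (x : ℕ → V) :
    coeffDeriv V (coeffwise f x) = coeffwise f (coeffDeriv V x) :=
  funext fun c => by simp only [coeffDeriv_apply, coeffwise_apply, map_smul]

theorem coeffShift_coeffwise (f : Module.End ℂ V) (x : ℕ → V) :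
    coeffShift V (coeffwise f x) = coeffwise f (coeffShift V x) :=
  funext fun c => by
    simp only [coeffShift_apply, coeffwise_apply]
    split_ifs
    exacts [(map_zero f).symm, rfl]

theorem coeffDeriv_coeffShift (x : ℕ → V) :
    coeffDeriv V (coeffShift V x) = coeffShift V (coeffDeriv V x) + x := by
  refine funext fun c => ?_
  simp only [coeffDeriv_apply, coeffShift_apply, Pi.add_apply]
  cases c with
  | zero => simp
  | succ c =>
    rw [if_neg (by omega), if_neg (by omega), Nat.add_sub_cancel, Nat.add_sub_cancel]
    push_cast
    module

theorem iterate_coeffDeriv_coeffwise (f : Module.End ℂ V) (m : ℕ) (x : ℕ → V) :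
    (coeffDeriv V ^ m) (coeffwise f x) = coeffwise f ((coeffDeriv V ^ m) x) := by
  induction m with
  | zero => rfl
  | succ m ih => rw [pow_succ', Module.End.mul_apply, ih, coeffDeriv_coeffwise]; rfl

/-- Iterated form of the Weyl relation ∂_σ σ = σ ∂_σ + 1. -/
theorem iterate_coeffDeriv_coeffShift (m : ℕ) (x : ℕ → V) :
    (coeffDeriv V ^ (m + 1)) (coeffShift V x) =
      coeffShift V ((coeffDeriv V ^ (m + 1)) x) + ((m : ℂ) + 1) • (coeffDeriv V ^ m) x := by
  induction m with
  | zero => simp [coeffDeriv_coeffShift]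
  | succ m ih =>
    rw [pow_succ' _ (m + 1), Module.End.mul_apply, ih, map_add, map_smul, coeffDeriv_coeffShift,
      Module.End.mul_apply, pow_succ' _ m, Module.End.mul_apply]
    push_cast
    module

theorem iterate_coeffDeriv_apply (m c : ℕ) (x : ℕ → V) :
    (coeffDeriv V ^ m) x c = ((c + m).descFactorial m : ℂ) • x (c + m) := by
  induction m generalizing c with
  | zero => simp
  | succ m ih =>
    rw [pow_succ', Module.End.mul_apply, coeffDeriv_apply, ih, smul_smul,
      show c + 1 + m = c + (m + 1) by ring, Nat.descFactorial_succ,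
      show c + (m + 1) - m = c + 1 by omega]
    push_cast
    rfl

end Coefficients

/-! ### Matrix currents and the Miura product. -/

/-- The Kronecker delta. -/
def kron {n : Type*} [DecidableEq n] (i j : n) : ℂ := if i = j then 1 else 0

section
variable {n : Type*} [DecidableEq n]

theorem kron_self (i : n) : kron i i = 1 := if_pos rfl

theorem kron_of_ne {i j : n} (h : i ≠ j) : kron i j = 0 := if_neg h

theorem sum_kron_smul [Fintype n] {M : Type*} [AddCommGroup M] [Module ℂ M] (i : n) (x : n → M) :
    ∑ j, kron i j • x j = x i := by
  simp [kron, ite_smul]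

theorem sum_kron_smul' [Fintype n] {M : Type*} [AddCommGroup M] [Module ℂ M] (i : n) (x : n → M) :
    ∑ j, kron j i • x j = x i := by
  simp [kron, ite_smul]

end

/-- Commuting copies, indexed by `ι`, of the currents of the affinization of `gl_n` with the form
`α tr(XY) + tr(X) tr(Y)`, acting on a space `V` with a translation operator and a vacuum vector. -/
structure MatrixCurrents (ι n V : Type*) [DecidableEq ι] [DecidableEq n] [AddCommGroup V]
    [Module ℂ V] (α : ℂ) where
  cur : ι → n → n → Fields V
  T : Module.End ℂ V
  vac : V
  cur_comm_of_ne : ∀ {s t : ι}, s ≠ t → ∀ (i j k q : n) (p r : ℤ) (v : V),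
    (cur s i j).1 p ((cur t k q).1 r v) = (cur t k q).1 r ((cur s i j).1 p v)
  cur_comm : ∀ (s : ι) (i j k q : n) (p r : ℤ) (v : V),
    (cur s i j).1 p ((cur s k q).1 r v) = (cur s k q).1 r ((cur s i j).1 p v) +
      (kron j k • (cur s i q).1 (p + r) v - kron i q • (cur s k j).1 (p + r) v +
        (if p + r = 0 then (p : ℂ) * (α * kron i q * kron j k + kron i j * kron k q) else 0) • v)
  cur_T : ∀ (s : ι) (i j : n) (m : ℤ) (v : V),
    (cur s i j).1 m (T v) = T ((cur s i j).1 m v) + (m : ℂ) • (cur s i j).1 (m - 1) v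
  cur_vac : ∀ (s : ι) (i j : n) (m : ℤ), 0 ≤ m → (cur s i j).1 m vac = 0
  T_vac : T vac = 0

namespace MatrixCurrents
variable {ι n V : Type*} [DecidableEq ι] [DecidableEq n] [AddCommGroup V]
  [Module ℂ V] {α : ℂ} (C : MatrixCurrents ι n V α)

/-- The sum over `s ∈ L` of the `s`-th copies of the current of the matrix unit `E_{ij}`. -/
def diag (L : List ι) (i j : n) : Fields V := (L.map fun s => C.cur s i j).sum

theorem diag_nil (i j : n) (m : ℤ) : (C.diag [] i j).1 m = 0 := rfl

theorem diag_cons (s : ι) (L : List ι) (i j : n) (m : ℤ) :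
    (C.diag (s :: L) i j).1 m = (C.cur s i j).1 m + (C.diag L i j).1 m := by
  rw [diag, List.map_cons, List.sum_cons]
  rfl

theorem cur_diag_comm {s : ι} {L : List ι} (hs : s ∉ L) (i j k q : n) (p r : ℤ) (v : V) :
    (C.cur s i j).1 p ((C.diag L k q).1 r v) = (C.diag L k q).1 r ((C.cur s i j).1 p v) := by
  induction L with
  | nil => simp [diag_nil]
  | cons t L ih =>
    rw [List.mem_cons, not_or] at hs
    simp only [diag_cons, LinearMap.add_apply, map_add, ih hs.2, C.cur_comm_of_ne hs.1]

theorem diag_T (L : List ι) (i j : n) (m : ℤ) (v : V) :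
    (C.diag L i j).1 m (C.T v) = C.T ((C.diag L i j).1 m v) +
      (m : ℂ) • (C.diag L i j).1 (m - 1) v := by
  induction L with
  | nil => simp [diag_nil]
  | cons t L ih =>
    simp only [diag_cons, LinearMap.add_apply, map_add, ih, C.cur_T]
    module

variable [Fintype n]

/-- The family of coefficients `u_c` of
`∏_{s ∈ L} (σ - α T + A^{[s]}(-1)) |0⟩ = ∑_c σ^c u_c`. -/
def miura : List ι → n → n → ℕ → V
  | [] => fun i j => Pi.single 0 (kron i j • C.vac)
  | s :: L => fun i j => coeffShift V (miura L i j) - α • coeffwise C.T (miura L i j) +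
      ∑ b, coeffwise ((C.cur s i b).1 (-1)) (miura L b j)

theorem miura_nil (i j : n) : C.miura [] i j = Pi.single 0 (kron i j • C.vac) := rfl

theorem miura_cons (s : ι) (L : List ι) (i j : n) :
    C.miura (s :: L) i j = coeffShift V (C.miura L i j) - α • coeffwise C.T (C.miura L i j) +
      ∑ b, coeffwise ((C.cur s i b).1 (-1)) (C.miura L b j) := rfl

theorem miura_eq_zero (L : List ι) (i j : n) {c : ℕ} (hc : L.length < c) : C.miura L i j c = 0 := by
  induction L generalizing i j c with
  | nil => exact Pi.single_eq_of_ne (by simp at hc; omega) _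
  | cons s L ih =>
    rw [List.length_cons] at hc
    simp only [miura_cons, Pi.add_apply, Pi.sub_apply, Pi.smul_apply, Finset.sum_apply,
      coeffwise_apply, coeffShift_apply, ih _ _ (show L.length < c by omega)]
    rw [if_neg (by omega), ih _ _ (by omega)]
    simp

theorem miura_length (L : List ι) (i j : n) : C.miura L i j L.length = kron i j • C.vac := by
  induction L generalizing i j with
  | nil => exact Pi.single_eq_same _ _
  | cons s L ih =>
    simp only [miura_cons, Pi.add_apply, Pi.sub_apply, Pi.smul_apply, Finset.sum_apply,
      coeffwise_apply, coeffShift_apply, List.length_cons,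
      C.miura_eq_zero L _ _ (Nat.lt_succ_self L.length)]
    rw [if_neg (by omega), Nat.add_sub_cancel, ih]
    simp

theorem iterate_coeffDeriv_miura (L : List ι) (i j : n) {m : ℕ} (hm : L.length < m) :
    (coeffDeriv V ^ m) (C.miura L i j) = 0 :=
  funext fun c => by
    rw [iterate_coeffDeriv_apply, C.miura_eq_zero L i j (by omega), smul_zero]; rfl

/-- The product over L is built from T and from currents at other sites. The annihilation modes at
site s can be moved through these down to the vacuum. -/
theorem coeffwise_cur_miura {s : ι} {L : List ι} (hs : s ∉ L) (i j k q : n) {m : ℤ} (hm : 0 ≤ m) :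
    coeffwise ((C.cur s i j).1 m) (C.miura L k q) = 0 := by
  induction L generalizing k m with
  | nil =>
    refine funext fun c => ?_
    rw [coeffwise_apply, miura_nil]
    by_cases hc : c = 0
    · subst hc
      rw [Pi.single_eq_same, map_smul, C.cur_vac _ _ _ _ hm, smul_zero]; rfl
    · rw [Pi.single_eq_of_ne hc, map_zero]; rfl
  | cons t L ih =>
    rw [List.mem_cons, not_or] at hs
    have h1 : ∀ k m, 0 ≤ m → ∀ c, (C.cur s i j).1 m (C.miura L k q c) = 0 := fun k m hm c =>
      congrFun (ih hs.2 k hm) c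
    refine funext fun c => ?_
    simp only [miura_cons, Pi.add_apply, Pi.sub_apply, Pi.smul_apply, Finset.sum_apply,
      coeffwise_apply, coeffShift_apply, map_add, map_sub, map_smul, map_sum, C.cur_T,
      C.cur_comm_of_ne hs.1, h1 _ _ hm, Pi.zero_apply]
    -- Passing T lowers the mode to m - 1. For m = 0 this is a creation mode, but its coefficient m
    -- vanishes.
    have h2 : (m : ℂ) • (C.cur s i j).1 (m - 1) (C.miura L k q c) = 0 := by
      rcases hm.eq_or_lt with rfl | hm
      · simp
      · rw [h1 _ _ (by omega), smul_zero]
    rw [h2]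
    split_ifs <;> simp [h1 _ _ hm]

end MatrixCurrents
-- Annihilation modes of the diagonal currents acting on the Miura product.
namespace MatrixCurrents
variable {ι n V : Type*} [DecidableEq ι] [DecidableEq n] [AddCommGroup V]
  [Module ℂ V] {α : ℂ} (C : MatrixCurrents ι n V α)

/-- The coefficientwise action of the modes of the `s`-th copy of the current of `E_{ij}`. -/
def curOp (s : ι) (i j : n) (m : ℤ) : Module.End ℂ (ℕ → V) := coeffwise ((C.cur s i j).1 m)

/-- The coefficientwise action of the modes of `C.diag L i j`. -/
def diagOp (L : List ι) (i j : n) (m : ℤ) : Module.End ℂ (ℕ → V) := coeffwise ((C.diag L i j).1 m)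

/-- The operator `σ - α T`. -/
def shiftOp : Module.End ℂ (ℕ → V) := coeffShift V - α • coeffwise C.T

theorem shiftOp_apply (x : ℕ → V) : C.shiftOp x = coeffShift V x - α • coeffwise C.T x := rfl

theorem diagOp_nil (i j : n) (m : ℤ) : C.diagOp [] i j m = 0 := rfl

theorem diagOp_cons (s : ι) (L : List ι) (i j : n) (m : ℤ) :
    C.diagOp (s :: L) i j m = C.curOp s i j m + C.diagOp L i j m := by
  rw [diagOp, diag_cons, coeffwise_add]; rfl

theorem curOp_comm (s : ι) (i j k q : n) (p r : ℤ) (x : ℕ → V) :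
    C.curOp s i j p (C.curOp s k q r x) = C.curOp s k q r (C.curOp s i j p x) +
      (kron j k • C.curOp s i q (p + r) x - kron i q • C.curOp s k j (p + r) x +
        (if p + r = 0 then (p : ℂ) * (α * kron i q * kron j k + kron i j * kron k q) else 0) • x) :=
  funext fun _ => C.cur_comm s i j k q p r _

theorem curOp_diagOp_comm {s : ι} {L : List ι} (hs : s ∉ L) (i j k q : n) (p r : ℤ) (x : ℕ → V) :
    C.curOp s i j p (C.diagOp L k q r x) = C.diagOp L k q r (C.curOp s i j p x) :=
  funext fun _ => C.cur_diag_comm hs i j k q p r _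

theorem curOp_T (s : ι) (i j : n) (m : ℤ) (x : ℕ → V) :
    C.curOp s i j m (coeffwise C.T x) = coeffwise C.T (C.curOp s i j m x) +
      (m : ℂ) • C.curOp s i j (m - 1) x :=
  funext fun _ => C.cur_T s i j m _

theorem diagOp_T (L : List ι) (i j : n) (m : ℤ) (x : ℕ → V) :
    C.diagOp L i j m (coeffwise C.T x) = coeffwise C.T (C.diagOp L i j m x) +
      (m : ℂ) • C.diagOp L i j (m - 1) x :=
  funext fun _ => C.diag_T L i j m _

theorem curOp_shiftOp (s : ι) (i j : n) (m : ℤ) (x : ℕ → V) :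
    C.curOp s i j m (C.shiftOp x) = C.shiftOp (C.curOp s i j m x) -
      (α * m) • C.curOp s i j (m - 1) x := by
  rw [shiftOp_apply, shiftOp_apply, map_sub, map_smul, curOp_T, curOp, ← coeffShift_coeffwise]
  module

theorem diagOp_shiftOp (L : List ι) (i j : n) (m : ℤ) (x : ℕ → V) :
    C.diagOp L i j m (C.shiftOp x) = C.shiftOp (C.diagOp L i j m x) -
      (α * m) • C.diagOp L i j (m - 1) x := by
  rw [shiftOp_apply, shiftOp_apply, map_sub, map_smul, diagOp_T, diagOp, ← coeffShift_coeffwise]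
  module

theorem iterate_coeffDeriv_shiftOp (m : ℕ) (x : ℕ → V) :
    (coeffDeriv V ^ (m + 1)) (C.shiftOp x) =
      C.shiftOp ((coeffDeriv V ^ (m + 1)) x) + ((m : ℂ) + 1) • (coeffDeriv V ^ m) x := by
  rw [shiftOp_apply, shiftOp_apply, map_sub, map_smul, iterate_coeffDeriv_coeffwise,
    iterate_coeffDeriv_coeffShift]
  module

theorem iterate_coeffDeriv_curOp (s : ι) (i j : n) (m : ℤ) (p : ℕ) (x : ℕ → V) :
    (coeffDeriv V ^ p) (C.curOp s i j m x) = C.curOp s i j m ((coeffDeriv V ^ p) x) :=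
  iterate_coeffDeriv_coeffwise _ _ _

variable [Fintype n]

theorem miura_cons' (s : ι) (L : List ι) (i j : n) :
    C.miura (s :: L) i j = C.shiftOp (C.miura L i j) +
      ∑ b, C.curOp s i b (-1) (C.miura L b j) := rfl

theorem curOp_miura {s : ι} {L : List ι} (hs : s ∉ L) (i j k q : n) {m : ℤ} (hm : 0 ≤ m) :
    C.curOp s i j m (C.miura L k q) = 0 := C.coeffwise_cur_miura hs i j k q hm

theorem curOp_shiftOp_miura {s : ι} {L : List ι} (hs : s ∉ L) (i j k q : n) {m : ℤ} (hm : 0 ≤ m) :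
    C.curOp s i j m (C.shiftOp (C.miura L k q)) = 0 := by
  rw [curOp_shiftOp, C.curOp_miura hs _ _ _ _ hm, map_zero]
  rcases hm.eq_or_lt with rfl | hm
  · simp
  · rw [C.curOp_miura hs _ _ _ _ (by omega), smul_zero, sub_zero]

/-- The annihilation mode at site s kills the product over L, so only its commutator with the factor
at site s survives. The next lemmas extract the cases m = 0, m = 1 (where only the central term is
left) and m ≥ 2 (where nothing is left). -/
theorem curOp_curOp_miura {s : ι} {L : List ι} (hs : s ∉ L) (i j k b q : n) {m : ℤ} (hm : 0 ≤ m) :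
    C.curOp s i j m (C.curOp s k b (-1) (C.miura L b q)) =
      kron j k • C.curOp s i b (m - 1) (C.miura L b q) -
        kron i b • C.curOp s k j (m - 1) (C.miura L b q) +
        (if m = 1 then (α * kron i b * kron j k + kron i j * kron k b) else 0) •
          C.miura L b q := by
  rw [curOp_comm, C.curOp_miura hs _ _ _ _ hm, map_zero, zero_add, ← sub_eq_add_neg]
  by_cases h : m = 1
  · subst h; simp
  · rw [if_neg (by omega), if_neg h]

theorem sum_curOp_curOp_miura_zero {s : ι} {L : List ι} (hs : s ∉ L) (i j k q : n) :
    ∑ b, C.curOp s i j 0 (C.curOp s k b (-1) (C.miura L b q)) =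
      kron j k • ∑ b, C.curOp s i b (-1) (C.miura L b q) -
        C.curOp s k j (-1) (C.miura L i q) := by
  simp only [C.curOp_curOp_miura hs _ _ _ _ _ le_rfl, Finset.sum_add_distrib,
    Finset.sum_sub_distrib, sum_kron_smul, Finset.smul_sum]
  simp

theorem sum_curOp_curOp_miura_one {s : ι} {L : List ι} (hs : s ∉ L) (i j k q : n) :
    ∑ b, C.curOp s i j 1 (C.curOp s k b (-1) (C.miura L b q)) =
      (α * kron j k) • C.miura L i q + kron i j • C.miura L k q := by
  have h1 : ∀ b, (α * kron i b * kron j k + kron i j * kron k b) • C.miura L b q =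
      kron i b • ((α * kron j k) • C.miura L b q) + kron k b • (kron i j • C.miura L b q) :=
    fun b => by module
  simp only [C.curOp_curOp_miura hs _ _ _ _ _ zero_le_one, if_true, h1, Finset.sum_add_distrib,
    sum_kron_smul, sub_self, C.curOp_miura hs _ _ _ _ le_rfl, smul_zero, zero_add]

theorem curOp_curOp_miura_of_two_le {s : ι} {L : List ι} (hs : s ∉ L) (i j k b q : n) {m : ℤ}
    (hm : 2 ≤ m) : C.curOp s i j m (C.curOp s k b (-1) (C.miura L b q)) = 0 := by
  rw [C.curOp_curOp_miura hs _ _ _ _ _ (by omega), C.curOp_miura hs _ _ _ _ (by omega),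
    C.curOp_miura hs _ _ _ _ (by omega), if_neg (by omega)]
  simp

/-- The zero modes commute with σ - αT and act on each factor by the adjoint action, so the product
transforms like a matrix under commutator with E_ij. The empty product is the identity matrix, which
is invariant. -/
theorem diagOp_zero_miura {L : List ι} (hL : L.Nodup) (i j k q : n) :
    C.diagOp L i j 0 (C.miura L k q) =
      kron j k • C.miura L i q - kron i q • C.miura L k j := by
  induction L generalizing k with
  | nil =>
    rw [diagOp_nil, miura_nil, miura_nil, miura_nil, ← Pi.single_smul, ← Pi.single_smul,
      ← Pi.single_sub, smul_smul, smul_smul, ← sub_smul]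
    have : kron j k * kron i q - kron i q * kron k j = 0 := by
      simp only [kron, eq_comm (a := k)]
      ring
    rw [this, zero_smul, Pi.single_zero]
    rfl
  | cons s L ih =>
    obtain ⟨hs, hL⟩ := List.nodup_cons.mp hL
    simp only [diagOp_cons, LinearMap.add_apply]
    rw [miura_cons', map_add, map_add, map_sum, map_sum, C.curOp_shiftOp_miura hs _ _ _ _ le_rfl,
      C.sum_curOp_curOp_miura_zero hs, diagOp_shiftOp]
    simp only [← C.curOp_diagOp_comm hs, ih hL, map_sub, map_smul, Finset.sum_sub_distrib,
      ← Finset.smul_sum, Int.cast_zero, mul_zero, zero_smul, sub_zero, miura_cons']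
    have h1 : ∑ b, kron j b • C.curOp s k b (-1) (C.miura L i q) =
        C.curOp s k j (-1) (C.miura L i q) := sum_kron_smul _ _
    rw [h1]
    module

/-- Both sides obey the same recursion when a factor is added. Moving E(m+1) past σ - αT produces
-α(m+1)E(m), and moving ∂_σ^(m+1) past it produces (m+1)∂_σ^m; these match by the formula for m - 1
when m ≥ 1. -/
theorem diagOp_succ_miura {L : List ι} (hL : L.Nodup) (i j k q : n) (m : ℕ) :
    C.diagOp L i j (m + 1) (C.miura L k q) = (-α) ^ m • (coeffDeriv V ^ (m + 1))
      (kron i j • C.miura L k q + (α * kron i q) • C.miura L k j) := by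
  induction L generalizing k m with
  | nil =>
    rw [diagOp_nil, map_add, map_smul, map_smul, C.iterate_coeffDeriv_miura _ _ _ (by simp),
      C.iterate_coeffDeriv_miura _ _ _ (by simp)]
    simp
  | cons s L ih =>
    obtain ⟨hs, hL⟩ := List.nodup_cons.mp hL
    simp only [diagOp_cons, LinearMap.add_apply]
    rw [miura_cons', miura_cons', map_add, map_add, map_sum, map_sum,
      C.curOp_shiftOp_miura hs _ _ _ _ (by omega), diagOp_shiftOp]
    simp only [← C.curOp_diagOp_comm hs, ih hL, add_sub_cancel_right]
    simp only [map_add, map_smul, map_sum, iterate_coeffDeriv_shiftOp, iterate_coeffDeriv_curOp,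
      Finset.sum_add_distrib, ← Finset.smul_sum, smul_add]
    cases m with
    -- Here E(0) contributes -α(δ_jk M_iq - δ_iq M_kj), and the central term at site s contributes
    -- αδ_jk M_iq + δ_ij M_kq. The two δ_jk terms cancel precisely because the shift is by αT.
    | zero =>
      rw [Nat.cast_zero, show (0 : ℤ) + 1 = 1 from rfl, C.sum_curOp_curOp_miura_one hs,
        C.diagOp_zero_miura hL]
      simp only [pow_zero, Nat.cast_zero, zero_add, Int.cast_one, mul_one, one_smul,
        Module.End.one_apply]
      module
    | succ m =>
      rw [Finset.sum_eq_zero fun b _ => C.curOp_curOp_miura_of_two_le hs _ _ _ b _ (by omega)]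
      have := ih hL k m
      rw [Nat.cast_succ, this]
      push_cast
      simp only [map_add, map_smul, pow_succ]
      module

end MatrixCurrents

/-! ### Zero modes of normally ordered products. -/

section
variable {V : Type*} [AddCommGroup V] [Module ℂ V]

/-- The zero mode of the normally ordered product of two fields. -/
def normalOrderedZeroMode (a b : Fields V) : Module.End ℂ V := (fieldProd a (-1) b).1 0

/-- All coefficients of (x - z)^(-1) equal 1 in one expansion and -1 in the other, so the difference
defining the residue product becomes a sum. -/
theorem normalOrderedZeroMode_apply (a b : Fields V) (v : V) {N : ℕ}
    (ha : ∀ m : ℕ, N ≤ m → a.1 m v = 0) (hb : ∀ m : ℕ, N ≤ m → b.1 m v = 0) :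
    normalOrderedZeroMode a b v = ∑ m ∈ Finset.range N, a.1 (-1 - m) (b.1 m v) +
      ∑ m ∈ Finset.range N, b.1 (-1 - m) (a.1 m v) := by
  have h : normalOrderedZeroMode a b v = (prodLeft a (-1) b).1 0 v - (prodRight a (-1) b).1 0 v :=
    rfl
  rw [h, prodLeft_apply a b (-1) 0 v (N := N) (fun j hj => by rw [zero_add]; exact hb j hj),
    prodRight_apply a b (-1) 0 v ha, sub_eq_add_neg, ← Finset.sum_neg_distrib]
  simp [expCoeff_neg_one, Int.negOnePow_neg]

theorem exists_nat₂ (a b : Fields V) (v w : V) : ∃ N : ℕ, ∀ m : ℕ, N ≤ m →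
    a.1 m v = 0 ∧ b.1 m v = 0 ∧ a.1 m w = 0 ∧ b.1 m w = 0 := by
  obtain ⟨N1, h1⟩ := exists_nat a 0 v
  obtain ⟨N2, h2⟩ := exists_nat b 0 v
  obtain ⟨N3, h3⟩ := exists_nat a 0 w
  obtain ⟨N4, h4⟩ := exists_nat b 0 w
  simp only [zero_add] at h1 h2 h3 h4
  exact ⟨N1 + N2 + N3 + N4, fun m hm => ⟨h1 m (by omega), h2 m (by omega), h3 m (by omega),
    h4 m (by omega)⟩⟩

theorem normalOrderedZeroMode_comm (a b : Fields V) (X : Module.End ℂ V)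
    (ha : ∀ m v, X (a.1 m v) = a.1 m (X v)) (hb : ∀ m v, X (b.1 m v) = b.1 m (X v)) (v : V) :
    X (normalOrderedZeroMode a b v) = normalOrderedZeroMode a b (X v) := by
  obtain ⟨N, hN⟩ := exists_nat₂ a b v (X v)
  rw [normalOrderedZeroMode_apply a b v (fun m hm => (hN m hm).1) (fun m hm => (hN m hm).2.1),
    normalOrderedZeroMode_apply a b (X v) (fun m hm => (hN m hm).2.2.1)
      (fun m hm => (hN m hm).2.2.2)]
  simp only [map_add, map_sum, ha, hb]

/-- The corrections from moving T through a summand telescope in each half. The sums run one step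
past N so that the boundary term contains the mode N, which already vanishes on v. -/
theorem normalOrderedZeroMode_translation (a b : Fields V) (T : Module.End ℂ V)
    (ha : ∀ (m : ℤ) v, a.1 m (T v) = T (a.1 m v) + (m : ℂ) • a.1 (m - 1) v)
    (hb : ∀ (m : ℤ) v, b.1 m (T v) = T (b.1 m v) + (m : ℂ) • b.1 (m - 1) v) (v : V) :
    normalOrderedZeroMode a b (T v) = T (normalOrderedZeroMode a b v) := by
  obtain ⟨N, hN⟩ := exists_nat₂ a b v (T v)
  have key : ∀ a b : Fields V,
      (∀ (m : ℤ) v, a.1 m (T v) = T (a.1 m v) + (m : ℂ) • a.1 (m - 1) v) →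
      (∀ (m : ℤ) v, b.1 m (T v) = T (b.1 m v) + (m : ℂ) • b.1 (m - 1) v) →
      (∀ m : ℕ, N ≤ m → b.1 m v = 0) →
      ∑ m ∈ Finset.range (N + 1), a.1 (-1 - m) (b.1 m (T v)) =
        ∑ m ∈ Finset.range (N + 1), T (a.1 (-1 - m) (b.1 m v)) := by
    intro a b ha hb hv
    set g : ℕ → V := fun m => (m : ℂ) • a.1 (-1 - m) (b.1 (m - 1) v) with hg
    have h1 : ∀ m : ℕ, a.1 (-1 - m) (b.1 m (T v)) =
        T (a.1 (-1 - m) (b.1 m v)) + (g m - g (m + 1)) := by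
      intro m
      rw [hb, map_add, ha, hg]
      simp only [map_smul]
      rw [show (-1 : ℤ) - (m + 1 : ℕ) = -1 - m - 1 by push_cast; ring,
        show ((m + 1 : ℕ) : ℤ) - 1 = m by push_cast; ring]
      push_cast
      module
    rw [Finset.sum_congr rfl fun m _ => h1 m, Finset.sum_add_distrib, Finset.sum_range_sub', hg]
    simp only [Nat.cast_zero, zero_smul, zero_sub]
    rw [show ((N + 1 : ℕ) : ℤ) - 1 = N by push_cast; ring, hv N le_rfl]
    simp
  rw [normalOrderedZeroMode_apply a b v (N := N + 1) (fun m hm => (hN m (by omega)).1)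
      (fun m hm => (hN m (by omega)).2.1),
    normalOrderedZeroMode_apply a b (T v) (N := N + 1) (fun m hm => (hN m (by omega)).2.2.1)
      (fun m hm => (hN m (by omega)).2.2.2), key a b ha hb (fun m hm => (hN m hm).2.1),
    key b a hb ha (fun m hm => (hN m hm).1), map_add, map_sum, map_sum]

end

/-! ### The quadratic zero mode and its action on the Miura product. -/

namespace MatrixCurrents
variable {ι n V : Type*} [DecidableEq ι] [DecidableEq n] [AddCommGroup V]
  [Module ℂ V] {α : ℂ} (C : MatrixCurrents ι n V α)

/-- The operator `∑_m (-α)^m f(-2-m) ∂_σ^(m+1)`, truncated at `m < N`. -/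
def tailOp (_ : MatrixCurrents ι n V α) (N : ℕ) (f : ℤ → Module.End ℂ (ℕ → V)) :
    Module.End ℂ (ℕ → V) :=
  ∑ m ∈ Finset.range N, (-α) ^ m • (f (-2 - m) * coeffDeriv V ^ (m + 1))

theorem tailOp_apply (N : ℕ) (f : ℤ → Module.End ℂ (ℕ → V)) (x : ℕ → V) :
    C.tailOp N f x = ∑ m ∈ Finset.range N, (-α) ^ m • f (-2 - m) ((coeffDeriv V ^ (m + 1)) x) := by
  simp only [tailOp, LinearMap.sum_apply, LinearMap.smul_apply, Module.End.mul_apply]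

/-- Moving ∂_σ^(m+1) past σ gives (m+1)∂_σ^m, and moving f(-2-m) past -αT gives α(m+2)f(-3-m). These
cancel between consecutive m, leaving f(-2) at the bottom and a top term that contains ∂_σ^N x. -/
theorem tailOp_shiftOp {N : ℕ} {f : ℤ → Module.End ℂ (ℕ → V)} {x : ℕ → V}
    (hf : ∀ (m : ℤ) x, f m (C.shiftOp x) = C.shiftOp (f m x) - (α * m) • f (m - 1) x)
    (hx : (coeffDeriv V ^ N) x = 0) :
    C.tailOp N f (C.shiftOp x) = C.shiftOp (C.tailOp N f x) + f (-2) x := by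
  set g : ℕ → ℕ → V := fun m => (((m : ℂ) + 1) * (-α) ^ m) • f (-2 - m) ((coeffDeriv V ^ m) x)
    with hg
  have h1 : ∀ m : ℕ, (-α) ^ m • f (-2 - m) ((coeffDeriv V ^ (m + 1)) (C.shiftOp x)) =
      C.shiftOp ((-α) ^ m • f (-2 - m) ((coeffDeriv V ^ (m + 1)) x)) + (g m - g (m + 1)) := by
    intro m
    rw [iterate_coeffDeriv_shiftOp, map_add, hf, hg, map_smul, map_smul]
    simp only []
    rw [show (-2 : ℤ) - (m + 1 : ℕ) = -2 - m - 1 by push_cast; ring]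
    push_cast
    rw [pow_succ (-α)]
    module
  rw [tailOp_apply, tailOp_apply, Finset.sum_congr rfl fun m _ => h1 m, Finset.sum_add_distrib,
    Finset.sum_range_sub', ← map_sum, hg]
  simp only [hx, map_zero, smul_zero, sub_zero]
  simp

theorem tailOp_diagOp_curOp {s : ι} {L : List ι} (hs : s ∉ L) (N : ℕ) (i j k q : n) (p : ℤ)
    (x : ℕ → V) : C.tailOp N (C.diagOp L i j) (C.curOp s k q p x) =
      C.curOp s k q p (C.tailOp N (C.diagOp L i j) x) := by
  simp only [tailOp_apply, map_sum, map_smul, iterate_coeffDeriv_curOp, C.curOp_diagOp_comm hs]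

theorem tailOp_curOp_curOp (N : ℕ) (s : ι) (i j k q : n) (x : ℕ → V) :
    C.tailOp N (C.curOp s i j) (C.curOp s k q (-1) x) =
      C.curOp s k q (-1) (C.tailOp N (C.curOp s i j) x) +
      (kron j k • C.tailOp N (fun p => C.curOp s i q (p - 1)) x -
        kron i q • C.tailOp N (fun p => C.curOp s k j (p - 1)) x) := by
  simp only [tailOp_apply, map_sum, map_smul, iterate_coeffDeriv_curOp, Finset.smul_sum,
    ← Finset.sum_add_distrib, ← Finset.sum_sub_distrib]
  refine Finset.sum_congr rfl fun m _ => ?_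
  rw [curOp_comm, if_neg (by omega), ← sub_eq_add_neg]
  module

theorem tailOp_cons (N : ℕ) (s : ι) (L : List ι) (i j : n) (x : ℕ → V) :
    C.tailOp N (C.diagOp (s :: L) i j) x =
      C.tailOp N (C.curOp s i j) x + C.tailOp N (C.diagOp L i j) x := by
  simp only [tailOp_apply, diagOp_cons, LinearMap.add_apply, smul_add, Finset.sum_add_distrib]

theorem coeffwise_normalOrderedZeroMode_shiftOp (s : ι) (L : List ι) (i a j : n) (x : ℕ → V) :
    coeffwise (normalOrderedZeroMode (C.cur s i a) (C.diag L a j)) (C.shiftOp x) =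
      C.shiftOp (coeffwise (normalOrderedZeroMode (C.cur s i a) (C.diag L a j)) x) := by
  have h : ∀ x, coeffwise (normalOrderedZeroMode (C.cur s i a) (C.diag L a j)) (coeffwise C.T x) =
      coeffwise C.T (coeffwise (normalOrderedZeroMode (C.cur s i a) (C.diag L a j)) x) :=
    fun x => funext fun _ => normalOrderedZeroMode_translation _ _ _ (C.cur_T _ _ _)
      (C.diag_T _ _ _) _
  rw [shiftOp_apply, shiftOp_apply, map_sub, map_smul, h, coeffShift_coeffwise]

theorem coeffwise_normalOrderedZeroMode (s : ι) (L : List ι) (i a j : n) (x : ℕ → V) {N : ℕ}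
    (h1 : ∀ m : ℕ, N ≤ m → C.curOp s i a m x = 0) (h2 : ∀ m : ℕ, N ≤ m → C.diagOp L a j m x = 0) :
    coeffwise (normalOrderedZeroMode (C.cur s i a) (C.diag L a j)) x =
      ∑ m ∈ Finset.range N, C.curOp s i a (-1 - m) (C.diagOp L a j m x) +
      ∑ m ∈ Finset.range N, C.diagOp L a j (-1 - m) (C.curOp s i a m x) := by
  refine funext fun c => ?_
  rw [coeffwise_apply, normalOrderedZeroMode_apply _ _ (x c) (fun m hm => congrFun (h1 m hm) c)
    (fun m hm => congrFun (h2 m hm) c), Pi.add_apply, Finset.sum_apply, Finset.sum_apply]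
  rfl

variable [Fintype n]

/-- The zero mode of the `(i, j)` entry of `∑_{s < t} A^{[s]} A^{[t]}`, `s, t ∈ L`. -/
def quadZeroMode : List ι → n → n → Module.End ℂ V
  | [] => fun _ _ => 0
  | s :: L => fun i j => quadZeroMode L i j +
      ∑ a, normalOrderedZeroMode (C.cur s i a) (C.diag L a j)

theorem quadZeroMode_cons (s : ι) (L : List ι) (i j : n) : C.quadZeroMode (s :: L) i j =
    C.quadZeroMode L i j + ∑ a, normalOrderedZeroMode (C.cur s i a) (C.diag L a j) := rfl

theorem cur_quadZeroMode {s : ι} {L : List ι} (hs : s ∉ L) (i j k q : n) (p : ℤ) (v : V) :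
    (C.cur s k q).1 p (C.quadZeroMode L i j v) = C.quadZeroMode L i j ((C.cur s k q).1 p v) := by
  induction L with
  | nil => exact map_zero _
  | cons t L ih =>
    rw [List.mem_cons, not_or] at hs
    simp only [quadZeroMode_cons, LinearMap.add_apply, LinearMap.sum_apply, map_add, map_sum,
      ih hs.2]
    congr 1
    refine Finset.sum_congr rfl fun a _ => normalOrderedZeroMode_comm _ _ _ ?_ ?_ v
    · exact fun m v => C.cur_comm_of_ne hs.1 _ _ _ _ _ _ _
    · exact fun m v => C.cur_diag_comm hs.2 _ _ _ _ _ _ _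

theorem quadZeroMode_T (L : List ι) (i j : n) (v : V) :
    C.quadZeroMode L i j (C.T v) = C.T (C.quadZeroMode L i j v) := by
  induction L with
  | nil => exact (map_zero _).symm
  | cons t L ih =>
    simp only [quadZeroMode_cons, LinearMap.add_apply, LinearMap.sum_apply, map_add, map_sum, ih]
    congr 1
    exact Finset.sum_congr rfl fun a _ => normalOrderedZeroMode_translation _ _ _ (C.cur_T _ _ _)
      (C.diag_T _ _ _) v

/-- The coefficientwise action of `C.quadZeroMode L i j`. -/
def quadOp (L : List ι) (i j : n) : Module.End ℂ (ℕ → V) := coeffwise (C.quadZeroMode L i j)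

theorem quadOp_cons (s : ι) (L : List ι) (i j : n) : C.quadOp (s :: L) i j =
    C.quadOp L i j + ∑ a, coeffwise (normalOrderedZeroMode (C.cur s i a) (C.diag L a j)) := by
  rw [quadOp, quadZeroMode_cons, coeffwise_add, coeffwise_sum]; rfl

theorem quadOp_curOp {s : ι} {L : List ι} (hs : s ∉ L) (i j k q : n) (p : ℤ) (x : ℕ → V) :
    C.quadOp L i j (C.curOp s k q p x) = C.curOp s k q p (C.quadOp L i j x) :=
  funext fun _ => (C.cur_quadZeroMode hs i j k q p _).symm

theorem quadOp_shiftOp (L : List ι) (i j : n) (x : ℕ → V) :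
    C.quadOp L i j (C.shiftOp x) = C.shiftOp (C.quadOp L i j x) := by
  have h : ∀ x, C.quadOp L i j (coeffwise C.T x) = coeffwise C.T (C.quadOp L i j x) :=
    fun x => funext fun _ => C.quadZeroMode_T L i j _
  rw [shiftOp_apply, shiftOp_apply, map_sub, map_smul, h, quadOp, coeffShift_coeffwise]

theorem diagOp_miura_eq_zero {L : List ι} (hL : L.Nodup) (i j k q : n) {m : ℕ}
    (hm : L.length < m) : C.diagOp L i j m (C.miura L k q) = 0 := by
  obtain ⟨m, rfl⟩ := Nat.exists_eq_succ_of_ne_zero (Nat.ne_zero_of_lt hm)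
  rw [Nat.cast_succ, C.diagOp_succ_miura hL, map_add, map_smul, map_smul,
    C.iterate_coeffDeriv_miura _ _ _ hm, C.iterate_coeffDeriv_miura _ _ _ hm]
  simp

/-- The action on `C.miura L k q` of the part of `C.quadZeroMode (s :: L) i j` that involves the
`s`-th currents. -/
theorem sum_normalOrderedZeroMode_miura {s : ι} {L : List ι} (hs : s ∉ L) (hL : L.Nodup)
    (i j k q : n) {N : ℕ} (hN : L.length ≤ N) :
    ∑ a, coeffwise (normalOrderedZeroMode (C.cur s i a) (C.diag L a j)) (C.miura L k q) =
      kron j k • ∑ a, C.curOp s i a (-1) (C.miura L a q) - C.curOp s i q (-1) (C.miura L k j) +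
      C.tailOp N (C.curOp s i j) (C.miura L k q) +
      α • C.tailOp N (C.curOp s i q) (C.miura L k j) := by
  have h1 : ∀ a, coeffwise (normalOrderedZeroMode (C.cur s i a) (C.diag L a j)) (C.miura L k q) =
      kron j k • C.curOp s i a (-1) (C.miura L a q) -
        kron a q • C.curOp s i a (-1) (C.miura L k j) +
      (kron a j • C.tailOp N (C.curOp s i a) (C.miura L k q) +
      kron a q • (α • C.tailOp N (C.curOp s i a) (C.miura L k j))) := by
    intro a
    rw [C.coeffwise_normalOrderedZeroMode s L i a j _ (N := N + 1)
      (fun m _ => C.curOp_miura hs _ _ _ _ (by omega))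
      (fun m hm => C.diagOp_miura_eq_zero hL _ _ _ _ (by omega)),
      -- The half of the normally ordered product with annihilation modes at site s on the right
      -- vanishes. In the other half, the term 0 uses the adjoint action and the remaining terms
      -- assemble into the tails.
      Finset.sum_eq_zero (s := Finset.range (N + 1))
        (f := fun m : ℕ => C.diagOp L a j (-1 - m) (C.curOp s i a m (C.miura L k q)))
        (fun m _ => by rw [C.curOp_miura hs _ _ _ _ (by omega), map_zero]),
      add_zero, Finset.sum_range_succ', Nat.cast_zero, C.diagOp_zero_miura hL, add_comm]
    congr 1
    · simp only [map_sub, map_smul, sub_zero]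
    · simp only [tailOp_apply, Finset.smul_sum, ← Finset.sum_add_distrib]
      refine Finset.sum_congr rfl fun m _ => ?_
      rw [Nat.cast_succ, C.diagOp_succ_miura hL, show (-1 : ℤ) - (m + 1) = -2 - m by ring]
      simp only [map_add, map_smul]
      module
  rw [Finset.sum_congr rfl fun a _ => h1 a]
  simp only [Finset.sum_add_distrib, Finset.sum_sub_distrib, sum_kron_smul', ← Finset.smul_sum]
  module

end MatrixCurrents
namespace MatrixCurrents
variable {ι n V : Type*} [DecidableEq ι] [DecidableEq n] [AddCommGroup V]
  [Module ℂ V] {α : ℂ} (C : MatrixCurrents ι n V α) [Fintype n]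

theorem sum_range_curOp_diagOp_miura {s : ι} {L : List ι} (hL : L.Nodup)
    (i a k j b q : n) (N : ℕ) :
    ∑ m ∈ Finset.range (N + 1), C.curOp s i a (-2 - m) (C.diagOp L k j m (C.miura L b q)) =
      kron j b • C.curOp s i a (-2) (C.miura L k q) -
        kron k q • C.curOp s i a (-2) (C.miura L b j) +
      (kron k j • C.tailOp N (fun p => C.curOp s i a (p - 1)) (C.miura L b q) +
        (α * kron k q) • C.tailOp N (fun p => C.curOp s i a (p - 1)) (C.miura L b j)) := by
  rw [Finset.sum_range_succ', Nat.cast_zero, C.diagOp_zero_miura hL, add_comm]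
  congr 1
  · simp only [map_sub, map_smul, sub_zero]
  · simp only [tailOp_apply, Finset.smul_sum, ← Finset.sum_add_distrib]
    refine Finset.sum_congr rfl fun m _ => ?_
    rw [Nat.cast_succ, C.diagOp_succ_miura hL, show (-2 : ℤ) - (m + 1) = -2 - m - 1 by ring]
    simp only [map_add, map_smul]
    module

/-- Three contributions arise when the zero mode meets the factor at site s: the factor moved to the
left, its commutators with the creation modes at site s, and the annihilation modes 0 and 1 at site
s, which no longer kill the vector. -/
theorem coeffwise_normalOrderedZeroMode_curOp_miura {s : ι} {L : List ι} (hs : s ∉ L)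
    (hL : L.Nodup) (i a j k b q : n) {N : ℕ} (hN : L.length + 1 ≤ N) :
    coeffwise (normalOrderedZeroMode (C.cur s i a) (C.diag L a j))
        (C.curOp s k b (-1) (C.miura L b q)) =
      C.curOp s k b (-1)
        (coeffwise (normalOrderedZeroMode (C.cur s i a) (C.diag L a j)) (C.miura L b q)) +
      (kron a k • ∑ m ∈ Finset.range (N + 1),
          C.curOp s i b (-2 - m) (C.diagOp L a j m (C.miura L b q)) -
        kron i b • ∑ m ∈ Finset.range (N + 1),
          C.curOp s k a (-2 - m) (C.diagOp L a j m (C.miura L b q))) +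
      (C.diagOp L a j (-1) (C.curOp s i a 0 (C.curOp s k b (-1) (C.miura L b q))) +
        C.diagOp L a j (-2) (C.curOp s i a 1 (C.curOp s k b (-1) (C.miura L b q)))) := by
  have hz : ∀ m : ℕ, L.length < m → C.diagOp L a j m (C.miura L b q) = 0 :=
    fun m hm => C.diagOp_miura_eq_zero hL _ _ _ _ hm
  rw [C.coeffwise_normalOrderedZeroMode s L i a j _ (N := N + 1)
      (fun m hm => C.curOp_curOp_miura_of_two_le hs _ _ _ _ _ (by omega))
      (fun m hm => by rw [← C.curOp_diagOp_comm hs, hz m (by omega), map_zero]),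
    C.coeffwise_normalOrderedZeroMode s L i a j _ (N := N + 1)
      (fun m _ => C.curOp_miura hs _ _ _ _ (by omega)) (fun m hm => hz m (by omega)),
    Finset.sum_eq_zero (s := Finset.range (N + 1))
        (f := fun m : ℕ => C.diagOp L a j (-1 - m) (C.curOp s i a m (C.miura L b q)))
        (fun m _ => by rw [C.curOp_miura hs _ _ _ _ (by omega), map_zero]), add_zero]
  congr 1
  · rw [map_sum, Finset.smul_sum, Finset.smul_sum, ← Finset.sum_sub_distrib,
      ← Finset.sum_add_distrib]
    refine Finset.sum_congr rfl fun m _ => ?_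
    rw [← C.curOp_diagOp_comm hs, curOp_comm, if_neg (by omega),
      show (-1 : ℤ) - m + -1 = -2 - m by ring]
    module
  -- The bound on N leaves room to split off both surviving terms, with modes 0 and 1.
  · obtain ⟨M, rfl⟩ : ∃ M, N = M + 1 := ⟨N - 1, by omega⟩
    rw [Finset.sum_range_succ', Finset.sum_range_succ', Finset.sum_eq_zero, zero_add, add_comm]
    · simp
    · intro m _
      rw [C.curOp_curOp_miura_of_two_le hs _ _ _ _ _ (by omega), map_zero]

/-- Summation of the preceding identity over both inner indices, on column i. The part `e1` collects
the commutators with creation modes, `e2` the two annihilation terms; the hypothesis i ≠ j removes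
the δ_ji terms. -/
theorem sum_sum_normalOrderedZeroMode_curOp_miura {s : ι} {L : List ι} (hs : s ∉ L)
    (hL : L.Nodup) {i j : n} (hij : i ≠ j) (k : n) {N : ℕ} (hN : L.length + 1 ≤ N) :
    ∑ b, ∑ a, coeffwise (normalOrderedZeroMode (C.cur s i a) (C.diag L a j))
        (C.curOp s k b (-1) (C.miura L b i)) =
      ∑ b, C.curOp s k b (-1) (∑ a, coeffwise (normalOrderedZeroMode (C.cur s i a) (C.diag L a j))
        (C.miura L b i)) +
      (C.curOp s i j (-2) (C.miura L k i) - kron k i • ∑ b, C.curOp s i b (-2) (C.miura L b j) +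
        C.curOp s k i (-2) (C.miura L i j) +
        kron k j • ∑ b, C.tailOp N (fun p => C.curOp s i b (p - 1)) (C.miura L b i) +
        (α * kron k i) • ∑ b, C.tailOp N (fun p => C.curOp s i b (p - 1)) (C.miura L b j) -
        C.tailOp N (fun p => C.curOp s k j (p - 1)) (C.miura L i i) -
        α • C.tailOp N (fun p => C.curOp s k i (p - 1)) (C.miura L i j)) +
      (∑ b, C.curOp s i b (-1) (C.diagOp L k j (-1) (C.miura L b i)) -
        ∑ a, C.curOp s k a (-1) (C.diagOp L a j (-1) (C.miura L i i)) +
        α • C.diagOp L k j (-2) (C.miura L i i) + C.diagOp L i j (-2) (C.miura L k i)) := by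
  have e1 : ∑ b, ∑ a, (kron a k • ∑ m ∈ Finset.range (N + 1),
          C.curOp s i b (-2 - m) (C.diagOp L a j m (C.miura L b i)) -
        kron i b • ∑ m ∈ Finset.range (N + 1),
          C.curOp s k a (-2 - m) (C.diagOp L a j m (C.miura L b i))) =
      C.curOp s i j (-2) (C.miura L k i) - kron k i • ∑ b, C.curOp s i b (-2) (C.miura L b j) +
        C.curOp s k i (-2) (C.miura L i j) +
        kron k j • ∑ b, C.tailOp N (fun p => C.curOp s i b (p - 1)) (C.miura L b i) +
        (α * kron k i) • ∑ b, C.tailOp N (fun p => C.curOp s i b (p - 1)) (C.miura L b j) -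
        C.tailOp N (fun p => C.curOp s k j (p - 1)) (C.miura L i i) -
        α • C.tailOp N (fun p => C.curOp s k i (p - 1)) (C.miura L i j) := by
    simp only [Finset.sum_sub_distrib, sum_kron_smul']
    rw [Finset.sum_comm (f := fun b a => kron i b • _)]
    simp only [sum_kron_smul, C.sum_range_curOp_diagOp_miura hL, Finset.sum_add_distrib,
      Finset.sum_sub_distrib, mul_smul, ← Finset.smul_sum, sum_kron_smul', kron_of_ne hij.symm]
    module
  have e2 : ∑ b, ∑ a, (C.diagOp L a j (-1) (C.curOp s i a 0 (C.curOp s k b (-1) (C.miura L b i))) +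
        C.diagOp L a j (-2) (C.curOp s i a 1 (C.curOp s k b (-1) (C.miura L b i)))) =
      ∑ b, C.curOp s i b (-1) (C.diagOp L k j (-1) (C.miura L b i)) -
        ∑ a, C.curOp s k a (-1) (C.diagOp L a j (-1) (C.miura L i i)) +
        α • C.diagOp L k j (-2) (C.miura L i i) + C.diagOp L i j (-2) (C.miura L k i) := by
    rw [Finset.sum_comm]
    simp only [Finset.sum_add_distrib, ← map_sum, C.sum_curOp_curOp_miura_zero hs,
      C.sum_curOp_curOp_miura_one hs]
    simp only [map_add, map_sub, map_smul, map_sum, ← C.curOp_diagOp_comm hs,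
      Finset.sum_sub_distrib, Finset.sum_add_distrib, mul_smul, ← Finset.smul_sum, sum_kron_smul',
      sum_kron_smul]
    module
  have h : ∀ b a, _ := fun b a =>
    C.coeffwise_normalOrderedZeroMode_curOp_miura hs hL i a j k b i hN
  simp only [h, Finset.sum_add_distrib, map_sum] at e1 e2 ⊢
  rw [e1, e2]

end MatrixCurrents
namespace MatrixCurrents
variable {ι n V : Type*} [DecidableEq ι] [DecidableEq n] [AddCommGroup V]
  [Module ℂ V] {α : ℂ} (C : MatrixCurrents ι n V α) [Fintype n]

theorem diagOp_neg_one_miura_cons {s : ι} {L : List ι} (hs : s ∉ L) (i j k q : n) :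
    C.diagOp L i j (-1) (C.miura (s :: L) k q) =
      C.shiftOp (C.diagOp L i j (-1) (C.miura L k q)) +
      α • C.diagOp L i j (-2) (C.miura L k q) +
      ∑ b, C.curOp s k b (-1) (C.diagOp L i j (-1) (C.miura L b q)) := by
  rw [miura_cons', map_add, map_sum, diagOp_shiftOp]
  simp only [← C.curOp_diagOp_comm hs]
  norm_num

theorem curOp_neg_one_miura_cons (s : ι) (L : List ι) (i k q : n) :
    C.curOp s i i (-1) (C.miura (s :: L) k q) =
      C.shiftOp (C.curOp s i i (-1) (C.miura L k q)) + α • C.curOp s i i (-2) (C.miura L k q) +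
      ∑ b, C.curOp s k b (-1) (C.curOp s i i (-1) (C.miura L b q)) +
      kron i k • ∑ b, C.curOp s i b (-2) (C.miura L b q) - C.curOp s k i (-2) (C.miura L i q) := by
  rw [miura_cons', map_add, map_sum, curOp_shiftOp]
  simp only [C.curOp_comm s i i k _ (-1) (-1), Finset.sum_add_distrib, Finset.sum_sub_distrib,
    sum_kron_smul, ← Finset.smul_sum]
  norm_num
  module

theorem tailOp_diagOp_miura_cons {s : ι} {L : List ι} (hs : s ∉ L) (i j k q : n) {N : ℕ}
    (hN : L.length < N) : C.tailOp N (C.diagOp L i j) (C.miura (s :: L) k q) =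
      C.shiftOp (C.tailOp N (C.diagOp L i j) (C.miura L k q)) +
      C.diagOp L i j (-2) (C.miura L k q) +
      ∑ b, C.curOp s k b (-1) (C.tailOp N (C.diagOp L i j) (C.miura L b q)) := by
  rw [miura_cons', map_add, map_sum, C.tailOp_shiftOp (C.diagOp_shiftOp L i j)
    (C.iterate_coeffDeriv_miura L k q hN)]
  simp only [C.tailOp_diagOp_curOp hs]

theorem tailOp_curOp_miura_cons (s : ι) (L : List ι) (i j k q : n) {N : ℕ}
    (hN : L.length < N) : C.tailOp N (C.curOp s i j) (C.miura (s :: L) k q) =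
      C.shiftOp (C.tailOp N (C.curOp s i j) (C.miura L k q)) +
      C.curOp s i j (-2) (C.miura L k q) +
      ∑ b, C.curOp s k b (-1) (C.tailOp N (C.curOp s i j) (C.miura L b q)) +
      kron j k • ∑ b, C.tailOp N (fun p => C.curOp s i b (p - 1)) (C.miura L b q) -
      C.tailOp N (fun p => C.curOp s k j (p - 1)) (C.miura L i q) := by
  rw [miura_cons', map_add, map_sum, C.tailOp_shiftOp (C.curOp_shiftOp s i j)
    (C.iterate_coeffDeriv_miura L k q hN)]
  simp only [C.tailOp_curOp_curOp, Finset.sum_add_distrib, Finset.sum_sub_distrib,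
    sum_kron_smul, ← Finset.smul_sum]
  module

theorem coeffShift_miura_cons (s : ι) (L : List ι) (k q : n) :
    coeffShift V (C.miura (s :: L) k q) = C.shiftOp (coeffShift V (C.miura L k q)) +
      ∑ b, C.curOp s k b (-1) (coeffShift V (C.miura L b q)) := by
  rw [miura_cons', map_add, map_sum, shiftOp_apply, shiftOp_apply, map_sub, map_smul,
    coeffShift_coeffwise]
  simp only [curOp, coeffShift_coeffwise]

/-- The action of the zero mode of the `(i, j)` entry of `∑_{s < t} A^{[s]} A^{[t]}` on the `i`-th
column of `∏_{s ∈ L} (σ - α T + A^{[s]}(-1)) |0⟩`. -/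
theorem quadOp_miura {L : List ι} (hL : L.Nodup) {i j : n} (hij : i ≠ j) (k : n) {N : ℕ}
    (hN : L.length < N) : C.quadOp L i j (C.miura L k i) =
      kron j k • C.shiftOp (C.miura L i i) - coeffShift V (C.miura L k j) +
      C.diagOp L k j (-1) (C.miura L i i) - C.diagOp L i i (-1) (C.miura L k j) +
      α • C.tailOp N (C.diagOp L i i) (C.miura L k j) +
      C.tailOp N (C.diagOp L i j) (C.miura L k i) := by
  induction L generalizing k with
  | nil =>
    have h1 : ∀ (f : ℤ → Module.End ℂ (ℕ → V)) (k q : n), C.tailOp N f (C.miura [] k q) = 0 := by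
      intro f k q
      rw [tailOp_apply]
      refine Finset.sum_eq_zero fun m _ => ?_
      rw [C.iterate_coeffDeriv_miura _ _ _ (by simp), map_zero, smul_zero]
    have h2 : coeffwise C.T (C.miura [] i i) = 0 := by
      refine funext fun c => ?_
      rw [coeffwise_apply, miura_nil]
      by_cases hc : c = 0
      · subst hc
        rw [Pi.single_eq_same, map_smul, C.T_vac, smul_zero]; rfl
      · rw [Pi.single_eq_of_ne hc, map_zero]; rfl
    -- For the empty product, the two surviving terms δ_jk σ M_ii and σ M_kj cancel by this
    -- identity.
    have h3 : C.miura [] k j = kron j k • C.miura [] i i := by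
      rw [miura_nil, miura_nil, ← Pi.single_smul, smul_smul, kron_self, mul_one, kron, kron]
      simp only [eq_comm]
    rw [h1, h1, shiftOp_apply, h2, h3, map_smul, diagOp_nil, diagOp_nil]
    simp only [LinearMap.zero_apply, smul_zero, sub_zero, sub_self, add_zero]
    rfl
  | cons s L ih =>
    obtain ⟨hs, hL⟩ := List.nodup_cons.mp hL
    rw [List.length_cons] at hN
    have hN' : L.length < N := by omega
    have h0 := C.sum_sum_normalOrderedZeroMode_curOp_miura hs hL hij k (N := N) (by omega)
    simp only [C.sum_normalOrderedZeroMode_miura hs hL i j _ i hN'.le] at h0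
    have hR5 : C.curOp s k j (-1) (C.miura (s :: L) i i) = C.curOp s k j (-1)
        (C.shiftOp (C.miura L i i)) + C.curOp s k j (-1) (∑ b, C.curOp s i b (-1) (C.miura L b i)) := by
      rw [miura_cons', map_add]
    have hR0 : C.shiftOp (C.miura (s :: L) i i) = C.shiftOp (C.shiftOp (C.miura L i i)) +
        C.shiftOp (∑ b, C.curOp s i b (-1) (C.miura L b i)) := by
      rw [miura_cons', map_add]
    -- Both the operator and the product split off site s, which gives four pieces. The first two
    -- are covered by the inductive hypothesis and the last two by the computations at site s.
    have hL1 : C.quadOp (s :: L) i j (C.miura (s :: L) k i) =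
        C.shiftOp (C.quadOp L i j (C.miura L k i)) +
        ∑ b, C.curOp s k b (-1) (C.quadOp L i j (C.miura L b i)) +
        C.shiftOp (∑ a, coeffwise (normalOrderedZeroMode (C.cur s i a) (C.diag L a j))
          (C.miura L k i)) +
        ∑ b, ∑ a, coeffwise (normalOrderedZeroMode (C.cur s i a) (C.diag L a j))
          (C.curOp s k b (-1) (C.miura L b i)) := by
      rw [miura_cons', quadOp_cons]
      simp only [LinearMap.add_apply, LinearMap.sum_apply, map_add, map_sum, quadOp_shiftOp,
        C.quadOp_curOp hs, coeffwise_normalOrderedZeroMode_shiftOp,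
        Finset.sum_add_distrib]
      rw [Finset.sum_comm (f := fun b a => coeffwise _ (C.curOp s k b (-1) (C.miura L b i)))]
      module
    rw [hL1, h0, C.sum_normalOrderedZeroMode_miura hs hL i j k i hN'.le, hR0,
      coeffShift_miura_cons, diagOp_cons, diagOp_cons, LinearMap.add_apply, LinearMap.add_apply, hR5,
      curOp_neg_one_miura_cons, C.diagOp_neg_one_miura_cons hs, C.diagOp_neg_one_miura_cons hs,
      tailOp_cons, tailOp_cons, C.tailOp_diagOp_miura_cons hs _ _ _ _ hN',
      C.tailOp_diagOp_miura_cons hs _ _ _ _ hN', C.tailOp_curOp_miura_cons _ _ _ _ _ _ hN',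
      C.tailOp_curOp_miura_cons _ _ _ _ _ _ hN']
    have hk : kron i k = kron k i := by simp only [kron, eq_comm]
    have hk' : kron k j = kron j k := by simp only [kron, eq_comm]
    -- Once the inductive hypothesis is inserted, both sides are linear combinations of the same
    -- vectors, so that only their scalar coefficients remain to be compared.
    simp only [ih hL _ hN', hk, hk', map_add, map_sub, map_smul, Finset.sum_add_distrib,
      Finset.sum_sub_distrib, sum_kron_smul, ← Finset.smul_sum]
    module

end MatrixCurrents
-- The descent from one coefficient to the next.
namespace MatrixCurrents
variable {ι n V : Type*} [DecidableEq ι] [DecidableEq n] [AddCommGroup V]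
  [Module ℂ V] {α : ℂ} (C : MatrixCurrents ι n V α)

theorem diag_comm {L : List ι} (hL : L.Nodup) (i j k q : n) (p r : ℤ) (v : V) :
    (C.diag L i j).1 p ((C.diag L k q).1 r v) = (C.diag L k q).1 r ((C.diag L i j).1 p v) +
      (kron j k • (C.diag L i q).1 (p + r) v - kron i q • (C.diag L k j).1 (p + r) v +
        (if p + r = 0 then L.length * ((p : ℂ) * (α * kron i q * kron j k + kron i j * kron k q))
          else 0) • v) := by
  induction L with
  | nil => simp [diag_nil]
  | cons s L ih =>
    obtain ⟨hs, hL⟩ := List.nodup_cons.mp hL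
    simp only [diag_cons, LinearMap.add_apply, map_add, ih hL, C.cur_diag_comm hs, C.cur_comm s i j k q p r v,
      List.length_cons]
    push_cast
    split_ifs <;> module

variable [Fintype n]

theorem diag_zero_miura_apply {L : List ι} (hL : L.Nodup) (i j k q : n) (c : ℕ) :
    (C.diag L i j).1 0 (C.miura L k q c) =
      kron j k • C.miura L i q c - kron i q • C.miura L k j c :=
  congrFun (C.diagOp_zero_miura hL i j k q) c

theorem diag_succ_miura_apply {L : List ι} (hL : L.Nodup) (i j k q : n) (m c : ℕ) :
    (C.diag L i j).1 (m + 1) (C.miura L k q c) =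
      ((-α) ^ m * (c + (m + 1)).descFactorial (m + 1)) •
        (kron i j • C.miura L k q (c + (m + 1)) +
          (α * kron i q) • C.miura L k j (c + (m + 1))) := by
  have h := congrFun (C.diagOp_succ_miura hL i j k q m) c
  rw [Pi.smul_apply, iterate_coeffDeriv_apply, smul_smul] at h
  exact h

theorem diag_one_miura_apply {L : List ι} (hL : L.Nodup) (i j k q : n) (c : ℕ) :
    (C.diag L i j).1 1 (C.miura L k q c) =
      ((c : ℂ) + 1) • (kron i j • C.miura L k q (c + 1) + (α * kron i q) • C.miura L k j (c + 1)) := by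
  have h := C.diag_succ_miura_apply hL i j k q 0 c
  rw [Nat.cast_zero, zero_add, zero_add, pow_zero, one_mul, Nat.descFactorial_one] at h
  rw [h]
  push_cast
  rfl

theorem diag_zero_coeffShift_miura {L : List ι} (hL : L.Nodup) (i j k q : n) (c : ℕ) :
    (C.diag L i j).1 0 (coeffShift V (C.miura L k q) c) =
      kron j k • coeffShift V (C.miura L i q) c - kron i q • coeffShift V (C.miura L k j) c := by
  have h := congrArg (coeffShift V) (C.diagOp_zero_miura hL i j k q)
  rw [diagOp, coeffShift_coeffwise, map_sub, map_smul, map_smul] at h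
  exact congrFun h c

theorem diag_one_coeffShift_miura {L : List ι} (hL : L.Nodup) (i j k q : n) (c : ℕ) :
    (C.diag L i j).1 1 (coeffShift V (C.miura L k q) c) =
      (c : ℂ) • (kron i j • C.miura L k q c + (α * kron i q) • C.miura L k j c) := by
  cases c with
  | zero => simp [coeffShift_apply]
  | succ c =>
    rw [coeffShift_apply, if_neg (by omega), Nat.add_sub_cancel, C.diag_one_miura_apply hL]
    push_cast
    rfl

variable {K : Submodule ℂ V} {L : List ι}

theorem tailOp_miura_apply_mem (hE : ∀ i j, ∀ v ∈ K, ∀ m, (C.diag L i j).1 m v ∈ K) {c : ℕ}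
    (hc : ∀ c', c < c' → ∀ i j, C.miura L i j c' ∈ K) (N : ℕ) (i j k q : n) :
    C.tailOp N (C.diagOp L i j) (C.miura L k q) c ∈ K := by
  rw [tailOp_apply, Finset.sum_apply]
  refine Submodule.sum_mem _ fun m _ => Submodule.smul_mem _ _ ?_
  change (C.diag L i j).1 _ ((coeffDeriv V ^ (m + 1)) (C.miura L k q) c) ∈ K
  rw [iterate_coeffDeriv_apply]
  exact hE _ _ _ (Submodule.smul_mem _ _ (hc _ (by omega) _ _)) _

/-- The zero mode Q_ij applied to (U_c)_ji reaches the coefficient c - 1 through the terms with σ.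
In `quadOp_miura` with k = j, the tails involve only coefficients above c, and (U_c)_ii and (U_c)_jj
agree modulo K because E_ij(0) maps (U_c)_ji to their difference. -/
theorem coeffShift_miura_sub_mem (hL : L.Nodup) (hT : ∀ v ∈ K, C.T v ∈ K)
    (hE : ∀ i j, ∀ v ∈ K, ∀ m, (C.diag L i j).1 m v ∈ K)
    (hQ : ∀ i j, i ≠ j → ∀ v ∈ K, C.quadZeroMode L i j v ∈ K) {c : ℕ}
    (hc : ∀ c', c < c' → ∀ i j, C.miura L i j c' ∈ K)
    (ho : ∀ i j, i ≠ j → C.miura L i j c ∈ K) {i j : n} (hij : i ≠ j) :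
    coeffShift V (C.miura L i j) c - (C.diag L i j).1 (-1) (C.miura L i i c) ∈ K := by
  have hd : C.miura L i i c - C.miura L j j c ∈ K := by
    have h := hE i j _ (ho j i hij.symm) 0
    rwa [C.diag_zero_miura_apply hL, kron_self, kron_self, one_smul, one_smul] at h
  have hy := hQ i j hij _ (ho j i hij.symm)
  have hf : C.quadZeroMode L i j (C.miura L j i c) =
      coeffShift V (C.miura L i i) c - α • C.T (C.miura L i i c) -
        coeffShift V (C.miura L j j) c + (C.diag L j j).1 (-1) (C.miura L i i c) -
        (C.diag L i i).1 (-1) (C.miura L j j c) +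
        α • C.tailOp (L.length + 1) (C.diagOp L i i) (C.miura L j j) c +
        C.tailOp (L.length + 1) (C.diagOp L i j) (C.miura L j i) c := by
    have h := congrFun (C.quadOp_miura hL hij j (Nat.lt_succ_self L.length)) c
    rw [kron_self, one_smul] at h
    exact h
  have ht := C.tailOp_miura_apply_mem hE hc (L.length + 1)
  have hz : coeffShift V (C.miura L i i) c - coeffShift V (C.miura L j j) c -
      α • C.T (C.miura L i i c) + (C.diag L j j).1 (-1) (C.miura L i i c) -
        (C.diag L i i).1 (-1) (C.miura L i i c) ∈ K := by
    rw [hf] at hy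
    have h1 := sub_mem (sub_mem hy (ht i j j i)) (add_mem (K.smul_mem α (ht i i j j))
      (hE i i _ hd (-1)))
    rw [map_sub] at h1
    convert h1 using 1
    abel
  have hij' := ho i j hij
  -- E_ij(0) sends (U_{c-1})_ii - (U_{c-1})_jj to -2(U_{c-1})_ij, and it sends (E_jj(-1) -
  -- E_ii(-1))(U_c)_ii to 2E_ij(-1)(U_c)_ii plus modes of (U_c)_ij. The latter, and the term with T,
  -- lie in K and are removed in `h3`; the factor -1/2 in `h4` normalises.
  have h2 := hE i j _ hz 0
  simp only [map_add, map_sub, map_smul, C.diag_zero_coeffShift_miura hL, C.diag_T,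
    C.diag_comm hL i j j j 0 (-1), C.diag_comm hL i j i i 0 (-1), C.diag_zero_miura_apply hL,
    kron_self, kron_of_ne hij, kron_of_ne hij.symm] at h2
  have h3 := add_mem (sub_mem h2 (K.smul_mem α (hT _ hij')))
    (sub_mem (hE j j _ hij' (-1)) (hE i i _ hij' (-1)))
  have h4 := K.smul_mem (-(1 / 2 : ℂ)) h3
  convert h4 using 1
  norm_num
  module

/-- E_ji(1) maps (U_{c-1})_ij to cα(U_c)_ii. On E_ij(-1)(U_c)_ii only the central term of its
commutator with E_ij(-1) survives, namely α times the number of sites. The difference is a nonzero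
multiple of (U_c)_ii, since c is less than the number of sites. -/
theorem miura_mem_and_coeffShift_miura_mem (hα : α ≠ 0) (hL : L.Nodup) (hT : ∀ v ∈ K, C.T v ∈ K)
    (hE : ∀ i j, ∀ v ∈ K, ∀ m, (C.diag L i j).1 m v ∈ K)
    (hQ : ∀ i j, i ≠ j → ∀ v ∈ K, C.quadZeroMode L i j v ∈ K) {c : ℕ} (hcL : c < L.length)
    (hc : ∀ c', c < c' → ∀ i j, C.miura L i j c' ∈ K)
    (ho : ∀ i j, i ≠ j → C.miura L i j c ∈ K) {i j : n} (hij : i ≠ j) :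
    C.miura L i i c ∈ K ∧ coeffShift V (C.miura L i j) c ∈ K := by
  have hw := C.coeffShift_miura_sub_mem hL hT hE hQ hc ho hij
  have h1 := hE j i _ hw 1
  simp only [map_sub, C.diag_one_coeffShift_miura hL, C.diag_comm hL j i i j 1 (-1),
    C.diag_one_miura_apply hL, kron_self, kron_of_ne hij, kron_of_ne hij.symm] at h1
  norm_num [C.diag_zero_miura_apply hL, kron_of_ne hij.symm] at h1
  have h2 : C.miura L i i c ∈ K := by
    have h3 : (α * (c - L.length : ℂ)) • C.miura L i i c ∈ K := by
      convert h1 using 1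
      module
    refine (Submodule.smul_mem_iff _ (mul_ne_zero hα (sub_ne_zero.mpr ?_))).mp h3
    exact_mod_cast hcL.ne
  refine ⟨h2, ?_⟩
  have h4 := add_mem hw (hE i j _ h2 (-1))
  rwa [sub_add_cancel] at h4

/-- A subspace that contains the vacuum vector and the off-diagonal entries of the first two
coefficients, and is stable under translation, under the modes of the first coefficients that it
contains, and under the zero modes of the second ones, contains all coefficients. -/
theorem miura_mem [Nontrivial n] (hα : α ≠ 0) (hL : L.Nodup) {l : ℕ} (hl : L.length = l + 2)
    (hvac : C.vac ∈ K) (hT : ∀ v ∈ K, C.T v ∈ K)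
    (hE : ∀ i j, C.miura L i j (l + 1) ∈ K → ∀ v ∈ K, ∀ m, (C.diag L i j).1 m v ∈ K)
    (hQ : ∀ i j, i ≠ j → ∀ v ∈ K, C.quadZeroMode L i j v ∈ K)
    (h1 : ∀ i j, i ≠ j → C.miura L i j (l + 1) ∈ K)
    (h2 : ∀ i j, i ≠ j → C.miura L i j l ∈ K) (c : ℕ) (i j : n) : C.miura L i j c ∈ K := by
  -- Brackets of off-diagonal currents only reach traceless matrices. The individual diagonal
  -- entries come from the second coefficient: E_ji(1) sends (U_l)_ij to (l + 1)α(U_{l+1})_ii.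
  have h3 : ∀ i j, C.miura L i j (l + 1) ∈ K := by
    intro i j
    by_cases hij : i = j
    · subst hij
      obtain ⟨j, hj⟩ := exists_ne i
      have h := hE j i (h1 j i hj) _ (h2 i j hj.symm) 1
      rw [C.diag_one_miura_apply hL, kron_of_ne hj, zero_smul, zero_add, kron_self, mul_one,
        smul_smul] at h
      refine (Submodule.smul_mem_iff _ (mul_ne_zero ?_ hα)).mp h
      exact_mod_cast Nat.succ_ne_zero l
    · exact h1 i j hij
  replace hE := fun i j => hE i j (h3 i j)
  -- Descending induction on the index l - r. At the start the coefficients above l are the first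
  -- one, the multiple of the vacuum at l + 2, and zeros.
  have key : ∀ r, r ≤ l → (∀ c', l - r < c' → ∀ i j, C.miura L i j c' ∈ K) ∧
      ∀ i j, i ≠ j → C.miura L i j (l - r) ∈ K := by
    intro r
    induction r with
    | zero =>
      refine fun _ => ⟨fun c' hc' i j => ?_, h2⟩
      rcases lt_trichotomy c' (l + 2) with h | rfl | h
      · obtain rfl : c' = l + 1 := by omega
        exact h3 i j
      · rw [← hl, miura_length]
        exact K.smul_mem _ hvac
      · rw [C.miura_eq_zero L i j (by omega)]
        exact K.zero_mem
    | succ r ih =>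
      intro hr
      obtain ⟨ha, hb⟩ := ih (by omega)
      have hs := fun i j hij => C.miura_mem_and_coeffShift_miura_mem hα hL hT hE hQ
        (c := l - r) (by omega) ha hb (i := i) (j := j) hij
      refine ⟨fun c' hc' i j => ?_, fun i j hij => ?_⟩
      · rcases (show l - r ≤ c' by omega).eq_or_lt with rfl | h
        · by_cases hij : i = j
          · subst hij
            obtain ⟨j, hj⟩ := exists_ne i
            exact (hs i j hj.symm).1
          · exact hb i j hij
        · exact ha c' h i j
      · have := (hs i j hij).2
        rwa [coeffShift_apply, if_neg (by omega), show l - r - 1 = l - (r + 1) by omega] at this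
  obtain ⟨ha, hb⟩ := key l le_rfl
  rw [Nat.sub_self] at ha hb
  -- At index 0 there is nothing further to descend to, but the diagonal entries must still be
  -- extracted.
  rcases Nat.eq_zero_or_pos c with rfl | hc
  · by_cases hij : i = j
    · subst hij
      obtain ⟨j, hj⟩ := exists_ne i
      exact (C.miura_mem_and_coeffShift_miura_mem hα hL hT hE hQ (c := 0) (by omega) ha hb
        hj.symm).1
    · exact hb i j hij
  · exact ha c hc i j

end MatrixCurrents
-- Passage from σ to τ by the operator exp(αT∂_σ).
namespace MatrixCurrents
variable {ι n V : Type*} [DecidableEq ι] [DecidableEq n] [AddCommGroup V]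
  [Module ℂ V] {α : ℂ} (C : MatrixCurrents ι n V α)

/-- The operator `exp(α T ∂_σ)`, truncated to the powers of `T ∂_σ` below `N`. -/
def expOp (N : ℕ) : Module.End ℂ (ℕ → V) :=
  ∑ m ∈ Finset.range N, (α ^ m / m.factorial) • (coeffwise C.T ^ m * coeffDeriv V ^ m)

theorem expOp_apply (N : ℕ) (x : ℕ → V) : C.expOp N x = ∑ m ∈ Finset.range N,
    (α ^ m / m.factorial) • (coeffwise C.T ^ m) ((coeffDeriv V ^ m) x) := by
  simp only [expOp, LinearMap.sum_apply, LinearMap.smul_apply, Module.End.mul_apply]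

theorem iterate_coeffwise_apply (f : Module.End ℂ V) (m : ℕ) (x : ℕ → V) (c : ℕ) :
    (coeffwise f ^ m) x c = (f ^ m) (x c) := by
  induction m generalizing x with
  | zero => rfl
  | succ m ih => rw [pow_succ, Module.End.mul_apply, ih, pow_succ, Module.End.mul_apply]; rfl

theorem expOp_apply_eq_zero {N c : ℕ} {x : ℕ → V} (h : ∀ c', c ≤ c' → x c' = 0) :
    C.expOp N x c = 0 := by
  rw [expOp_apply, Finset.sum_apply]
  refine Finset.sum_eq_zero fun m _ => ?_
  rw [Pi.smul_apply, iterate_coeffwise_apply, iterate_coeffDeriv_apply, h _ (by omega), smul_zero,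
    map_zero, smul_zero]

/-- The exponential is unitriangular: its corrections at index c are multiples of iterated
translates of strictly higher coefficients. -/
theorem expOp_apply_sub_mem {K : Submodule ℂ V} (hT : ∀ v ∈ K, C.T v ∈ K) (N : ℕ) {c : ℕ}
    {x : ℕ → V} (h : ∀ c', c < c' → x c' ∈ K) : C.expOp (N + 1) x c - x c ∈ K := by
  have hT' : ∀ m : ℕ, ∀ v ∈ K, (C.T ^ m) v ∈ K := by
    intro m
    induction m with
    | zero => exact fun v hv => hv
    | succ m ih =>
      intro v hv
      rw [pow_succ, Module.End.mul_apply]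
      exact ih _ (hT v hv)
  rw [expOp_apply, Finset.sum_range_succ', Pi.add_apply]
  have h0 : ((α ^ 0 / (Nat.factorial 0 : ℂ)) • (coeffwise C.T ^ 0) ((coeffDeriv V ^ 0) x)) c = x c := by
    simp
  rw [h0, add_sub_cancel_right, Finset.sum_apply]
  refine Submodule.sum_mem _ fun m _ => ?_
  rw [Pi.smul_apply, iterate_coeffwise_apply, iterate_coeffDeriv_apply]
  exact K.smul_mem _ (hT' _ _ (K.smul_mem _ (h _ (by omega))))

/-- Conjugation by exp(αT∂_σ) takes σ to σ + αT, hence σ - αT to σ. In the truncated version the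
corrections telescope, and the last one contains ∂_σ^N x. -/
theorem expOp_shiftOp {N : ℕ} {x : ℕ → V} (hx : (coeffDeriv V ^ N) x = 0) :
    C.expOp (N + 1) (C.shiftOp x) = coeffShift V (C.expOp (N + 1) x) := by
  have hc : ∀ (m : ℕ) (y : ℕ → V), coeffShift V ((coeffwise C.T ^ m) y) =
      (coeffwise C.T ^ m) (coeffShift V y) := by
    intro m
    induction m with
    | zero => exact fun y => rfl
    | succ m ih =>
      intro y
      rw [pow_succ, Module.End.mul_apply, ih, coeffShift_coeffwise, Module.End.mul_apply]
  set g : ℕ → ℕ → V := fun m => (α ^ m * m / m.factorial) •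
    (coeffwise C.T ^ m) ((coeffDeriv V ^ (m - 1)) x) with hg
  have h1 : ∀ m : ℕ, (α ^ m / m.factorial) • (coeffwise C.T ^ m) ((coeffDeriv V ^ m)
      (C.shiftOp x)) = coeffShift V ((α ^ m / m.factorial) • (coeffwise C.T ^ m)
        ((coeffDeriv V ^ m) x)) - (g (m + 1) - g m) := by
    intro m
    have hf : (α ^ (m + 1) * ((m + 1 : ℕ) : ℂ) / ((m + 1).factorial : ℂ)) =
        α ^ m / m.factorial * α := by
      have := Nat.cast_ne_zero (R := ℂ).mpr m.factorial_ne_zero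
      have := Nat.cast_ne_zero (R := ℂ).mpr m.succ_ne_zero
      rw [Nat.factorial_succ]
      push_cast at *
      field_simp
      ring
    rw [map_smul, hc, hg]
    simp only [hf, Nat.add_sub_cancel, pow_succ (coeffwise C.T), Module.End.mul_apply]
    cases m with
    | zero =>
      simp [shiftOp_apply]
    | succ m =>
      rw [iterate_coeffDeriv_shiftOp, shiftOp_apply, map_add, map_sub, map_smul, map_smul,
        Nat.add_sub_cancel]
      push_cast
      module
  rw [expOp_apply, expOp_apply, Finset.sum_congr rfl fun m _ => h1 m, Finset.sum_sub_distrib,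
    Finset.sum_range_sub, ← map_sum, hg]
  simp [hx]

/-- This is the Leibniz rule in divided powers: iterating [T, E(-1-p)] = (p+1) E(-2-p), the
commutators with T^p/p! turn E(-1) into E(-1-p). -/
theorem iterate_T_cur (s : ι) (i j : n) (m : ℕ) (x : ℕ → V) :
    (1 / m.factorial : ℂ) • (coeffwise C.T ^ m) (C.curOp s i j (-1) x) =
      ∑ p ∈ Finset.HasAntidiagonal.antidiagonal m, (1 / p.2.factorial : ℂ) •
        C.curOp s i j (-1 - p.1) ((coeffwise C.T ^ p.2) x) := by
  induction m with
  | zero => simp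
  | succ m ih =>
    have hf : ∀ m : ℕ, (1 / (m + 1).factorial : ℂ) * (m + 1) = 1 / m.factorial := by
      intro m
      have := Nat.cast_ne_zero (R := ℂ).mpr m.factorial_ne_zero
      have := Nat.cast_ne_zero (R := ℂ).mpr m.succ_ne_zero
      rw [Nat.factorial_succ]
      push_cast at *
      field_simp
    set F : ℕ → ℕ → ℕ → V := fun k j' => (1 / j'.factorial : ℂ) •
        C.curOp s i j (-1 - k) ((coeffwise C.T ^ j') x) with hF
    have h1 : ∀ k j', coeffwise C.T (F k j') =
        ((j' : ℂ) + 1) • F k (j' + 1) + ((k : ℂ) + 1) • F (k + 1) j' := by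
      intro k j'
      have e := C.curOp_T s i j (-1 - k) ((coeffwise C.T ^ j') x)
      rw [← Module.End.mul_apply (coeffwise C.T), ← pow_succ'] at e
      simp only [hF, map_smul]
      rw [show (-1 : ℤ) - (k + 1 : ℕ) = -1 - k - 1 by push_cast; ring, ← hf j', e]
      push_cast
      module
    -- Multiplying by m + 1 and writing it as the sum of the two entries of each antidiagonal pair
    -- splits the claim into the two sums that one more application of T produces.
    have h2 : ((m : ℂ) + 1) • ((1 / (m + 1).factorial : ℂ) • (coeffwise C.T ^ (m + 1))
        (C.curOp s i j (-1) x)) = ((m : ℂ) + 1) • ∑ p ∈ Finset.HasAntidiagonal.antidiagonal (m + 1),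
          F p.1 p.2 := by
      have e1 : ∑ p ∈ Finset.HasAntidiagonal.antidiagonal (m + 1), (p.1 : ℂ) • F p.1 p.2 =
          ∑ p ∈ Finset.HasAntidiagonal.antidiagonal m, ((p.1 : ℂ) + 1) • F (p.1 + 1) p.2 := by
        rw [Finset.Nat.sum_antidiagonal_succ]
        push_cast
        simp
      have e2 : ∑ p ∈ Finset.HasAntidiagonal.antidiagonal (m + 1), (p.2 : ℂ) • F p.1 p.2 =
          ∑ p ∈ Finset.HasAntidiagonal.antidiagonal m, ((p.2 : ℂ) + 1) • F p.1 (p.2 + 1) := by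
        rw [Finset.Nat.sum_antidiagonal_succ']
        push_cast
        simp
      have e3 : ((m : ℂ) + 1) • ∑ p ∈ Finset.HasAntidiagonal.antidiagonal (m + 1), F p.1 p.2 =
          ∑ p ∈ Finset.HasAntidiagonal.antidiagonal (m + 1), (p.1 : ℂ) • F p.1 p.2 +
          ∑ p ∈ Finset.HasAntidiagonal.antidiagonal (m + 1), (p.2 : ℂ) • F p.1 p.2 := by
        rw [← Finset.sum_add_distrib, Finset.smul_sum]
        refine Finset.sum_congr rfl fun p hp => ?_
        rw [← add_smul, ← Nat.cast_add, Finset.HasAntidiagonal.mem_antidiagonal.mp hp]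
        push_cast
        rfl
      rw [e3, e1, e2, smul_smul, mul_comm ((m : ℂ) + 1), hf, pow_succ', Module.End.mul_apply,
        ← map_smul, ih, map_sum]
      rw [Finset.sum_congr rfl fun p _ => h1 p.1 p.2, Finset.sum_add_distrib, add_comm]
    exact smul_right_injective _ (Nat.cast_add_one_ne_zero (R := ℂ) m) h2

/-- The conjugate of E(-1) by exp(αT∂_σ) is ∑_k α^k E(-1-k) ∂_σ^k. This is the rule for moving
powers of τ to the left of E[-1] in the original product. -/
theorem expOp_curOp {N : ℕ} {x : ℕ → V} (hx : ∀ m, N ≤ m → (coeffDeriv V ^ m) x = 0) (s : ι)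
    (i j : n) : C.expOp N (C.curOp s i j (-1) x) =
      ∑ k ∈ Finset.range N, α ^ k • C.curOp s i j (-1 - k) ((coeffDeriv V ^ k) (C.expOp N x)) := by
  have hT : ∀ (k m : ℕ) (y : ℕ → V), (coeffDeriv V ^ k) ((coeffwise C.T ^ m) y) =
      (coeffwise C.T ^ m) ((coeffDeriv V ^ k) y) := by
    intro k m
    induction m with
    | zero => exact fun y => rfl
    | succ m ih =>
      intro y
      rw [pow_succ, Module.End.mul_apply, ih, iterate_coeffDeriv_coeffwise, Module.End.mul_apply]
  set F : ℕ → ℕ → ℕ → V := fun k m => (α ^ (k + m) / m.factorial) •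
    C.curOp s i j (-1 - k) ((coeffwise C.T ^ m) ((coeffDeriv V ^ (k + m)) x)) with hF
  have h1 : ∑ k ∈ Finset.range N, ∑ m ∈ Finset.range N, F k m = ∑ k ∈ Finset.range N,
      α ^ k • C.curOp s i j (-1 - k) ((coeffDeriv V ^ k) (C.expOp N x)) := by
    refine Finset.sum_congr rfl fun k _ => ?_
    rw [expOp_apply, map_sum, map_sum, Finset.smul_sum]
    refine Finset.sum_congr rfl fun m _ => ?_
    rw [map_smul, map_smul, hT, ← Module.End.mul_apply (coeffDeriv V ^ k), ← pow_add, smul_smul, hF]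
    simp only [pow_add α]
    congr 1
    ring
  rw [← h1, sum_range_range F N (fun k m hkm => by
    simp only [hF]; rw [hx _ hkm, map_zero, map_zero, smul_zero]), expOp_apply]
  refine Finset.sum_congr rfl fun m _ => ?_
  rw [iterate_coeffDeriv_curOp, div_eq_mul_one_div, mul_smul, iterate_T_cur, Finset.smul_sum]
  refine Finset.sum_congr rfl fun p hp => ?_
  rw [Finset.HasAntidiagonal.mem_antidiagonal] at hp
  simp only [hF]
  rw [hp, smul_smul, div_eq_mul_one_div (α ^ m)]

variable [Fintype n]

theorem expOp_miura_cons (s : ι) (L : List ι) (i j : n) {N : ℕ} (hN : L.length < N) :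
    C.expOp (N + 1) (C.miura (s :: L) i j) = coeffShift V (C.expOp (N + 1) (C.miura L i j)) +
      ∑ b, ∑ k ∈ Finset.range (N + 1), α ^ k • C.curOp s i b (-1 - k)
        ((coeffDeriv V ^ k) (C.expOp (N + 1) (C.miura L b j))) := by
  rw [miura_cons', map_add, map_sum, C.expOp_shiftOp (C.iterate_coeffDeriv_miura L i j hN)]
  congr 1
  exact Finset.sum_congr rfl fun b _ =>
    C.expOp_curOp (fun m hm => C.iterate_coeffDeriv_miura L b j (by omega)) s i b

/-- Identifies the subleading coefficient. Shifting first, instead of using the index `L.length -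
1`, makes the empty product give 0. -/
theorem coeffShift_miura_length (L : List ι) (i j : n) :
    coeffShift V (C.miura L i j) L.length = (C.diag L i j).1 (-1) C.vac := by
  induction L with
  | nil => simp [coeffShift_apply, diag_nil]
  | cons s L ih =>
    rw [coeffShift_apply, List.length_cons, if_neg (by omega), Nat.add_sub_cancel, miura_cons,
      diag_cons, Pi.add_apply, Pi.sub_apply, ih, Finset.sum_apply, Pi.smul_apply]
    simp only [coeffwise_apply, miura_length, map_smul, T_vac, sum_kron_smul', LinearMap.add_apply,
      smul_zero, sub_zero]
    rw [add_comm]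

end MatrixCurrents

/-! ### Creation and translation in the universal affine vertex algebra. -/

section
variable {g : Type*} [LieRing g] [LieAlgebra ℂ g] (κ : InvForm g)

/-- The modes X(j) with j ≥ 0 kill the vacuum, so one half of the residue product disappears. The
creation property and translation covariance follow from this recursion. -/
theorem fieldProd_current_apply_vacuum (X : g) (m k : ℤ) (b : Fields (AffineVA κ)) {N : ℕ}
    (hN : ∀ j : ℕ, N ≤ j → b.1 (k + j) (vacuum κ) = 0) :
    (fieldProd (current κ X) m b).1 k (vacuum κ) =
      ∑ j ∈ Finset.range N, expCoeff m j • mode κ X (m - j) (b.1 (k + j) (vacuum κ)) := by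
  have h : (fieldProd (current κ X) m b).1 k (vacuum κ) =
    (prodLeft (current κ X) m b).1 k (vacuum κ) - (prodRight (current κ X) m b).1 k (vacuum κ) := rfl
  rw [h, prodLeft_apply _ _ _ _ _ hN, prodRight_apply _ _ _ _ _ (N := 0)
    (fun j _ => mode_vacuum κ X j (by omega))]
  simp only [Finset.range_zero, Finset.sum_empty, sub_zero]
  rfl

theorem stateField_vacuum_apply_of_nonneg (v : AffineVA κ) {k : ℤ} (hk : 0 ≤ k) :
    (stateField κ v).1 k (vacuum κ) = 0 := by
  induction v using affineVA_induction generalizing k with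
  | hv =>
    rw [stateField_vacuum]
    have : k ≠ -1 := by omega
    simp [idField, this]
  | hm X m v ih =>
    rw [stateField_mode, fieldProd_current_apply_vacuum κ X m k _ (N := 0)
      (fun j _ => ih (by omega))]
    simp
  | ha v w hv hw =>
    rw [map_add]
    change (stateField κ v).1 k _ + (stateField κ w).1 k _ = 0
    rw [hv hk, hw hk, add_zero]
  | hs c v hv =>
    rw [map_smul]
    change c • (stateField κ v).1 k _ = 0
    rw [hv hk, smul_zero]

theorem stateField_neg_one_vacuum (v : AffineVA κ) : (stateField κ v).1 (-1) (vacuum κ) = v := by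
  induction v using affineVA_induction with
  | hv => rw [stateField_vacuum]; simp [idField]
  | hm X m v ih =>
    rw [stateField_mode, fieldProd_current_apply_vacuum κ X m (-1) _ (N := 1)
      (fun j _ => stateField_vacuum_apply_of_nonneg κ v (by omega))]
    simp [expCoeff_zero, ih]
  | ha v w hv hw =>
    rw [map_add]
    change (stateField κ v).1 (-1) _ + (stateField κ w).1 (-1) _ = _
    rw [hv, hw]
  | hs c v hv =>
    rw [map_smul]
    change c • (stateField κ v).1 (-1) _ = _
    rw [hv]

/-- The translation operator `v ↦ v_(-2) |0⟩`. -/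
def translation : Module.End ℂ (AffineVA κ) where
  toFun v := (stateField κ v).1 (-2) (vacuum κ)
  map_add' v w := by rw [map_add]; rfl
  map_smul' c v := by rw [map_smul]; rfl

theorem translation_apply (v : AffineVA κ) :
    translation κ v = (stateField κ v).1 (-2) (vacuum κ) := rfl

theorem translation_vacuum : translation κ (vacuum κ) = 0 := by
  rw [translation_apply, stateField_vacuum]
  simp [idField]

/-- In the (-2)-mode of X(m)v on the vacuum only j = 0 and j = 1 survive. They give X(m)Tv and
-mX(m-1)v. -/
theorem mode_translation (X : g) (m : ℤ) (v : AffineVA κ) :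
    mode κ X m (translation κ v) =
      translation κ (mode κ X m v) + (m : ℂ) • mode κ X (m - 1) v := by
  rw [translation_apply κ (mode κ X m v), stateField_mode,
    fieldProd_current_apply_vacuum κ X m (-2) _ (N := 2)
      (fun j _ => stateField_vacuum_apply_of_nonneg κ v (by omega)), Finset.sum_range_succ,
    Finset.sum_range_one]
  simp only [Nat.cast_zero, Nat.cast_one, add_zero, sub_zero, expCoeff_zero, one_smul]
  rw [show (-2 : ℤ) + 1 = -1 by norm_num, stateField_neg_one_vacuum, ← translation_apply]
  have : expCoeff m 1 = -m := by simp [expCoeff]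
  rw [this, ← Int.cast_smul_eq_zsmul ℂ]
  push_cast
  module

theorem stateField_mode_neg_one_vacuum (X : g) :
    stateField κ (mode κ X (-1) (vacuum κ)) = current κ X := by
  rw [stateField_mode, stateField_vacuum]
  refine Subtype.ext (funext fun k => LinearMap.ext fun v => ?_)
  obtain ⟨N, hN⟩ := exists_nat (current κ X) 0 v
  simp only [zero_add] at hN
  have h1 : ∀ j : ℕ, N + k.natAbs + 1 ≤ j → (current κ X).1 j v = 0 := fun j hj => hN j (by omega)
  have h2 : ∀ j : ℕ, N + k.natAbs + 1 ≤ j → (idField (AffineVA κ)).1 (k + j) v = 0 := fun j hj => by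
    have : k + j ≠ -1 := by omega
    simp [idField, this]
  have h : (fieldProd (current κ X) (-1) (idField _)).1 k v =
    (prodLeft (current κ X) (-1) (idField _)).1 k v -
      (prodRight (current κ X) (-1) (idField _)).1 k v := rfl
  rw [h, prodLeft_apply _ _ _ _ _ h2, prodRight_apply _ _ _ _ _ h1]
  simp only [expCoeff_neg_one, one_smul, mul_one]
  -- The identity field has a single nonzero mode, so exactly one term survives in total: in the
  -- left product if k < 0, in the right product if k ≥ 0.
  rcases lt_or_ge k 0 with hk | hk
  · rw [Finset.sum_eq_single (-1 - k).toNat, Finset.sum_eq_zero, sub_zero]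
    · rw [show k + ((-1 - k).toNat : ℤ) = -1 by omega,
        show -1 - ((-1 - k).toNat : ℤ) = k by omega]
      simp [idField]
    · intro j _
      have : -1 + k - (j : ℤ) ≠ -1 := by omega
      simp [idField, this]
    · intro j _ hj
      have : k + (j : ℤ) ≠ -1 := by omega
      simp [idField, this]
    · intro hj
      exact absurd (Finset.mem_range.mpr (by omega)) hj
  · rw [Finset.sum_eq_zero, Finset.sum_eq_single k.toNat, zero_sub]
    · rw [show -1 + k - (k.toNat : ℤ) = -1 by omega, show (k.toNat : ℤ) = k by omega]
      simp [idField, Int.negOnePow_neg]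
    · intro j _ hj
      have : -1 + k - (j : ℤ) ≠ -1 := by omega
      simp [idField, this]
    · intro hj
      exact absurd (Finset.mem_range.mpr (by omega)) hj
    · intro j _
      have : k + (j : ℤ) ≠ -1 := by omega
      simp [idField, this]

/-- X(-2)|0⟩ is the translate of X(-1)|0⟩, and the derivative of a field has no residue. This
discards the derivative terms in the second coefficient. -/
theorem stateField_mode_neg_two_vacuum_zero (X : g) :
    (stateField κ (mode κ X (-2) (vacuum κ))).1 0 = 0 := by
  rw [stateField_mode, stateField_vacuum]
  refine LinearMap.ext fun v => ?_
  obtain ⟨N, hN⟩ := exists_nat (current κ X) 0 v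
  simp only [zero_add] at hN
  have h : (fieldProd (current κ X) (-2) (idField _)).1 0 v =
    (prodLeft (current κ X) (-2) (idField _)).1 0 v -
      (prodRight (current κ X) (-2) (idField _)).1 0 v := rfl
  have h2 : ∀ j : ℕ, 0 ≤ j → (idField (AffineVA κ)).1 (0 + j) v = 0 := fun j hj => by
    have : (0 : ℤ) + j ≠ -1 := by omega
    simp only [idField, if_neg this, LinearMap.zero_apply]
  rw [h, prodLeft_apply _ _ _ _ _ h2, prodRight_apply _ _ _ _ _ hN]
  rw [Finset.sum_eq_zero (s := Finset.range N), Finset.range_zero, Finset.sum_empty, sub_zero]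
  · rfl
  · intro j _
    have : (-2 : ℤ) + 0 - j ≠ -1 := by omega
    simp only [idField, if_neg this, LinearMap.zero_apply, smul_zero]

end

/-! ### The Levi currents and the zero modes of the first two coefficients. -/

section
variable (l n : ℕ) (k : ℂ)

theorem lie_unit (s t : Fin l) (i j p q : Fin n) :
    ⁅(unit s i j : LeviAlgebra l n), unit t p q⁆ =
      if s = t then kron j p • unit s i q - kron i q • unit s p j else 0 := by
  have h : ⁅(unit s i j : LeviAlgebra l n), unit t p q⁆ =
    unit s i j * unit t p q - unit t p q * unit s i j := rfl
  rw [h]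
  by_cases hst : s = t
  · subst hst
    rw [if_pos rfl]
    simp only [unit, ← Pi.single_mul, ← Pi.single_sub, ← Pi.single_smul, kron]
    congr 1
    by_cases h1 : j = p <;> by_cases h2 : i = q <;>
      simp [h1, h2, Ne.symm]
  · rw [if_neg hst]
    funext u
    simp only [unit, Pi.sub_apply, Pi.mul_apply, Pi.zero_apply]
    by_cases hu : u = s
    · subst hu; simp [Pi.single_eq_of_ne hst]
    · simp [Pi.single_eq_of_ne hu]

theorem leviForm_unit (s t : Fin l) (i j p q : Fin n) :
    (leviForm l n k).form (unit s i j) (unit t p q) =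
      if s = t then alpha l n k * kron i q * kron j p + kron i j * kron p q else 0 := by
  have h : (leviForm l n k).form (unit s i j) (unit t p q) = ∑ u, (alpha l n k *
      ((unit s i j : LeviAlgebra l n) u * (unit t p q : LeviAlgebra l n) u).trace +
      ((unit s i j : LeviAlgebra l n) u).trace * ((unit t p q : LeviAlgebra l n) u).trace) := rfl
  rw [h, Finset.sum_eq_single s (fun u _ hu => by simp [unit, Pi.single_eq_of_ne hu]) (by simp)]
  by_cases hst : s = t
  · subst hst
    rw [if_pos rfl]
    simp only [unit, Pi.single_eq_same, kron]
    by_cases h1 : j = p <;> by_cases h2 : i = q <;> by_cases h3 : i = j <;> by_cases h4 : p = q <;>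
      simp_all [Matrix.trace_single_eq_same, Matrix.trace_single_eq_of_ne]
  · rw [if_neg hst]
    simp [unit, Pi.single_eq_of_ne hst]

/-- The currents of `gl_n ⊕ ⋯ ⊕ gl_n` on `V^κ(gl_n ⊕ ⋯ ⊕ gl_n)`. -/
def leviCurrents : MatrixCurrents (Fin l) (Fin n) (AffineVA (leviForm l n k)) (alpha l n k) where
  cur s i j := current _ (unit s i j)
  T := translation _
  vac := vacuum _
  cur_comm_of_ne {s t} hst i j p q m r v := by
    have h := mode_comm (leviForm l n k) (unit s i j) (unit t p q) m r v
    rw [lie_unit, leviForm_unit, if_neg hst, if_neg hst] at h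
    have h0 : mode (leviForm l n k) 0 (m + r) v = 0 := by
      have := current_smul (leviForm l n k) 0 0
      rw [zero_smul, zero_smul] at this
      exact congrArg (fun a : Fields _ => a.1 (m + r) v) this
    rw [h0] at h
    simp only [mul_zero, ite_self, zero_smul, add_zero] at h
    exact sub_eq_zero.mp h
  cur_comm s i j p q m r v := by
    have h := mode_comm (leviForm l n k) (unit s i j) (unit s p q) m r v
    rw [lie_unit, leviForm_unit, if_pos rfl, if_pos rfl] at h
    have h0 : mode (leviForm l n k) (kron j p • unit s i q - kron i q • unit s p j) (m + r) v =
        kron j p • mode (leviForm l n k) (unit s i q) (m + r) v -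
          kron i q • mode (leviForm l n k) (unit s p j) (m + r) v := by
      have : current (leviForm l n k) (kron j p • unit s i q - kron i q • unit s p j) =
          kron j p • current (leviForm l n k) (unit s i q) -
          kron i q • current (leviForm l n k) (unit s p j) := by
        rw [sub_eq_add_neg, ← neg_smul, current_add, current_smul, current_smul]
        module
      exact congrArg (fun a : Fields _ => a.1 (m + r) v) this
    rw [h0] at h
    exact sub_eq_iff_eq_add'.mp h
  cur_T s i j m v := mode_translation _ _ _ _
  cur_vac s i j m hm := mode_vacuum _ _ _ hm
  T_vac := translation_vacuum _

theorem stateField_diag (L : List (Fin l)) (i j : Fin n) :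
    stateField (leviForm l n k) (((leviCurrents l n k).diag L i j).1 (-1) (vacuum _)) =
      (leviCurrents l n k).diag L i j := by
  induction L with
  | nil => exact map_zero _
  | cons s L ih =>
    rw [MatrixCurrents.diag_cons, LinearMap.add_apply, map_add, ih]
    change stateField _ (mode _ (unit s i j) (-1) (vacuum _)) + _ = _
    rw [stateField_mode_neg_one_vacuum]
    rfl

theorem stateField_diag_neg_two (L : List (Fin l)) (i j : Fin n) :
    (stateField (leviForm l n k) (((leviCurrents l n k).diag L i j).1 (-2) (vacuum _))).1 0 = 0 := by
  induction L with
  | nil =>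
    rw [MatrixCurrents.diag_nil, LinearMap.zero_apply, map_zero]
    rfl
  | cons s L ih =>
    rw [MatrixCurrents.diag_cons, LinearMap.add_apply, map_add]
    change (stateField _ (mode _ (unit s i j) (-2) (vacuum _))).1 0 + (stateField _ _).1 0 = 0
    rw [stateField_mode_neg_two_vacuum_zero, ih, add_zero]

/-- The second coefficient consists of the quadratic terms with s < t and of multiples of states
E(-2)|0⟩, whose zero modes vanish. The two shifts keep the index meaningful for lists with fewer
than two sites. -/
theorem stateField_coeffShift_coeffShift_miura (L : List (Fin l)) (i j : Fin n) :
    (stateField (leviForm l n k) (coeffShift _ (coeffShift _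
      ((leviCurrents l n k).miura L i j)) L.length)).1 0 =
      (leviCurrents l n k).quadZeroMode L i j := by
  induction L with
  | nil =>
    rw [List.length_nil, coeffShift_apply, if_pos rfl, map_zero]
    rfl
  | cons s L ih =>
    have hT : (leviCurrents l n k).T (((leviCurrents l n k).diag L i j).1 (-1) (vacuum _)) =
        ((leviCurrents l n k).diag L i j).1 (-2) (vacuum _) := by
      have h := (leviCurrents l n k).diag_T L i j (-1) (vacuum _)
      rw [show (leviCurrents l n k).T (vacuum _) = 0 from translation_vacuum _, map_zero] at h
      norm_num at h
      exact add_neg_eq_zero.mp h.symm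
    have h1 : coeffShift _ (coeffShift _ ((leviCurrents l n k).miura (s :: L) i j)) (L.length + 1) =
        coeffShift _ (coeffShift _ ((leviCurrents l n k).miura L i j)) L.length -
          alpha l n k • ((leviCurrents l n k).diag L i j).1 (-2) (vacuum _) +
          ∑ b, mode _ (unit s i b) (-1)
            (((leviCurrents l n k).diag L b j).1 (-1) (vacuum _)) := by
      have h2 := fun b => (leviCurrents l n k).coeffShift_miura_length L b j
      rw [coeffShift_apply, if_neg (by omega), Nat.add_sub_cancel, MatrixCurrents.miura_cons,
        map_add, map_sub, map_smul, map_sum, coeffShift_coeffwise]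
      simp only [coeffShift_coeffwise]
      rw [Pi.add_apply, Pi.sub_apply, Pi.smul_apply, Finset.sum_apply]
      simp only [coeffwise_apply, h2]
      rw [show (leviCurrents l n k).vac = vacuum _ from rfl, hT]
      rfl
    rw [List.length_cons, h1, map_add, map_sub, map_smul, map_sum]
    simp only [stateField_mode, stateField_diag]
    have h3 : ∀ (x y : Fields (AffineVA (leviForm l n k))) (z : Fin n → Fields _) (c : ℂ),
        (x - c • y + ∑ b, z b).1 0 = x.1 0 - c • y.1 0 + ∑ b, (z b).1 0 := by
      intro x y z c
      rw [Submodule.coe_add, Submodule.coe_sub, Submodule.coe_smul, AddSubmonoidClass.coe_finsetSum,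
        Pi.add_apply, Pi.sub_apply, Pi.smul_apply, Finset.sum_apply]
    rw [h3, ih, stateField_diag_neg_two, smul_zero, sub_zero, MatrixCurrents.quadZeroMode_cons]
    rfl

end

/-! ### Comparison of the W^{(r)} with the coefficients U. -/

section
variable (l n : ℕ) (k : ℂ)

theorem sum_Icc_eq_sum_range {M : Type*} [AddCommGroup M] (f : ℕ → M) {c l : ℕ}
    (hf : ∀ a, l < a → f a = 0) :
    ∑ a ∈ Finset.Icc c l, f a = ∑ m ∈ Finset.range (l + 1), f (c + m) := by
  rw [← Finset.Ico_add_one_right_eq_Icc, Finset.sum_Ico_eq_sum_range]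
  refine Finset.sum_subset (fun m hm => ?_) (fun m hm hm' => hf _ ?_)
  · rw [Finset.mem_range] at hm ⊢; omega
  · rw [Finset.mem_range] at hm'; omega

/-- `miuraFactor` is multiplication by σ - αT + A^{[s]}(-1) conjugated by exp(αT∂_σ). With m = a -
c, its weight is α^m times the descending factorial coming from ∂_σ^m, and the bound on the length
lets the sums be cut at l. -/
theorem foldr_miuraFactor (L : List (Fin l)) (hL : L.length ≤ l) (c : ℕ) (i j : Fin n) :
    L.foldr (fun s w => miuraFactor l k s w)
      (fun c i j => if c = 0 ∧ i = j then vacuum (leviForm l n k) else 0) c i j =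
    (leviCurrents l n k).expOp (l + 1) ((leviCurrents l n k).miura L i j) c := by
  set C := leviCurrents l n k with hC
  induction L generalizing c i j with
  | nil =>
    rw [List.foldr_nil, C.expOp_apply, Finset.sum_range_succ', Finset.sum_eq_zero (fun m _ => by
      rw [C.iterate_coeffDeriv_miura _ _ _ (by simp), map_zero, smul_zero])]
    simp only [pow_zero, Nat.factorial_zero, Nat.cast_one, div_one, one_smul, Module.End.one_apply,
      zero_add, MatrixCurrents.miura_nil, Pi.single_apply, kron]
    by_cases h1 : c = 0 <;> by_cases h2 : i = j <;> simp [h1, h2]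
    rfl
  | cons s L ih =>
    rw [List.length_cons] at hL
    have hz : ∀ (i j : Fin n) a, l < a → C.expOp (l + 1) (C.miura L i j) a = 0 := fun i j a ha =>
      C.expOp_apply_eq_zero fun c' hc' => C.miura_eq_zero L i j (by omega)
    rw [List.foldr_cons, C.expOp_miura_cons s L i j (N := l) (by omega), miuraFactor]
    simp only [ih (by omega)]
    rw [Pi.add_apply]
    congr 1
    rw [sum_Icc_eq_sum_range _ (fun a ha => by simp only [hz _ _ a ha, map_zero,
      Finset.sum_const_zero, smul_zero]), Finset.sum_apply]
    simp only [Finset.sum_apply, Finset.smul_sum]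
    rw [Finset.sum_comm]
    refine Finset.sum_congr rfl fun b _ => Finset.sum_congr rfl fun m _ => ?_
    rw [Pi.smul_apply]
    change _ = alpha l n k ^ m • (C.cur s i b).1 (-1 - m)
      ((coeffDeriv _ ^ m) (C.expOp (l + 1) (C.miura L b j)) c)
    rw [iterate_coeffDeriv_apply, map_smul, smul_smul, Nat.add_sub_cancel_left,
      Nat.descFactorial_eq_factorial_mul_choose, Nat.choose_symm_add]
    push_cast
    congr 1
    ring

theorem W_eq (r : ℕ) (i j : Fin n) : W l n k r i j = (leviCurrents l n k).expOp (l + 1)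
    ((leviCurrents l n k).miura (List.finRange l) i j) (l - r) := by
  rw [W, miuraCoeff, foldr_miuraFactor l n k _ (List.length_finRange).le]

/-- The coefficients of `∏_s (σ - α T + E^{[s]}(-1)) |0⟩`. -/
abbrev U (c : ℕ) (i j : Fin n) : AffineVA (leviForm l n k) :=
  (leviCurrents l n k).miura (List.finRange l) i j c

/-- The element `∑_s A^{[s]}` of `gl_n ⊕ ⋯ ⊕ gl_n`. -/
def diagMatrix (A : Matrix (Fin n) (Fin n) ℂ) : LeviAlgebra l n := fun _ => A

theorem diag_finRange (i j : Fin n) : (leviCurrents l n k).diag (List.finRange l) i j =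
    current (leviForm l n k) (diagMatrix l n (Matrix.single i j 1)) := by
  have h : ∀ L : List (Fin l), (leviCurrents l n k).diag L i j =
      current (leviForm l n k) (L.map fun s => unit s i j).sum := by
    intro L
    induction L with
    | nil =>
      have := current_smul (leviForm l n k) 0 0
      rw [zero_smul, zero_smul] at this
      exact this.symm
    | cons s L ih => rw [List.map_cons, List.sum_cons, current_add, ← ih]; rfl
  rw [h]
  congr 1
  rw [← List.ofFn_eq_map, List.sum_ofFn]
  funext s
  rw [Finset.sum_apply, Finset.sum_eq_single s (fun t _ ht => Pi.single_eq_of_ne ht.symm _)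
    (by simp)]
  exact Pi.single_eq_same _ _

theorem U_top (i j : Fin n) : U l n k l i j = kron i j • vacuum (leviForm l n k) := by
  have h := (leviCurrents l n k).miura_length (List.finRange l) i j
  rwa [List.length_finRange] at h

theorem U_of_lt (i j : Fin n) {c : ℕ} (hc : l < c) : U l n k c i j = 0 :=
  (leviCurrents l n k).miura_eq_zero _ i j (by rwa [List.length_finRange])

end

section
variable {l n : ℕ} (k : ℂ)

theorem U_pred (hl : 1 ≤ l) (i j : Fin n) : U l n k (l - 1) i j =
    mode (leviForm l n k) (diagMatrix l n (Matrix.single i j 1)) (-1) (vacuum _) := by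
  have h := (leviCurrents l n k).coeffShift_miura_length (List.finRange l) i j
  rw [List.length_finRange, coeffShift_apply, if_neg (by omega), diag_finRange] at h
  exact h

theorem stateField_U_pred (hl : 1 ≤ l) (i j : Fin n) :
    stateField (leviForm l n k) (U l n k (l - 1) i j) =
      (leviCurrents l n k).diag (List.finRange l) i j := by
  rw [U_pred k hl, stateField_mode_neg_one_vacuum, diag_finRange]

theorem stateField_U_pred_pred (hl : 2 ≤ l) (i j : Fin n) :
    (stateField (leviForm l n k) (U l n k (l - 2) i j)).1 0 =
      (leviCurrents l n k).quadZeroMode (List.finRange l) i j := by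
  have h := stateField_coeffShift_coeffShift_miura l n k (List.finRange l) i j
  rwa [List.length_finRange, coeffShift_apply, if_neg (by omega), coeffShift_apply,
    if_neg (by omega), show l - 1 - 1 = l - 2 by omega] at h

/-- The only possible correction is the translate of the top coefficient, a multiple of the vacuum,
hence zero. -/
theorem W_one (hl : 1 ≤ l) (i j : Fin n) : W l n k 1 i j = U l n k (l - 1) i j := by
  rw [W_eq, MatrixCurrents.expOp_apply, Finset.sum_range_succ', Pi.add_apply, Finset.sum_apply,
    Finset.sum_eq_zero, zero_add]
  · simp
  · intro m _
    rw [Pi.smul_apply, MatrixCurrents.iterate_coeffwise_apply, iterate_coeffDeriv_apply, map_smul]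
    rcases Nat.eq_zero_or_pos m with rfl | hm
    · have h := U_top l n k i j
      rw [show l - 1 + (0 + 1) = l by omega]
      rw [U] at h
      simp only [zero_add, pow_one]
      rw [h, map_smul, show (leviCurrents l n k).T (vacuum _) = 0 from
        translation_vacuum _]
      simp
    · rw [show (leviCurrents l n k).miura (List.finRange l) i j (l - 1 + (m + 1)) = 0 from
        U_of_lt l n k i j (by omega)]
      simp

variable {k} {K : Submodule ℂ (AffineVA (leviForm l n k))}

theorem W_sub_U_mem (hT : ∀ v ∈ K, translation _ v ∈ K) (r : ℕ) {i j : Fin n}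
    (h : ∀ c, l - r < c → U l n k c i j ∈ K) : W l n k r i j - U l n k (l - r) i j ∈ K := by
  rw [W_eq]
  exact (leviCurrents l n k).expOp_apply_sub_mem hT l h

/-! ### Generation of the off-diagonal loops of gl_n. -/

/-- A subspace of `gl_n` that contains an off-diagonal matrix unit and is stable under the adjoint
action of the off-diagonal matrix units contains all of them. -/
theorem single_mem_of_stable (S : Submodule ℂ (Matrix (Fin n) (Fin n) ℂ))
    (hS : ∀ i j, i ≠ j → ∀ A ∈ S, Matrix.single i j 1 * A - A * Matrix.single i j 1 ∈ S)
    {a b : Fin n} (hab : a ≠ b) (h : Matrix.single a b 1 ∈ S) {i j : Fin n} (hij : i ≠ j) :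
    Matrix.single i j 1 ∈ S := by
  have hl : ∀ {a b c : Fin n}, a ≠ b → c ≠ b → Matrix.single a b (1 : ℂ) ∈ S →
      Matrix.single c b (1 : ℂ) ∈ S := by
    intro a b c hab hcb h
    by_cases hca : c = a
    · rwa [hca]
    have := hS c a hca _ h
    rwa [Matrix.single_mul_single_same, Matrix.single_mul_single_of_ne _ _ _ _ hcb.symm, mul_one,
      sub_zero] at this
  have hr : ∀ {a b c : Fin n}, a ≠ b → c ≠ a → Matrix.single a b (1 : ℂ) ∈ S →
      Matrix.single a c (1 : ℂ) ∈ S := by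
    intro a b c hab hca h
    by_cases hcb : c = b
    · rwa [hcb]
    have := hS b c (Ne.symm hcb) _ h
    rw [Matrix.single_mul_single_same, Matrix.single_mul_single_of_ne _ _ _ _ hca, mul_one,
      zero_sub] at this
    simpa using S.neg_mem this
  -- Transposition comes from ad(E_ba)² E_ab = -2E_ba.
  have hs : ∀ {a b : Fin n}, a ≠ b → Matrix.single a b (1 : ℂ) ∈ S →
      Matrix.single b a (1 : ℂ) ∈ S := by
    intro a b hab h
    have h1 := hS b a hab.symm _ (hS b a hab.symm _ h)
    have h2 := S.smul_mem (-(1 / 2 : ℂ)) h1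
    convert h2 using 1
    simp only [mul_sub, sub_mul, Matrix.single_mul_single_same, mul_one,
      Matrix.single_mul_single_of_ne _ _ _ _ hab]
    module
  -- Replacing the row a by i would lead to the diagonal unit E_bb if i = b; in that case the unit
  -- is transposed first.
  by_cases hib : i = b
  · subst hib
    exact hr hab.symm hij.symm (hs hab h)
  · exact hr hib hij.symm (hl hab hib h)

end

section
variable {n : ℕ}

/-- A subspace of `gl_n` that is closed under commutators and contains the simple root vectors
contains all off-diagonal matrix units. -/
theorem single_mem_of_simple (S : Submodule ℂ (Matrix (Fin n) (Fin n) ℂ))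
    (hS : ∀ A ∈ S, ∀ B ∈ S, A * B - B * A ∈ S)
    (h : ∀ (i : ℕ) (hi : i + 1 < n), Matrix.single (⟨i, by omega⟩ : Fin n) ⟨i + 1, hi⟩ 1 ∈ S ∧
      Matrix.single (⟨i + 1, hi⟩ : Fin n) ⟨i, by omega⟩ 1 ∈ S) {a b : Fin n} (hab : a ≠ b) :
    Matrix.single a b 1 ∈ S := by
  have key : ∀ (d i : ℕ) (hi : i + d + 1 < n),
      Matrix.single (⟨i, by omega⟩ : Fin n) ⟨i + d + 1, hi⟩ 1 ∈ S ∧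
      Matrix.single (⟨i + d + 1, hi⟩ : Fin n) ⟨i, by omega⟩ 1 ∈ S := by
    intro d
    induction d with
    | zero => exact h
    | succ d ih =>
      intro i hi
      obtain ⟨h1, h2⟩ := ih i (by omega)
      obtain ⟨h3, h4⟩ := h (i + d + 1) hi
      have hne : (⟨i + d + 1 + 1, hi⟩ : Fin n) ≠ ⟨i, by omega⟩ := by
        rw [ne_eq, Fin.mk.injEq]; omega
      have h5 := hS _ h1 _ h3
      have h6 := hS _ h4 _ h2
      rw [Matrix.single_mul_single_same, mul_one,
        Matrix.single_mul_single_of_ne _ _ _ _ hne, sub_zero] at h5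
      rw [Matrix.single_mul_single_same, mul_one,
        Matrix.single_mul_single_of_ne _ _ _ _ hne.symm, sub_zero] at h6
      exact ⟨h5, h6⟩
  rcases lt_or_gt_of_ne hab with hlt | hlt
  · have h1 := (key (b - a - 1) a (by omega)).1
    convert h1 using 2
    exact Fin.ext (show (b : ℕ) = a + (b - a - 1) + 1 by omega)
  · have h1 := (key (a - b - 1) b (by omega)).2
    convert h1 using 2
    exact Fin.ext (show (a : ℕ) = b + (a - b - 1) + 1 by omega)

theorem single_mul_sub_mul_single {a b : Fin n} :
    Matrix.single a b (1 : ℂ) * Matrix.single b a 1 - Matrix.single b a 1 * Matrix.single a b 1 =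
      Matrix.single a a 1 - Matrix.single b b 1 := by
  rw [Matrix.single_mul_single_same, Matrix.single_mul_single_same, mul_one]

/-- A graded subspace of the loop algebra of `gl_n` that is closed under commutators and contains
the off-diagonal matrix units in degree `0` and one of them in each of the degrees `1` and `-1`
contains all of them in all degrees. -/
theorem single_mem_of_loop (S : ℤ → Submodule ℂ (Matrix (Fin n) (Fin n) ℂ))
    (hS : ∀ p q, ∀ A ∈ S p, ∀ B ∈ S q, A * B - B * A ∈ S (p + q))
    (h0 : ∀ a b, a ≠ b → Matrix.single a b 1 ∈ S 0) {a b c d : Fin n} (hab : a ≠ b)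
    (h1 : Matrix.single a b 1 ∈ S 1) (hcd : c ≠ d) (h2 : Matrix.single c d 1 ∈ S (-1))
    {i j : Fin n} (hij : i ≠ j) (m : ℤ) : Matrix.single i j 1 ∈ S m := by
  have hs : ∀ m, ∀ i j : Fin n, i ≠ j → ∀ A ∈ S m,
      Matrix.single i j 1 * A - A * Matrix.single i j 1 ∈ S m := fun m i j hij A hA => by
    have := hS 0 m _ (h0 i j hij) _ hA
    rwa [zero_add] at this
  -- With H = E_ii - E_jj, the brackets are [E_ij t^p, E_ji] = H t^p and [H t^p, E_ij t^q] = 2E_ij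
  -- t^(p+q).
  have hstep : ∀ p q, (∀ i j, i ≠ j → Matrix.single i j 1 ∈ S p) →
      Matrix.single i j 1 ∈ S q → Matrix.single i j 1 ∈ S (p + q) := by
    intro p q hp hq
    have e1 := hS p 0 _ (hp i j hij) _ (h0 j i hij.symm)
    rw [single_mul_sub_mul_single, add_zero] at e1
    have e2 := (S (p + q)).smul_mem (1 / 2 : ℂ) (hS p q _ e1 _ hq)
    convert e2 using 1
    simp only [mul_sub, sub_mul, Matrix.single_mul_single_same, mul_one,
      Matrix.single_mul_single_of_ne _ _ _ _ hij.symm]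
    module
  induction m with
  | zero => exact h0 i j hij
  | succ m ih =>
    rw [add_comm]
    exact hstep 1 m (fun i j hij => single_mem_of_stable (S 1) (hs 1) hab h1 hij) ih
  | pred m ih =>
    rw [sub_eq_neg_add]
    exact hstep (-1) _ (fun i j hij => single_mem_of_stable (S (-1)) (hs (-1)) hcd h2 hij) ih

end

/-! ### The affine gl_n inside the rectangular W-algebra. -/

section
variable {g : Type*} [LieRing g] [LieAlgebra ℂ g] (κ : InvForm g)

theorem mode_add_left (X Y : g) (m : ℤ) (v : AffineVA κ) :
    mode κ (X + Y) m v = mode κ X m v + mode κ Y m v :=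
  congrArg (fun a : Fields _ => a.1 m v) (current_add κ X Y)

theorem mode_smul_left (c : ℂ) (X : g) (m : ℤ) (v : AffineVA κ) :
    mode κ (c • X) m v = c • mode κ X m v :=
  congrArg (fun a : Fields _ => a.1 m v) (current_smul κ c X)

end

section
variable (l n : ℕ) (k : ℂ)

theorem diagMatrix_add (A B : Matrix (Fin n) (Fin n) ℂ) :
    diagMatrix l n (A + B) = diagMatrix l n A + diagMatrix l n B := rfl

theorem diagMatrix_smul (c : ℂ) (A : Matrix (Fin n) (Fin n) ℂ) :
    diagMatrix l n (c • A) = c • diagMatrix l n A := rfl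

/-- The state `∑_s A^{[s]}(-1) |0⟩`. -/
def diagState : Matrix (Fin n) (Fin n) ℂ →ₗ[ℂ] AffineVA (leviForm l n k) where
  toFun A := mode (leviForm l n k) (diagMatrix l n A) (-1) (vacuum _)
  map_add' A B := by rw [diagMatrix_add, mode_add_left]
  map_smul' c A := by rw [diagMatrix_smul, mode_smul_left, RingHom.id_apply]

theorem diagState_mem_weight (A : Matrix (Fin n) (Fin n) ℂ) :
    diagState l n k A ∈ weight (leviForm l n k) 1 := by
  have h := mode_mem_weight (leviForm l n k) (diagMatrix l n A) (-1) (vacuum_mem_weight _)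
  rwa [sub_neg_eq_add, zero_add] at h

theorem stateField_diagState (A : Matrix (Fin n) (Fin n) ℂ) :
    stateField (leviForm l n k) (diagState l n k A) = current _ (diagMatrix l n A) :=
  stateField_mode_neg_one_vacuum _ _

theorem mode_diagState (A B : Matrix (Fin n) (Fin n) ℂ) (m : ℕ) :
    mode _ (diagMatrix l n A) m (diagState l n k B) =
      if m = 0 then diagState l n k (A * B - B * A) else
        if m = 1 then (leviForm l n k).form (diagMatrix l n A) (diagMatrix l n B) • vacuum _
        else 0 := by
  have h := mode_comm (leviForm l n k) (diagMatrix l n A) (diagMatrix l n B) m (-1) (vacuum _)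
  rw [mode_vacuum _ _ _ (Int.natCast_nonneg m), map_zero, sub_zero] at h
  refine h.trans ?_
  rcases m with _ | _ | m
  · simp only [Nat.cast_zero, zero_add, if_true]
    rw [if_neg (by norm_num), zero_smul, add_zero]
    rfl
  · simp [mode_vacuum]
  · rw [mode_vacuum _ _ _ (by push_cast; omega), if_neg (by push_cast; omega), if_neg (by omega),
      if_neg (by omega), zero_smul, add_zero]

end

section
variable {l n : ℕ} {k : ℂ}

theorem diagState_mem (hl : 1 ≤ l) (A : Matrix (Fin n) (Fin n) ℂ) :
    diagState l n k A ∈ (affineVertexData (leviForm l n k)).closure (strongGenerators l n k) := by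
  rw [Matrix.matrix_eq_sum_single A]
  simp only [map_sum]
  refine Submodule.sum_mem _ fun i _ => Submodule.sum_mem _ fun j _ => ?_
  rw [show Matrix.single i j (A i j) = A i j • Matrix.single i j (1 : ℂ) by
    rw [Matrix.smul_single, smul_eq_mul, mul_one], map_smul]
  refine Submodule.smul_mem _ _ (VertexData.subset_closure _ ⟨1, i, j, le_rfl, hl, ?_⟩)
  rw [W_one k hl, U_pred k hl]
  rfl

/-- The state `∑_s A^{[s]}(-1) |0⟩` of the rectangular `W`-algebra. -/
def glState (k : ℂ) (hl : 1 ≤ l) : Matrix (Fin n) (Fin n) ℂ →ₗ[ℂ]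
    (affineVertexData (leviForm l n k)).closure (strongGenerators l n k) :=
  (diagState l n k).codRestrict _ (diagState_mem hl)

theorem Y_glState (hl : 1 ≤ l) (A : Matrix (Fin n) (Fin n) ℂ) (m : ℤ)
    (v : (affineVertexData (leviForm l n k)).closure (strongGenerators l n k)) :
    ((rectW l n k).Y (glState k hl A) m v : AffineVA (leviForm l n k)) =
      mode _ (diagMatrix l n A) m v := by
  change (stateField _ (diagState l n k A)).1 m v.1 = _
  rw [stateField_diagState]
  rfl

theorem Y_glState_glState (hl : 1 ≤ l) (A B : Matrix (Fin n) (Fin n) ℂ) (m : ℕ) :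
    (rectW l n k).Y (glState k hl A) m (glState k hl B) =
      if m = 0 then glState k hl (A * B - B * A) else
        if m = 1 then
          (leviForm l n k).form (diagMatrix l n A) (diagMatrix l n B) • (rectW l n k).vac
        else 0 := by
  refine Subtype.ext ((Y_glState hl A m _).trans ((mode_diagState l n k A B m).trans ?_))
  split_ifs <;> rfl

variable (P : Subalgebra ℂ (rectW l n k).Completed)

/-- The matrices `A` for which the Fourier coefficient `A t^m` lies in `P`. -/
def glModes (hl : 1 ≤ l) (m : ℤ) : Submodule ℂ (Matrix (Fin n) (Fin n) ℂ) :=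
  P.toSubmodule.comap ((rectW l n k).cmodeLin m ∘ₗ glState k hl)

variable {P}

theorem mem_glModes (hl : 1 ≤ l) {m : ℤ} {A : Matrix (Fin n) (Fin n) ℂ} :
    A ∈ glModes P hl m ↔ (rectW l n k).cmode (glState k hl A) m ∈ P := Iff.rfl

/-- Among the nonnegative products of two currents only those of index 0 and 1 survive. The second
is a multiple of the vacuum, whose modes lie in P, so the cocycle can be ignored. -/
theorem commutator_mem_glModes (hrel : (rectW l n k).relations ⊆ P) (hl : 1 ≤ l) (p q : ℤ)
    (A : Matrix (Fin n) (Fin n) ℂ) (hA : A ∈ glModes P hl p)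
    (B : Matrix (Fin n) (Fin n) ℂ) (hB : B ∈ glModes P hl q) :
    A * B - B * A ∈ glModes P hl (p + q) := by
  rw [mem_glModes] at *
  have h := (rectW l n k).commutator_sub_mem hrel (glState k hl A) (glState k hl B) p q (N := 2)
    (fun j hj => by rw [Y_glState_glState, if_neg (by omega), if_neg (by omega)])
  rw [Finset.sum_range_succ, Finset.sum_range_one, Y_glState_glState, Y_glState_glState, if_pos rfl,
    if_neg one_ne_zero, if_pos rfl, Ring.choose_zero_right, one_smul, Nat.cast_zero, sub_zero,
    VertexData.cmode_smul] at h
  have h1 := sub_mem (sub_mem (mul_mem hA hB) (mul_mem hB hA)) h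
  rw [sub_sub_cancel] at h1
  have h2 := P.smul_mem ((rectW l n k).cmode_vac_sub_mem hrel (p + q - (1 : ℕ)))
    ((leviForm l n k).form (diagMatrix l n A) (diagMatrix l n B))
  have h3 := sub_mem h1 (zsmul_mem h2 (Ring.choose p 1))
  rwa [add_sub_cancel_right] at h3

end

/-! ### From modes in P to states, and the reduction to the descent. -/

section
variable {l n : ℕ} {k : ℂ} {P : Subalgebra ℂ (rectW l n k).Completed}

theorem mode_diagMatrix_single (i j : Fin n) (m : ℤ) (v : AffineVA (leviForm l n k)) :
    mode _ (diagMatrix l n (Matrix.single i j 1)) m v =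
      ((leviCurrents l n k).diag (List.finRange l) i j).1 m v := by
  rw [diag_finRange]
  rfl

theorem glState_single (hl : 1 ≤ l) (i j : Fin n) :
    (glState k hl (Matrix.single i j 1) : AffineVA (leviForm l n k)) = W l n k 1 i j := by
  rw [W_one k hl, U_pred k hl]
  rfl

/-- If a closed subalgebra contains the loops of one `E_ij` with `i ≠ j` and of `E_ii - E_jj`, and
one mode of a coefficient `U (l - 2) i j`, then it contains all modes of this coefficient. -/
theorem U_mem_modeSub (hrel : (rectW l n k).relations ⊆ P) (hl : 2 ≤ l) {i j : Fin n} (hij : i ≠ j)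
    (hE : ∀ m, Matrix.single i j 1 ∈ glModes P (one_le_two.trans hl) m)
    (hH : ∀ m, Matrix.single i i 1 - Matrix.single j j 1 ∈ glModes P (one_le_two.trans hl) m)
    (u : (affineVertexData (leviForm l n k)).closure (strongGenerators l n k))
    (hu : (u : AffineVA (leviForm l n k)) = U l n k (l - 2) i j)
    (h1 : (rectW l n k).cmode u 1 ∈ P) : u ∈ (rectW l n k).modeSub P := by
  have hl1 := one_le_two.trans hl
  set H : Matrix (Fin n) (Fin n) ℂ := Matrix.single i i 1 - Matrix.single j j 1 with hHdef
  have hY : ∀ m : ℤ, ((rectW l n k).Y (glState k hl1 H) m u : AffineVA (leviForm l n k)) =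
      ((leviCurrents l n k).diag (List.finRange l) i i).1 m (U l n k (l - 2) i j) -
      ((leviCurrents l n k).diag (List.finRange l) j j).1 m (U l n k (l - 2) i j) := by
    intro m
    rw [hHdef, map_sub, map_sub, Pi.sub_apply, LinearMap.sub_apply, Submodule.coe_sub,
      Y_glState, Y_glState, mode_diagMatrix_single, mode_diagMatrix_single, hu]
  have hY0 : (rectW l n k).Y (glState k hl1 H) (0 : ℕ) u = (2 : ℂ) • u := by
    refine Subtype.ext ((hY _).trans ?_)
    rw [Nat.cast_zero, MatrixCurrents.diag_zero_miura_apply _ (List.nodup_finRange l),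
      MatrixCurrents.diag_zero_miura_apply _ (List.nodup_finRange l), kron_self, kron_self,
      kron_of_ne hij, kron_of_ne hij.symm, Submodule.coe_smul, hu]
    module
  -- In E_ii(1) - E_jj(1) the contributions of the trace form cancel, leaving only the term with α.
  have hY1 : (rectW l n k).Y (glState k hl1 H) (1 : ℕ) u =
      (-(((l - 2 : ℕ) : ℂ) + 1) * alpha l n k) • glState k hl1 (Matrix.single i j 1) := by
    refine Subtype.ext ((hY _).trans ?_)
    rw [Nat.cast_one, MatrixCurrents.diag_one_miura_apply _ (List.nodup_finRange l),
      MatrixCurrents.diag_one_miura_apply _ (List.nodup_finRange l), kron_self, kron_self,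
      kron_of_ne hij, Submodule.coe_smul, glState_single, W_one k hl1,
      show l - 2 + 1 = l - 1 by omega]
    module
  have hY2 : ∀ m : ℕ, 2 ≤ m → (rectW l n k).Y (glState k hl1 H) m u = 0 := by
    intro m hm
    obtain ⟨m, rfl⟩ := Nat.exists_eq_add_of_le' (one_le_two.trans hm)
    refine Subtype.ext ((hY _).trans ?_)
    -- The top coefficient is the identity matrix times the vacuum, so its off-diagonal entries
    -- vanish, as does everything above it.
    have hU : (leviCurrents l n k).miura (List.finRange l) i j (l - 2 + (m + 1)) = 0 := by
      rcases (show l ≤ l - 2 + (m + 1) by omega).eq_or_lt with h | h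
      · rw [← h]
        exact (U_top l n k i j).trans (by rw [kron_of_ne hij, zero_smul])
      · exact U_of_lt l n k i j h
    rw [Nat.cast_add, Nat.cast_one, MatrixCurrents.diag_succ_miura_apply _ (List.nodup_finRange l),
      MatrixCurrents.diag_succ_miura_apply _ (List.nodup_finRange l), kron_of_ne hij, hU]
    simp
  rw [VertexData.mem_modeSub]
  intro m
  -- Modulo P, [H t^(m-1), u t] is 2u t^m plus a multiple of E_ij t^(m-1), which can be solved for u
  -- t^m.
  have h := (rectW l n k).commutator_sub_mem hrel (glState k hl1 H) u (m - 1) 1 hY2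
  rw [Finset.sum_range_succ, Finset.sum_range_one, hY0, hY1, Ring.choose_zero_right, one_smul,
    Nat.cast_zero, sub_zero, VertexData.cmode_smul, VertexData.cmode_smul, sub_add_cancel] at h
  have h1' := (mem_glModes hl1).mp (hH (m - 1))
  have h2 := sub_mem (sub_mem (mul_mem h1' h1) (mul_mem h1 h1')) h
  have h3 := zsmul_mem (P.smul_mem (hE (m - (1 : ℕ))) (-(((l - 2 : ℕ) : ℂ) + 1) * alpha l n k))
    (Ring.choose (m - 1) 1)
  have h4 := P.smul_mem (sub_mem h2 h3) (1 / 2 : ℂ)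
  convert h4 using 1
  simp only [VertexData.cmodeLin, LinearMap.comp_apply, LinearMap.coe_mk, AddHom.coe_mk]
  module

variable (P) in
/-- The span in `V^κ(gl_n ⊕ ⋯ ⊕ gl_n)` of the homogeneous elements of the rectangular `W`-algebra
all of whose Fourier modes lie in `P`. -/
def stateSub : Submodule ℂ (AffineVA (leviForm l n k)) :=
  ((rectW l n k).homModeSub P).map (Submodule.subtype _)

theorem mem_stateSub {x : AffineVA (leviForm l n k)} {d : ℤ}
    (hx : x ∈ (affineVertexData (leviForm l n k)).closure (strongGenerators l n k))
    (hd : x ∈ weight (leviForm l n k) d)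
    (h : (⟨x, hx⟩ : (affineVertexData (leviForm l n k)).closure (strongGenerators l n k)) ∈
      (rectW l n k).modeSub P) : x ∈ stateSub P :=
  ⟨⟨x, hx⟩, Submodule.mem_iSup_of_mem d ⟨h, hd⟩, rfl⟩

theorem exists_of_mem_stateSub {x : AffineVA (leviForm l n k)} (h : x ∈ stateSub P) :
    ∃ hx : x ∈ (affineVertexData (leviForm l n k)).closure (strongGenerators l n k),
      (⟨x, hx⟩ : (affineVertexData (leviForm l n k)).closure (strongGenerators l n k)) ∈
        (rectW l n k).homModeSub P := by
  obtain ⟨y, hy, rfl⟩ := h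
  exact ⟨y.2, hy⟩

theorem vacuum_mem_stateSub (hrel : (rectW l n k).relations ⊆ P) : vacuum _ ∈ stateSub P :=
  ⟨(rectW l n k).vac, (rectW l n k).vac_mem_homModeSub hrel, rfl⟩

theorem stateField_mem_stateSub (hP : IsClosed (P : Set (rectW l n k).Completed))
    (hrel : (rectW l n k).relations ⊆ P) {u v : AffineVA (leviForm l n k)} (hu : u ∈ stateSub P)
    (hv : v ∈ stateSub P) (m : ℤ) : (stateField _ u).1 m v ∈ stateSub P := by
  obtain ⟨u, hu, rfl⟩ := hu
  obtain ⟨v, hv, rfl⟩ := hv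
  exact ⟨(rectW l n k).Y u m v, (rectW l n k).Y_mem_homModeSub hP hrel hu hv m, rfl⟩

/-- `stateSub P` contains the vacuum and is closed under all products, so once it contains the
strong generators it contains the whole W-algebra; then every generator of the free algebra lies in
P. -/
theorem eq_top_of_W_mem_stateSub (hP : IsClosed (P : Set (rectW l n k).Completed))
    (hrel : (rectW l n k).relations ⊆ P)
    (hW : ∀ (r : ℕ) (i j : Fin n), W l n k r i j ∈ stateSub P) : P = ⊤ := by
  have h : (affineVertexData (leviForm l n k)).closure (strongGenerators l n k) ≤ stateSub P := by
    refine sInf_le ⟨vacuum_mem_stateSub hrel, ?_,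
      fun u hu v hv m => stateField_mem_stateSub hP hrel hu hv m⟩
    rintro _ ⟨r, i, j, _, _, rfl⟩
    exact hW r i j
  refine (rectW l n k).eq_top_of_modeSub_eq_top hP (eq_top_iff.mpr fun x _ => ?_)
  obtain ⟨_, hx⟩ := exists_of_mem_stateSub (h x.2)
  exact (rectW l n k).homModeSub_le hx

/-- A closed subalgebra compatible with the relations is everything if it contains the loops of the
off-diagonal matrix units and one mode of one off-diagonal `W^{(2)}_{ij}`. -/
theorem eq_top_of_glModes (hP : IsClosed (P : Set (rectW l n k).Completed))
    (hrel : (rectW l n k).relations ⊆ P) (hl : 2 ≤ l) (hα : alpha l n k ≠ 0)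
    (hE : ∀ i j, i ≠ j → ∀ m, Matrix.single i j 1 ∈ glModes P (one_le_two.trans hl) m)
    {a b : Fin n} (hab : a ≠ b) (hW : (rectW l n k).cmode
      ⟨W l n k 2 a b, VertexData.subset_closure _ ⟨2, a, b, one_le_two, hl, rfl⟩⟩ 1 ∈ P) :
    P = ⊤ := by
  have hl1 := one_le_two.trans hl
  have : Nontrivial (Fin n) := ⟨a, b, hab⟩
  have hT : ∀ v ∈ stateSub P, translation _ v ∈ stateSub P := fun v hv =>
    stateField_mem_stateSub hP hrel hv (vacuum_mem_stateSub hrel) (-2)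
  have hU1 : ∀ i j, i ≠ j → U l n k (l - 1) i j ∈ stateSub P := by
    intro i j hij
    rw [U_pred k hl1]
    exact mem_stateSub (diagState_mem hl1 _) (diagState_mem_weight l n k _)
      ((rectW l n k).mem_modeSub.mpr (hE i j hij))
  have hE' : ∀ i j, U l n k (l - 1) i j ∈ stateSub P → ∀ v ∈ stateSub P, ∀ m,
      ((leviCurrents l n k).diag (List.finRange l) i j).1 m v ∈ stateSub P := by
    intro i j hij v hv m
    rw [← stateField_U_pred k hl1]
    exact stateField_mem_stateSub hP hrel hij hv m
  have hdiff : W l n k 2 a b - U l n k (l - 2) a b ∈ stateSub P := by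
    refine W_sub_U_mem hT 2 fun c hc => ?_
    rcases lt_trichotomy c l with h | rfl | h
    · obtain rfl : c = l - 1 := by omega
      exact hU1 a b hab
    · rw [U_top, kron_of_ne hab, zero_smul]
      exact Submodule.zero_mem _
    · rw [U_of_lt l n k a b h]
      exact Submodule.zero_mem _
  -- The given mode belongs to W^{(2)}_{ab}, while the bracket with H is computed on U_{l-2}. The
  -- difference of the two states already has all its modes in P, so one can pass from one to the
  -- other and back.
  have hU2 : U l n k (l - 2) a b ∈ stateSub P := by
    obtain ⟨hx, hx'⟩ := exists_of_mem_stateSub hdiff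
    set w : (affineVertexData (leviForm l n k)).closure (strongGenerators l n k) :=
      ⟨W l n k 2 a b, VertexData.subset_closure _ ⟨2, a, b, one_le_two, hl, rfl⟩⟩ with hw
    have hd := (rectW l n k).homModeSub_le hx'
    have hH : ∀ m, Matrix.single a a 1 - Matrix.single b b 1 ∈ glModes P hl1 m := by
      intro m
      have := commutator_mem_glModes hrel hl1 m 0 _ (hE a b hab m) _ (hE b a hab.symm 0)
      rwa [single_mul_sub_mul_single, add_zero] at this
    have hu := U_mem_modeSub hrel hl hab (hE a b hab) hH (w - ⟨_, hx⟩) (by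
      rw [Submodule.coe_sub, sub_sub_cancel]) (by
      have e : (rectW l n k).cmode (w - ⟨_, hx⟩) 1 =
          (rectW l n k).cmode w 1 - (rectW l n k).cmode ⟨_, hx⟩ 1 :=
        map_sub ((rectW l n k).cmodeLin 1) _ _
      rw [e]
      exact sub_mem hW ((rectW l n k).mem_modeSub.mp hd 1))
    have hw' : w ∈ (rectW l n k).modeSub P := by
      have := add_mem hu hd
      rwa [sub_add_cancel] at this
    have := sub_mem (mem_stateSub w.2 (W_mem l n k hl a b) hw') hdiff
    rwa [sub_sub_cancel] at this
  have hU2' : ∀ i j, i ≠ j → U l n k (l - 2) i j ∈ stateSub P := by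
    -- This map intertwines the adjoint action of gl_n with the zero modes of the diagonal currents,
    -- so the preimage of `stateSub P` is a subspace of matrices to which `single_mem_of_stable`
    -- applies.
    set f : Matrix (Fin n) (Fin n) ℂ →ₗ[ℂ] AffineVA (leviForm l n k) :=
      ∑ i, ∑ j, (Matrix.entryLinearMap ℂ ℂ i j).smulRight (U l n k (l - 2) i j) with hf
    have hfa : ∀ A, f A = ∑ i, ∑ j, A i j • U l n k (l - 2) i j := by
      intro A
      simp [hf]
    have hfs : ∀ i j, f (Matrix.single i j 1) = U l n k (l - 2) i j := by
      intro i j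
      rw [hfa, Finset.sum_eq_single i, Finset.sum_eq_single j]
      · rw [Matrix.single_apply_same, one_smul]
      · intro q _ hq
        rw [Matrix.single_apply_of_ne _ _ _ _ _ (fun h => hq h.2.symm), zero_smul]
      · simp
      · intro p _ hp
        refine Finset.sum_eq_zero fun q _ => ?_
        rw [Matrix.single_apply_of_ne _ _ _ _ _ (fun h => hp h.1.symm), zero_smul]
      · simp
    have hfc : ∀ i j A, f (Matrix.single i j 1 * A - A * Matrix.single i j 1) =
        ((leviCurrents l n k).diag (List.finRange l) i j).1 0 (f A) := by
      intro i j A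
      have hs : ∀ p q, f (Matrix.single i j 1 * Matrix.single p q 1 -
          Matrix.single p q 1 * Matrix.single i j 1) =
          ((leviCurrents l n k).diag (List.finRange l) i j).1 0 (f (Matrix.single p q 1)) := by
        intro p q
        rw [hfs, MatrixCurrents.diag_zero_miura_apply _ (List.nodup_finRange l), map_sub]
        congr 1
        · by_cases h : j = p
          · subst h
            rw [Matrix.single_mul_single_same, mul_one, hfs, kron_self, one_smul]
          · rw [Matrix.single_mul_single_of_ne _ _ _ _ h, kron_of_ne h, zero_smul, map_zero]
        · by_cases h : i = q
          · subst h
            rw [Matrix.single_mul_single_same, mul_one, hfs, kron_self, one_smul]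
          · rw [Matrix.single_mul_single_of_ne _ _ _ _ (Ne.symm h), kron_of_ne h, zero_smul,
              map_zero]
      rw [Matrix.matrix_eq_sum_single A]
      simp only [Finset.mul_sum, Finset.sum_mul, ← Finset.sum_sub_distrib, map_sum]
      refine Finset.sum_congr rfl fun p _ => Finset.sum_congr rfl fun q _ => ?_
      rw [show Matrix.single p q (A p q) = A p q • Matrix.single p q (1 : ℂ) by
        rw [Matrix.smul_single, smul_eq_mul, mul_one], mul_smul_comm, smul_mul_assoc, ← smul_sub,
        map_smul, map_smul, map_smul, hs]
    intro i j hij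
    have := single_mem_of_stable ((stateSub P).comap f) (fun i j hij A hA => by
      rw [Submodule.mem_comap, hfc]
      exact hE' i j (hU1 i j hij) _ hA 0) hab (by rwa [Submodule.mem_comap, hfs]) hij
    rwa [Submodule.mem_comap, hfs] at this
  obtain ⟨m, hm⟩ := Nat.exists_eq_add_of_le' hl
  have hU : ∀ c i j, U l n k c i j ∈ stateSub P := by
    rw [show l - 1 = m + 1 by omega] at hU1 hE'
    refine (leviCurrents l n k).miura_mem hα (List.nodup_finRange l) (l := m)
      (by rw [List.length_finRange, hm]) (vacuum_mem_stateSub hrel) hT hE' ?_ hU1 ?_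
    · intro i j hij v hv
      rw [← stateField_U_pred_pred k hl]
      exact stateField_mem_stateSub hP hrel (hU2' i j hij) hv 0
    · rwa [show l - 2 = m by omega] at hU2'
  refine eq_top_of_W_mem_stateSub hP hrel fun r i j => ?_
  have := add_mem (W_sub_U_mem hT r (i := i) (j := j) fun c _ => hU c i j) (hU (l - r) i j)
  rwa [sub_add_cancel] at this

end
end RectW

end

/-- For `l, n ≥ 2` and `α = k + (l - 1) n ≠ 0`, the current algebra of the rectangular `W`-algebra is
topologically generated by `W^{(1)}_{n,1}(1)`, `W^{(1)}_{1,n}(-1)`, `W^{(1)}_{i,i+1}(0)`,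
`W^{(1)}_{i+1,i}(0)` and `W^{(2)}_{i,i+1}(0)` for `1 ≤ i ≤ n - 1`. The indices are written in the
range `0, …, n - 1`. -/
theorem propositionA2 (l n : ℕ) (k : ℂ) (hl : 2 ≤ l) (hn : 2 ≤ n)
    (hα : k + ((l : ℂ) - 1) * (n : ℂ) ≠ 0) :
    Dense (Algebra.adjoin ℂ
      ({RectW.Wmode k 1 le_rfl (one_le_two.trans hl) (⟨n - 1, by omega⟩ : Fin n) ⟨0, by omega⟩ 1,
        RectW.Wmode k 1 le_rfl (one_le_two.trans hl) (⟨0, by omega⟩ : Fin n) ⟨n - 1, by omega⟩ (-1)} ∪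
      {x : RectW.CurrentW l n k | ∃ (i : ℕ) (hi : i + 1 < n),
        x = RectW.Wmode k 1 le_rfl (one_le_two.trans hl) ⟨i, by omega⟩ ⟨i + 1, hi⟩ 0 ∨
        x = RectW.Wmode k 1 le_rfl (one_le_two.trans hl) ⟨i + 1, hi⟩ ⟨i, by omega⟩ 0 ∨
        x = RectW.Wmode k 2 one_le_two hl ⟨i, by omega⟩ ⟨i + 1, hi⟩ 0}) :
      Set (RectW.CurrentW l n k)) := by
  set S : Set (RectW.CurrentW l n k) := _ ∪ _ with hS
  refine RectW.VertexData.dense_adjoin_of_closure_comap_eq_top _ S ?_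
  set P := ((Algebra.adjoin ℂ S).comap (RectW.rectW l n k).toCurrent).topologicalClosure with hP
  have hl1 := one_le_two.trans hl
  have hmem : ∀ x, (RectW.rectW l n k).toCurrent x ∈ Algebra.adjoin ℂ S → x ∈ P := fun x hx =>
    Subalgebra.le_topologicalClosure _ hx
  have hrel : (RectW.rectW l n k).relations ⊆ P := fun x hx => hmem x (by
    rw [RectW.VertexData.toCurrent_eq_zero _ hx]
    exact zero_mem _)
  have hgl : ∀ i j m, RectW.Wmode k 1 le_rfl hl1 i j m ∈ S →
      Matrix.single i j 1 ∈ RectW.glModes P hl1 m := by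
    intro i j m h
    have h' := Algebra.subset_adjoin (R := ℂ) h
    rw [RectW.Wmode, Nat.cast_one, add_sub_cancel_right] at h'
    rw [RectW.mem_glModes, show RectW.glState k hl1 (Matrix.single i j 1) =
      ⟨_, RectW.VertexData.subset_closure _ ⟨1, i, j, le_rfl, hl1, rfl⟩⟩ from
      Subtype.ext (RectW.glState_single hl1 i j)]
    exact hmem _ h'
  have h0 : ∀ i j : Fin n, i ≠ j → Matrix.single i j 1 ∈ RectW.glModes P hl1 0 := by
    refine fun i j hij => RectW.single_mem_of_simple _ (fun A hA B hB => ?_) (fun i hi =>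
      ⟨hgl _ _ _ (Or.inr ⟨i, hi, Or.inl rfl⟩), hgl _ _ _ (Or.inr ⟨i, hi, Or.inr (Or.inl rfl)⟩)⟩)
      hij
    have := RectW.commutator_mem_glModes hrel hl1 0 0 A hA B hB
    rwa [add_zero] at this
  have hne : (⟨n - 1, by omega⟩ : Fin n) ≠ ⟨0, by omega⟩ := by
    rw [ne_eq, Fin.mk.injEq]; omega
  have hE : ∀ i j : Fin n, i ≠ j → ∀ m, Matrix.single i j 1 ∈ RectW.glModes P hl1 m :=
    fun i j hij m => RectW.single_mem_of_loop (RectW.glModes P hl1)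
      (RectW.commutator_mem_glModes hrel hl1) h0 hne (hgl _ _ _ (Or.inl (Or.inl rfl))) hne.symm
      (hgl _ _ _ (Or.inl (Or.inr rfl))) hij m
  refine RectW.eq_top_of_glModes (Subalgebra.isClosed_topologicalClosure _) hrel hl hα hE
    (a := ⟨0, by omega⟩) (b := ⟨0 + 1, by omega⟩) (by rw [ne_eq, Fin.mk.injEq]; omega) (hmem _ ?_)
  have h := Algebra.subset_adjoin (R := ℂ)
    (show RectW.Wmode k 2 one_le_two hl ⟨0, by omega⟩ ⟨0 + 1, by omega⟩ 0 ∈ S from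
      Or.inr ⟨0, by omega, Or.inr (Or.inr rfl)⟩)
  -- In the conformal indexing, W^{(2)}(0) is the coefficient W^{(2)} t^1.
  rwa [RectW.Wmode, show (0 : ℤ) + (2 : ℕ) - 1 = 1 by norm_num] at h
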